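/- Let $G$ be a connected reductive group over $\mathbb Q$ with Lie algebra $\mathfrak g$, and let $K\subseteq G$ be an algebraic $\mathbb Q$-subgroup with Lie algebra $\mathfrak k$ such that $K(\mathbb R)$ is a maximal compact subgroup of $G(\mathbb R)$ and is Zariski dense in $K$. Write $K(\mathbb R)^0$ for the identity component of $K(\mathbb R)$, and $\pi_\circ(K)$ for the finite étale group scheme of connected components of $K$. A locally algebraic representation $V$ of $G$ (resp. a locally algebraic $(\mathfrak g,K)$-module $A$) over a field $E\subseteq\mathbb C$ is a finite-dimensional rational representation of $G$ (resp. a $(\mathfrak g,K)$-module) over $E$ together with a commuting $E$-linear action $\rho$ of $\pi_0(K(\mathbb R))$; the complexification $A_{\mathbb C}$ is the $(\mathfrak g_{\mathbb C},K(\mathbb R))$-module $\mathbb C\otimes_E A$ in which $k\in K(\mathbb R)$ acts by $v\mapsto \rho(k)(k\cdot v)$. For a $\mathbb Q$-rational character $\chi\colon\pi_\circ(K)\to\mathbb G_m$, twisting $V$ or $A$ by $\chi$ means multiplying $\rho$ by the character that $\chi$ induces on $\pi_0(K(\mathbb R))$, leaving the rest unchanged. Let $E\subseteq \mathbb C$ be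 a number field (for example $E=\mathbb Q(A)$) and let $(A,V)$ be a pair over $E$ representing a cohomological type, with $A$ absolutely irreducible. That is: $V$ is an absolutely irreducible locally algebraic representation of $G$; $A$ is an absolutely irreducible locally algebraic $(\mathfrak g,K)$-module on which $\pi_0(K(\mathbb R))$ acts by the same scalars as on $V$; for some $\theta$-stable parabolic subalgebra $\mathfrak q=\mathfrak l+\mathfrak u$ of $\mathfrak g_{\mathbb C}$, with Levi subgroup $L$ and opposite $\bar{\mathfrak q}=\mathfrak l+\bar{\mathfrak u}$, the space $H^0(\bar{\mathfrak u},V_{\mathbb C})$ is one-dimensional and the $(\mathfrak g_{\mathbb C},K_{\mathbb C})$-module $\mathbb C\otimes_E A$ is isomorphic to the cohomologically induced module $$A_{\mathfrak q}(\lambda)=R^{S} I^{\mathfrak g_{\mathbb C},K_{\mathbb C}}_{\mathfrak q,L\cap K_{\mathbb C}}\bigl(\lambda\otimes\textstyle\bigwedge^{\rm top}\mathfrak g_{\mathbb C}/\bar{\mathfrak q}\bigr),\qquad \lambda=H^0(\bar{\mathfrak u},V_{\mathbb C})^\vee,\quad S=\dim(\mathfrak u\cap\mathfrak k_{\mathbb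 C}),$$ where $I$ is the right adjoint of the forgetful functor and $V_{\mathbb C}$ is formed from the rational representation underlying $V$; and for every embedding $\sigma\colon E\to\mathbb C$ the complexification of $A$ along $\sigma$ is essentially unitarizable, i.e. infinitesimally unitarizable for ${}^0G$, the common kernel of the squares of the $\mathbb Q$-rational characters of $G$. Assume that $A_{\mathbb C}$ decomposes multiplicity-free as a $(\mathfrak g_{\mathbb C},K(\mathbb R)^0)$-module. Let $V'\not\cong V$ be an admissible weight of $A$, i.e. the twist of $V$ by a $\mathbb Q$-rational character $\chi$ of $\pi_\circ(K)$, let $A'$ be the twist of $A$ by $\chi$, and assume that $A_{\mathbb C}\cong A'_{\mathbb C}$, i.e. that $(A',V')$ represents the same cohomological type. Put $\widetilde K=\ker\chi\subseteq K$. For a field extension $E'/E$ and a $(\mathfrak h,K)$-module $M$ over $E'$ (with $\mathfrak h=\mathfrak g$ or $\mathfrak k$), a $\chi$-twisted linear isomorphism of $M$ is an $\mathfrak h$-linear isomorphism $\widetilde\psi\colon M\to M$ with $\widetilde\psi(\chi(k)\,k\,m)=k\,\widetilde\psi(m)$, i.e. an isomorphism $M\otimes\chi\to M$. Then for each field extension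 $E'/E$ the following are equivalent: (a) As a $(\mathfrak g_{E'},\widetilde K_{E'})$-module, $A_{E'}=E'\otimes_E A$ is reducible. (b) As a $(\mathfrak g_{E'},\widetilde K_{E'})$-module, $A_{E'}$ decomposes into a direct sum of two non-isomorphic absolutely irreducible modules. (c) For any $\chi$-twisted linear isomorphism $\widetilde\psi$ of $A_{E'}$ we have $\widetilde\psi^2=\widetilde\alpha^2\cdot\mathbf 1_{A_{E'}}$ for some $\widetilde\alpha\in E'$. (d) For any $\chi$-twisted linear isomorphism $\widetilde\psi$ of $A_{E'}$ there is $\widetilde\alpha\in E'$ such that $\widetilde\psi$ acts by one of the scalars $\pm\widetilde\alpha$ on each irreducible $(\mathfrak g_{E'},\widetilde K_{E'})$-submodule of $A_{E'}$. Moreover, let $B\subseteq A$ be the bottom layer, i.e. the $K$-submodule over $E$ for which $\mathbb C\otimes_E B$ is the minimal $K(\mathbb R)$-type of $A_{\mathbb C}$ (the irreducible $K$-submodule whose Vogan norm is strictly smaller than that of every other irreducible $K$-submodule). Then (a)–(d) are equivalent to each of the following: (a') As a $(\mathfrak k_{E'},\widetilde K_{E'})$-module, $B_{E'}$ is reducible.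 (b') As a $(\mathfrak k_{E'},\widetilde K_{E'})$-module, $B_{E'}$ decomposes into a direct sum of two non-isomorphic absolutely irreducible modules. (c') For any $\chi$-twisted linear isomorphism $\widetilde\psi^K$ of $B_{E'}$ we have $(\widetilde\psi^K)^2=\widetilde\alpha^2\cdot\mathbf 1_{B_{E'}}$ for some $\widetilde\alpha\in E'$. (d') For any $\chi$-twisted linear isomorphism $\widetilde\psi^K$ of $B_{E'}$ there is $\widetilde\alpha\in E'$ such that $\widetilde\psi^K$ acts by one of the scalars $\pm\widetilde\alpha$ on each irreducible $(\mathfrak k_{E'},\widetilde K_{E'})$-submodule of $B_{E'}$. -/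

import Mathlib

open scoped TensorProduct

noncomputable section

namespace LocAlg

universe u v w

attribute [local instance] LieRing.ofAssociativeRing

/- ## Linear algebraic groups over the rationals, given by their complex points -/

/-- Coordinates on `GL n`: the entries of a matrix (`Sum.inl`) and of its inverse (`Sum.inr`). -/
abbrev Coord (n : ℕ) : Type := (Fin n × Fin n) ⊕ (Fin n × Fin n)

/-- Complex square matrices. -/
abbrev MatC (n : ℕ) : Type := Matrix (Fin n) (Fin n) ℂ

/-- Rational square matrices. -/
abbrev MatQ (n : ℕ) : Type := Matrix (Fin n) (Fin n) ℚ

/-- The complex general linear group. -/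
abbrev GLC (n : ℕ) : Type := Matrix.GeneralLinearGroup (Fin n) ℂ

/-- The real general linear group. -/
abbrev GLR (n : ℕ) : Type := Matrix.GeneralLinearGroup (Fin n) ℝ

/-- The coordinates of an invertible matrix. -/
def coords {n : ℕ} (g : GLC n) : Coord n → ℂ :=
  Sum.elim (fun p => (g : MatC n) p.1 p.2) (fun p => ((g⁻¹ : GLC n) : MatC n) p.1 p.2)

/-- `H` is (the group of complex points of) an algebraic subgroup of `GL n` defined over `F`,
for a subfield `F` of `ℂ`: it is cut out by polynomials with coefficients in `F`. -/
def IsAlgebraicOver {n : ℕ} (F : Type*) [Field F] [Algebra F ℂ] (H : Subgroup (GLC n)) : Prop :=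
  ∃ S : Set (MvPolynomial (Coord n) F),
    ∀ g : GLC n, g ∈ H ↔ ∀ p ∈ S, MvPolynomial.aeval (coords g) p = 0

/-- The rational coordinate ring `O(H)` of an algebraic group over `ℚ`, realized as the ring of
those functions on complex points that are given by rational polynomials in the coordinates. -/
def coordRing {n : ℕ} (H : Subgroup (GLC n)) : Subalgebra ℚ (H → ℂ) :=
  (MvPolynomial.aeval (R := ℚ) (fun (s : Coord n) (h : H) => coords (h : GLC n) s)).range

/-- Restriction of functions `O(H) → O(H')` for a subgroup `H'` of `H`. -/
def coordRes {n : ℕ} {H' H : Subgroup (GLC n)} (h : H' ≤ H) : coordRing H →ₐ[ℚ] coordRing H' where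
  toFun f := ⟨fun x => (f : H → ℂ) ⟨x, h x.2⟩, by
    obtain ⟨p, hp⟩ := f.2
    refine ⟨p, ?_⟩
    have hp' : (MvPolynomial.aeval (R := ℚ)
        (fun (s : Coord n) (h : H) => coords (h : GLC n) s)) p = (f : H → ℂ) := hp
    rw [← hp']
    let r : (H → ℂ) →ₐ[ℚ] (H' → ℂ) :=
      { toFun := fun f x => f ⟨x, h x.2⟩
        map_one' := rfl
        map_mul' := fun _ _ => rfl
        map_zero' := rfl
        map_add' := fun _ _ => rfl
        commutes' := fun _ => rfl }
    have key : (MvPolynomial.aeval (R := ℚ)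
        (fun (s : Coord n) (h : H') => coords (h : GLC n) s)) =
        r.comp (MvPolynomial.aeval (R := ℚ)
          (fun (s : Coord n) (h : H) => coords (h : GLC n) s)) := by
      apply MvPolynomial.algHom_ext
      intro i
      rw [AlgHom.comp_apply, MvPolynomial.aeval_X, MvPolynomial.aeval_X]
      rfl
    exact congrArg (fun f => f p) key⟩
  map_one' := rfl
  map_mul' _ _ := rfl
  map_zero' := rfl
  map_add' _ _ := rfl
  commutes' _ := rfl

/-- The left invariant derivation of the polynomial ring in the coordinates of `GL n` attached to
a matrix `X`: on functions it is `(D f)(g) = d/dt f (g exp (t X))` at `t = 0`. -/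
def leftInvDer {n : ℕ} (X : MatC n) :
    Derivation ℂ (MvPolynomial (Coord n) ℂ) (MvPolynomial (Coord n) ℂ) :=
  MvPolynomial.mkDerivation ℂ (fun s : Coord n => Sum.elim
    (fun p : Fin n × Fin n => ∑ k : Fin n,
      MvPolynomial.C (X k p.2) * (MvPolynomial.X (Sum.inl (p.1, k)) : MvPolynomial (Coord n) ℂ))
    (fun p : Fin n × Fin n => - ∑ k : Fin n,
      MvPolynomial.C (X p.1 k) * (MvPolynomial.X (Sum.inr (k, p.2)) : MvPolynomial (Coord n) ℂ)) s)

/-- The derivative at the identity of a polynomial function in direction `X`. -/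
def derivAtOne {n : ℕ} (X : MatC n) (p : MvPolynomial (Coord n) ℂ) : ℂ :=
  MvPolynomial.aeval (coords (1 : GLC n)) (leftInvDer X p)

theorem leftInvDer_inl {n : ℕ} (X : MatC n) (p : Fin n × Fin n) :
    leftInvDer X (MvPolynomial.X (Sum.inl p)) =
      ∑ k, MvPolynomial.C (X k p.2) * MvPolynomial.X (Sum.inl (p.1, k)) :=
  MvPolynomial.mkDerivation_X _ _ _

theorem leftInvDer_inr {n : ℕ} (X : MatC n) (p : Fin n × Fin n) :
    leftInvDer X (MvPolynomial.X (Sum.inr p)) =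
      - ∑ k, MvPolynomial.C (X p.1 k) * MvPolynomial.X (Sum.inr (k, p.2)) :=
  MvPolynomial.mkDerivation_X _ _ _

theorem leftInvDer_C {n : ℕ} (X : MatC n) (c : ℂ) (q : MvPolynomial (Coord n) ℂ) :
    leftInvDer X (MvPolynomial.C c * q) = MvPolynomial.C c * leftInvDer X q := by
  rw [← MvPolynomial.smul_eq_C_mul, Derivation.map_smul, MvPolynomial.smul_eq_C_mul]

theorem leftInvDer_add {n : ℕ} (X Y : MatC n) :
    leftInvDer (X + Y) = leftInvDer X + leftInvDer Y := by
  apply MvPolynomial.derivation_ext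
  rintro (p | p)
  · rw [Derivation.add_apply, leftInvDer_inl, leftInvDer_inl, leftInvDer_inl,
      ← Finset.sum_add_distrib]
    refine Finset.sum_congr rfl fun k _ => ?_
    rw [Matrix.add_apply, MvPolynomial.C_add, add_mul]
  · rw [Derivation.add_apply, leftInvDer_inr, leftInvDer_inr, leftInvDer_inr, ← neg_add,
      ← Finset.sum_add_distrib]
    refine congrArg _ (Finset.sum_congr rfl fun k _ => ?_)
    rw [Matrix.add_apply, MvPolynomial.C_add, add_mul]

theorem leftInvDer_smul {n : ℕ} (c : ℂ) (X : MatC n) :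
    leftInvDer (c • X) = c • leftInvDer X := by
  apply MvPolynomial.derivation_ext
  rintro (p | p)
  · rw [Derivation.smul_apply, leftInvDer_inl, leftInvDer_inl, Finset.smul_sum]
    refine Finset.sum_congr rfl fun k _ => ?_
    rw [Matrix.smul_apply, smul_eq_mul, MvPolynomial.C_mul, MvPolynomial.smul_eq_C_mul, mul_assoc]
  · rw [Derivation.smul_apply, leftInvDer_inr, leftInvDer_inr, smul_neg, Finset.smul_sum]
    refine congrArg _ (Finset.sum_congr rfl fun k _ => ?_)
    rw [Matrix.smul_apply, smul_eq_mul, MvPolynomial.C_mul, MvPolynomial.smul_eq_C_mul, mul_assoc]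

theorem leftInvDer_comp_inl {n : ℕ} (X Y : MatC n) (p : Fin n × Fin n) :
    leftInvDer X (leftInvDer Y (MvPolynomial.X (Sum.inl p))) =
      ∑ k, MvPolynomial.C ((X * Y) k p.2) * MvPolynomial.X (Sum.inl (p.1, k)) := by
  rw [leftInvDer_inl, map_sum]
  simp only [leftInvDer_C, leftInvDer_inl, Finset.mul_sum, Matrix.mul_apply, map_sum,
    Finset.sum_mul, MvPolynomial.C_mul]
  rw [Finset.sum_comm]
  refine Finset.sum_congr rfl fun k _ => Finset.sum_congr rfl fun l _ => ?_
  ring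

theorem leftInvDer_comp_inr {n : ℕ} (X Y : MatC n) (p : Fin n × Fin n) :
    leftInvDer X (leftInvDer Y (MvPolynomial.X (Sum.inr p))) =
      ∑ k, MvPolynomial.C ((Y * X) p.1 k) * MvPolynomial.X (Sum.inr (k, p.2)) := by
  rw [leftInvDer_inr, map_neg, map_sum]
  simp only [leftInvDer_C, leftInvDer_inr, Finset.mul_sum, Matrix.mul_apply, map_sum,
    Finset.sum_mul, MvPolynomial.C_mul, mul_neg, Finset.sum_neg_distrib, neg_neg]
  rw [Finset.sum_comm]
  refine Finset.sum_congr rfl fun k _ => Finset.sum_congr rfl fun l _ => ?_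
  ring

theorem leftInvDer_lie {n : ℕ} (X Y : MatC n) :
    leftInvDer ⁅X, Y⁆ = ⁅leftInvDer X, leftInvDer Y⁆ := by
  apply MvPolynomial.derivation_ext
  rintro (p | p)
  · rw [Derivation.commutator_apply, leftInvDer_comp_inl, leftInvDer_comp_inl, leftInvDer_inl,
      ← Finset.sum_sub_distrib]
    refine Finset.sum_congr rfl fun k _ => ?_
    rw [Ring.lie_def, Matrix.sub_apply, MvPolynomial.C_sub, sub_mul]
  · rw [Derivation.commutator_apply, leftInvDer_comp_inr, leftInvDer_comp_inr, leftInvDer_inr,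
      ← Finset.sum_sub_distrib, ← Finset.sum_neg_distrib]
    refine Finset.sum_congr rfl fun k _ => ?_
    rw [Ring.lie_def, Matrix.sub_apply, MvPolynomial.C_sub, sub_mul, neg_sub]

/-- The complex Lie algebra of an algebraic subgroup `H` of `GL n`: those matrices whose left
invariant derivation preserves the vanishing ideal of `H`. -/
def lieAlg {n : ℕ} (H : Subgroup (GLC n)) : LieSubalgebra ℂ (MatC n) where
  carrier := {X | ∀ p : MvPolynomial (Coord n) ℂ,
    (∀ h ∈ H, MvPolynomial.aeval (coords h) p = 0) →
      ∀ h ∈ H, MvPolynomial.aeval (coords h) (leftInvDer X p) = 0}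
  add_mem' := by
    intro X Y hX hY p hp h hh
    rw [leftInvDer_add, Derivation.add_apply, map_add, hX p hp h hh, hY p hp h hh, add_zero]
  zero_mem' := by
    intro p hp h hh
    have : leftInvDer (0 : MatC n) = 0 := by
      have := leftInvDer_smul (0 : ℂ) (0 : MatC n)
      simpa using this
    simp [this]
  smul_mem' := by
    intro c X hX p hp h hh
    rw [leftInvDer_smul, Derivation.smul_apply, map_smul, hX p hp h hh, smul_zero]
  lie_mem' := by
    intro X Y hX hY p hp h hh
    rw [leftInvDer_lie, Derivation.commutator_apply, map_sub, hX _ (hY p hp) h hh,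
      hY _ (hX p hp) h hh, sub_zero]

/-- The complex matrix with the same entries as a rational matrix. -/
def ratToC {n : ℕ} (X : MatQ n) : MatC n := X.map (algebraMap ℚ ℂ)

/-- The rational Lie algebra of an algebraic group over `ℚ`. -/
def lieAlgQ {n : ℕ} (H : Subgroup (GLC n)) : LieSubalgebra ℚ (MatQ n) where
  carrier := {X | ratToC X ∈ lieAlg H}
  add_mem' := by
    intro X Y hX hY
    have : ratToC (X + Y) = ratToC X + ratToC Y := by
      ext i j; simp [ratToC]
    simpa [this] using (lieAlg H).add_mem hX hY
  zero_mem' := by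
    have : ratToC (0 : MatQ n) = 0 := by
      ext i j; simp [ratToC]
    simp [this]
  smul_mem' := by
    intro c X hX
    have : ratToC (c • X) = (c : ℂ) • ratToC X := by
      ext i j; simp [ratToC]
    simpa [this] using (lieAlg H).smul_mem (c : ℂ) hX
  lie_mem' := by
    intro X Y hX hY
    have : ratToC ⁅X, Y⁆ = ⁅ratToC X, ratToC Y⁆ := by
      simp only [ratToC, Ring.lie_def]
      rw [Matrix.map_sub _ (map_sub _), Matrix.map_mul, Matrix.map_mul]
    simpa [this] using (lieAlg H).lie_mem hX hY

/-- The group `H(ℝ)` of real points, with its topology as a subgroup of `GL n ℝ`. -/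
def realPts {n : ℕ} (H : Subgroup (GLC n)) : Subgroup (GLR n) :=
  H.comap (Matrix.GeneralLinearGroup.map Complex.ofRealHom)

/-- A real point as a complex point. -/
def realToC {n : ℕ} {H : Subgroup (GLC n)} (g : realPts H) : H :=
  ⟨Matrix.GeneralLinearGroup.map Complex.ofRealHom (g : GLR n), g.2⟩

/-- The identity component `H(ℝ)⁰` of the group of real points, as a subgroup of `GL n ℂ`. -/
def realIdComp {n : ℕ} (H : Subgroup (GLC n)) : Subgroup (GLC n) :=
  ((Subgroup.connectedComponentOfOne (realPts H)).map (realPts H).subtype).map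
    (Matrix.GeneralLinearGroup.map Complex.ofRealHom)

theorem realIdComp_le {n : ℕ} (H : Subgroup (GLC n)) : realIdComp H ≤ H := by
  rintro _ ⟨_, ⟨g, -, rfl⟩, rfl⟩
  exact g.2

/-- `G` is a connected reductive group over `ℚ`: it is defined over `ℚ`, connected, and has trivial
unipotent radical (no nontrivial closed connected normal subgroup of unipotent matrices). -/
structure IsConnectedReductive {n : ℕ} (G : Subgroup (GLC n)) : Prop where
  algebraic : IsAlgebraicOver ℚ G
  connected : IsConnected (G : Set (GLC n))
  reductive : ∀ U : Subgroup (GLC n), U ≤ G → IsAlgebraicOver ℂ U →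
    IsConnected (U : Set (GLC n)) → (∀ g ∈ G, ∀ x ∈ U, g * x * g⁻¹ ∈ U) →
    (∀ x ∈ U, IsNilpotent ((x : MatC n) - 1)) → U = ⊥

/-- `K` is an algebraic subgroup of `G` over `ℚ` such that `K(ℝ)` is a maximal compact subgroup of
`G(ℝ)` and `K` is the Zariski closure of `K(ℝ)`. -/
structure IsMaximalCompactModel {n : ℕ} (G K : Subgroup (GLC n)) : Prop where
  algebraic : IsAlgebraicOver ℚ K
  le : K ≤ G
  compact : IsCompact (realPts K : Set (GLR n))
  maximal : ∀ C : Subgroup (GLR n), C ≤ realPts G → IsCompact (C : Set (GLR n)) →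
    realPts K ≤ C → C = realPts K
  dense : ∀ p : MvPolynomial (Coord n) ℂ,
    (∀ k : realPts K, MvPolynomial.aeval (coords (realToC k : GLC n)) p = 0) →
      ∀ k ∈ K, MvPolynomial.aeval (coords k) p = 0

/-- A `ℚ`-rational character `π₀(K) → 𝔾ₘ` of the étale group scheme of connected components of
`K`: a rational character of `K` that is trivial on the identity component. -/
structure CompChar {n : ℕ} (K : Subgroup (GLC n)) where
  hom : K →* ℂ
  mem : (hom : K → ℂ) ∈ coordRing K
  trivial : ∀ k ∈ Subgroup.connectedComponentOfOne K, hom k = 1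

/-- The character as an element of the coordinate ring. -/
def CompChar.fn {n : ℕ} {K : Subgroup (GLC n)} (χ : CompChar K) : coordRing K := ⟨χ.hom, χ.mem⟩

/-- The kernel of `χ`, an algebraic subgroup of `K` over `ℚ`. -/
def CompChar.ker {n : ℕ} {K : Subgroup (GLC n)} (χ : CompChar K) : Subgroup (GLC n) :=
  χ.hom.ker.map K.subtype

theorem CompChar.ker_le {n : ℕ} {K : Subgroup (GLC n)} (χ : CompChar K) : χ.ker ≤ K :=
  Subgroup.map_subtype_le _

/- ## Actions of a pair (rational Lie algebra, algebraic group over `ℚ`) over arbitrary fields -/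

/-- The data of an action of the pair `(𝔥, H)` over a field `F` of characteristic `0` on the
`F`-vector space `A`: an `F`-linear action of the rational Lie algebra `𝔥` (equivalently of
`𝔥_F`), and a coaction of `O(H)` (equivalently of `O(H_F)`). The axioms of modules over a pair are
imposed in `IsGKModule`. -/
structure PairAction {n : ℕ} (𝔥 : LieSubalgebra ℚ (MatQ n)) (H : Subgroup (GLC n))
    (F : Type u) [Field F] [CharZero F] (A : Type v) [AddCommGroup A] [Module F A] [Module ℚ A] where
  lie : 𝔥 →ₗ[ℚ] Module.End F A
  coact : A →ₗ[F] A ⊗[ℚ] coordRing H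

section Pair

variable {n : ℕ} {𝔥 : LieSubalgebra ℚ (MatQ n)} {H : Subgroup (GLC n)}
  {F : Type u} [Field F] [CharZero F]
  {A : Type v} [AddCommGroup A] [Module F A] [Module ℚ A]
  {B : Type w} [AddCommGroup B] [Module F B] [Module ℚ B]

/-- Extension of scalars along a field extension `F'/F`. -/
def PairAction.baseChange (a : PairAction 𝔥 H F A) (F' : Type w) [Field F'] [CharZero F']
    [Algebra F F'] : PairAction 𝔥 H F' (F' ⊗[F] A) where
  lie := ((LinearMap.baseChangeHom F F' A A).restrictScalars ℚ).comp a.lie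
  coact := (TensorProduct.AlgebraTensorModule.assoc ℚ F F' F' A (coordRing H)).symm.toLinearMap.comp
    (a.coact.baseChange F')

/-- Restriction to an algebraic subgroup. -/
def PairAction.restrict (a : PairAction 𝔥 H F A) {H' : Subgroup (GLC n)} (h : H' ≤ H) :
    PairAction 𝔥 H' F A where
  lie := a.lie
  coact := (TensorProduct.AlgebraTensorModule.map (LinearMap.id : A →ₗ[F] A)
    (coordRes h).toLinearMap).comp a.coact

/-- The action of a complex point of `H` on a complex module. -/
def PairAction.act {A : Type v} [AddCommGroup A] [Module ℂ A] [Module ℚ A]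
    (a : PairAction 𝔥 H ℂ A) (h : H) : A →ₗ[ℂ] A :=
  (TensorProduct.AlgebraTensorModule.lift
    ({ toFun := fun v =>
        { toFun := fun f => (f : H → ℂ) h • v
          map_add' := fun f g => by simp [add_smul]
          map_smul' := fun c f => by
            simp only [SetLike.val_smul, Pi.smul_apply, RingHom.id_apply, smul_assoc] }
       map_add' := fun v w => by ext f; simp
       map_smul' := fun c v => by
        ext f
        simp only [LinearMap.coe_mk, AddHom.coe_mk, RingHom.id_apply, LinearMap.smul_apply]
        exact smul_comm _ _ _ } : A →ₗ[ℂ] coordRing H →ₗ[ℚ] A)).comp a.coact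

/-- Linear maps that commute with both actions. -/
def IsPairHom (a : PairAction 𝔥 H F A) (b : PairAction 𝔥 H F B) (f : A →ₗ[F] B) : Prop :=
  (∀ X x, f (a.lie X x) = b.lie X (f x)) ∧
  ∀ x, b.coact (f x) = TensorProduct.AlgebraTensorModule.map f LinearMap.id (a.coact x)

/-- Linear maps `f` that are `χ`-twisted linear: `f` commutes with the Lie algebra, and
`f (χ(k) k x) = k f (x)`, i.e. `f` is a homomorphism `A ⊗ χ → A`. -/
def IsTwistedHom (a : PairAction 𝔥 H F A) (χ : CompChar H) (f : A →ₗ[F] A) : Prop :=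
  (∀ X x, f (a.lie X x) = a.lie X (f x)) ∧
  ∀ x, a.coact (f x) =
    TensorProduct.AlgebraTensorModule.map f (LinearMap.mulLeft ℚ χ.fn) (a.coact x)

/-- `W` is a submodule for both actions. -/
def IsStable (a : PairAction 𝔥 H F A) (W : Submodule F A) : Prop :=
  (∀ X, ∀ x ∈ W, a.lie X x ∈ W) ∧
  ∀ x ∈ W, a.coact x ∈ LinearMap.range
    (TensorProduct.AlgebraTensorModule.map W.subtype (LinearMap.id : coordRing H →ₗ[ℚ] coordRing H))

/-- `W` is an irreducible submodule. -/
def IsIrredSub (a : PairAction 𝔥 H F A) (W : Submodule F A) : Prop :=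
  IsStable a W ∧ W ≠ ⊥ ∧ ∀ U : Submodule F A, IsStable a U → U ≤ W → U = ⊥ ∨ U = W

/-- The module has a proper nonzero submodule. -/
def IsReducible (a : PairAction 𝔥 H F A) : Prop :=
  ∃ W : Submodule F A, IsStable a W ∧ W ≠ ⊥ ∧ W ≠ ⊤

/-- `W` is an absolutely irreducible submodule: it remains irreducible over all extension
fields. -/
def IsAbsIrredSub (a : PairAction 𝔥 H F A) (W : Submodule F A) : Prop :=
  ∀ (L : Type u) [Field L] [CharZero L] [Algebra F L],
    IsIrredSub (a.baseChange L) (W.baseChange L)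

/-- Two submodules are isomorphic as modules over the pair. -/
def SubIso (a : PairAction 𝔥 H F A) (W₁ W₂ : Submodule F A) : Prop :=
  ∃ φ : W₁ ≃ₗ[F] W₂,
    (∀ X, ∀ x y : W₁, (y : A) = a.lie X x → (φ y : A) = a.lie X (φ x)) ∧
    ∀ (x : W₁) (t : W₁ ⊗[ℚ] coordRing H),
      TensorProduct.AlgebraTensorModule.map W₁.subtype LinearMap.id t = a.coact x →
      TensorProduct.AlgebraTensorModule.map (W₂.subtype ∘ₗ φ.toLinearMap) LinearMap.id t =
        a.coact (φ x)

/-- The module is a direct sum of pairwise non-isomorphic irreducible submodules. -/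
def IsMultiplicityFree (a : PairAction 𝔥 H F A) : Prop :=
  ∃ (ι : Type v) (W : ι → Submodule F A), (∀ i, IsIrredSub a (W i)) ∧ iSupIndep W ∧
    ⨆ i, W i = ⊤ ∧ ∀ i j, SubIso a (W i) (W j) → i = j

end Pair

/- ## Modules over complex pairs and cohomological induction -/

/-- Modules over the complex pair `(h, M)`, where `h` is a complex Lie algebra of matrices and `M`
an algebraic group of matrices: the action of `M` is algebraic, its differential is the action of
`Lie M` (where this lies in `h`), and the two actions are compatible with the adjoint action. -/
structure HCMod {n : ℕ} (h : LieSubalgebra ℂ (MatC n)) (M : Subgroup (GLC n)) where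
  carrier : Type
  [addCommGroup : AddCommGroup carrier]
  [module : Module ℂ carrier]
  lie : h →ₗ⁅ℂ⁆ Module.End ℂ carrier
  grp : M →* Module.End ℂ carrier
  algebraic : ∀ w : carrier, ∃ (N : ℕ) (p : Fin N → MvPolynomial (Coord n) ℂ)
    (y : Fin N → carrier),
    (∀ m : M, grp m w = ∑ i, MvPolynomial.aeval (coords (m : GLC n)) (p i) • y i) ∧
    ∀ X : h, (X : MatC n) ∈ lieAlg M → lie X w = ∑ i, derivAtOne (X : MatC n) (p i) • y i
  compat : ∀ (m : M) (X Y : h),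
    (Y : MatC n) = ((m : GLC n) : MatC n) * (X : MatC n) * (((m : GLC n)⁻¹ : GLC n) : MatC n) →
    ∀ w, grp m (lie X w) = lie Y (grp m w)

attribute [instance] HCMod.addCommGroup HCMod.module

section HC

variable {n : ℕ} {h h' : LieSubalgebra ℂ (MatC n)} {M M' : Subgroup (GLC n)}

/-- `f` commutes with the actions of all elements common to both pairs. For equal pairs these are
the homomorphisms of modules; for `h ≤ h'`, `M ≤ M'` these are the `(h, M)`-homomorphisms from an
`(h', M')`-module to an `(h, M)`-module. -/
def HCHom (X : HCMod h' M') (Z : HCMod h M) (f : X.carrier →ₗ[ℂ] Z.carrier) : Prop :=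
  (∀ (Y' : h') (Y : h), (Y' : MatC n) = Y → ∀ w, f (X.lie Y' w) = Z.lie Y (f w)) ∧
  ∀ (m' : M') (m : M), (m' : GLC n) = m → ∀ w, f (X.grp m' w) = Z.grp m (f w)

/-- Injective objects of the category of `(h, M)`-modules. -/
def HCInjective (J : HCMod h M) : Prop :=
  ∀ (U W : HCMod h M) (i : U.carrier →ₗ[ℂ] W.carrier) (f : U.carrier →ₗ[ℂ] J.carrier),
    HCHom U W i → Function.Injective i → HCHom U J f →
    ∃ F : W.carrier →ₗ[ℂ] J.carrier, HCHom W J F ∧ F ∘ₗ i = f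

/-- `ev : X → J` exhibits `X` as the value at `J` of the right adjoint `I` of the forgetful
functor from `(h', M')`-modules to `(h, M)`-modules. -/
def IsCofree (X : HCMod h' M') (J : HCMod h M) (ev : X.carrier →ₗ[ℂ] J.carrier) : Prop :=
  HCHom X J ev ∧ ∀ (W : HCMod h' M') (f : W.carrier →ₗ[ℂ] J.carrier), HCHom W J f →
    ∃! F : W.carrier →ₗ[ℂ] X.carrier, HCHom W X F ∧ ev ∘ₗ F = f

/-- Coboundaries in degree `i` of a sequence of maps. -/
def coboundaries (X : ℕ → HCMod h' M')
    (δ : ∀ i, (X i).carrier →ₗ[ℂ] (X (i + 1)).carrier) : ∀ i, Submodule ℂ (X i).carrier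
  | 0 => ⊥
  | i + 1 => LinearMap.range (δ i)

/-- `Y` is the value at `Z` of the `u`-th right derived functor of the right adjoint `I` of the
forgetful functor from `(h', M')`-modules to `(h, M)`-modules: for some injective resolution
`Z → J⁰ → J¹ → ⋯`, the module `Y` is the `u`-th cohomology of `I(J⁰) → I(J¹) → ⋯`. -/
def IsDerivedInduction (Z : HCMod h M) (u : ℕ) (Y : HCMod h' M') : Prop :=
  ∃ (J : ℕ → HCMod h M) (η : Z.carrier →ₗ[ℂ] (J 0).carrier)
    (d : ∀ i, (J i).carrier →ₗ[ℂ] (J (i + 1)).carrier)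
    (X : ℕ → HCMod h' M') (ev : ∀ i, (X i).carrier →ₗ[ℂ] (J i).carrier)
    (δ : ∀ i, (X i).carrier →ₗ[ℂ] (X (i + 1)).carrier)
    (π : LinearMap.ker (δ u) →ₗ[ℂ] Y.carrier),
    HCHom Z (J 0) η ∧ (∀ i, HCHom (J i) (J (i + 1)) (d i)) ∧ (∀ i, HCInjective (J i)) ∧
    Function.Injective η ∧ LinearMap.range η = LinearMap.ker (d 0) ∧
    (∀ i, LinearMap.range (d i) = LinearMap.ker (d (i + 1))) ∧
    (∀ i, IsCofree (X i) (J i) (ev i)) ∧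
    (∀ i, HCHom (X i) (X (i + 1)) (δ i) ∧ ev (i + 1) ∘ₗ δ i = d i ∘ₗ ev i) ∧
    Function.Surjective π ∧
    (∀ z, π z = 0 ↔ (z : (X u).carrier) ∈ coboundaries X δ u) ∧
    (∀ (T : h') (z z' : LinearMap.ker (δ u)), (z' : (X u).carrier) = (X u).lie T z →
      π z' = Y.lie T (π z)) ∧
    ∀ (m : M') (z z' : LinearMap.ker (δ u)), (z' : (X u).carrier) = (X u).grp m z →
      π z' = Y.grp m (π z)

end HC

section Parabolic

variable {n : ℕ}

/-- The span of the eigenvectors of `ad x` in the Lie algebra of `H` with positive real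
eigenvalue. -/
def posPart (H : Subgroup (GLC n)) (x : MatC n) : Submodule ℂ (MatC n) :=
  Submodule.span ℂ {Y | Y ∈ lieAlg H ∧ ∃ r : ℝ, 0 < r ∧ ⁅x, Y⁆ = (r : ℂ) • Y}

/-- The parabolic subalgebra attached to `x`: the sum of the eigenspaces of `ad x` in the Lie
algebra of `H` with nonnegative real eigenvalue (this sum is closed under the bracket). -/
def parabolic (H : Subgroup (GLC n)) (x : MatC n) : LieSubalgebra ℂ (MatC n) :=
  LieSubalgebra.lieSpan ℂ (MatC n) {Y | Y ∈ lieAlg H ∧ ∃ r : ℝ, 0 ≤ r ∧ ⁅x, Y⁆ = (r : ℂ) • Y}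

/-- The centralizer of the matrix `x` in `H`. -/
def centralizer (H : Subgroup (GLC n)) (x : MatC n) : Subgroup (GLC n) where
  carrier := {g | g ∈ H ∧ (g : MatC n) * x = x * (g : MatC n)}
  mul_mem' := by
    rintro a b ⟨ha, ha'⟩ ⟨hb, hb'⟩
    refine ⟨H.mul_mem ha hb, ?_⟩
    rw [Units.val_mul, mul_assoc, hb', ← mul_assoc, ha', mul_assoc]
  one_mem' := ⟨H.one_mem, by simp⟩
  inv_mem' := by
    rintro a ⟨ha, ha'⟩
    refine ⟨H.inv_mem ha, ?_⟩
    have : Commute (a : MatC n) x := ha'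
    exact this.units_inv_left

/-- `x` lies in `i 𝔨_ℝ`, where `𝔨_ℝ` is the Lie algebra of `K(ℝ)`. -/
def InImagCompact (K : Subgroup (GLC n)) (x : MatC n) : Prop :=
  ∃ y : Matrix (Fin n) (Fin n) ℝ, y.map Complex.ofRealHom ∈ lieAlg K ∧
    x = Complex.I • y.map Complex.ofRealHom

/-- `s` is the trace of `ad X` on the subspace `u`, which it preserves. -/
def IsAdTrace (u : Submodule ℂ (MatC n)) (X : MatC n) (s : ℂ) : Prop :=
  ∃ T : u →ₗ[ℂ] u, (∀ y : u, (T y : MatC n) = ⁅X, (y : MatC n)⁆) ∧ s = LinearMap.trace ℂ u T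

/-- `s` is the determinant of `Ad m` on the subspace `u`, which it preserves. -/
def IsAdDet (u : Submodule ℂ (MatC n)) (m : GLC n) (s : ℂ) : Prop :=
  ∃ T : u →ₗ[ℂ] u, (∀ y : u, (T y : MatC n) = (m : MatC n) * (y : MatC n) * ((m⁻¹ : GLC n) : MatC n))
    ∧ s = LinearMap.det T

/-- For `x` in `i 𝔨_ℝ` with attached `θ`-stable parabolic `𝔮 = 𝔩 + 𝔲` and `L` the centralizer of
`x`, the `(𝔮, L ∩ K)`-module `Z` is `λ ⊗ Λ^top (𝔤 / 𝔮⁻)`, where `λ` is the dual of the space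
`H⁰(𝔲⁻, V)`, assumed to be one-dimensional (spanned by `v₀`). Here `𝔲⁻` and `𝔮⁻` are the complex
conjugates (the opposites) of `𝔲` and `𝔮`, and `𝔤 / 𝔮⁻` is identified with `𝔲` as a module
over `(𝔩, L ∩ K)`; the nilradical `𝔲` acts trivially. -/
def IsInducingModule (G K : Subgroup (GLC n)) (x : MatC n) (V : HCMod (lieAlg G) G)
    (Z : HCMod (parabolic G x) (centralizer K x)) : Prop :=
  ∃ (v₀ : V.carrier) (z₀ : Z.carrier), v₀ ≠ 0 ∧ z₀ ≠ 0 ∧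
    (∀ v, (∀ Y : lieAlg G, (Y : MatC n) ∈ posPart G (-x) → V.lie Y v = 0) ↔
      v ∈ Submodule.span ℂ {v₀}) ∧
    (∀ z, z ∈ Submodule.span ℂ {z₀}) ∧
    (∀ Y : parabolic G x, (Y : MatC n) ∈ posPart G x → Z.lie Y z₀ = 0) ∧
    (∀ (Y : parabolic G x) (Y' : lieAlg G), (Y' : MatC n) = Y → ⁅x, (Y : MatC n)⁆ = 0 →
      ∀ c s : ℂ, V.lie Y' v₀ = c • v₀ → IsAdTrace (posPart G x) Y s →
        Z.lie Y z₀ = (-c + s) • z₀) ∧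
    (∀ (m : centralizer K x) (m' : G), (m' : GLC n) = m →
      ∀ c s : ℂ, V.grp m' v₀ = c • v₀ → IsAdDet (posPart G x) m s →
        Z.grp m z₀ = (c⁻¹ * s) • z₀)

/-- `Y` is the cohomologically induced standard module `A_𝔮(λ) = R^S I (λ ⊗ Λ^top (𝔤 / 𝔮⁻))`,
`S = dim (𝔲 ∩ 𝔨)`, for some `θ`-stable parabolic subalgebra `𝔮` of `𝔤_ℂ` and `λ` the dual
of `H⁰(𝔲⁻, V)`. -/
def IsStandardFor (G K : Subgroup (GLC n)) (V : HCMod (lieAlg G) G)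
    (Y : HCMod (lieAlg G) K) : Prop :=
  ∃ x : MatC n, InImagCompact K x ∧
    ∃ Z : HCMod (parabolic G x) (centralizer K x), IsInducingModule G K x V Z ∧
      IsDerivedInduction Z
        (Module.finrank ℂ ↥(posPart G x ⊓ (lieAlg K).toSubmodule)) Y

/-- An irreducible `K`-submodule. -/
def IsKType {h : LieSubalgebra ℂ (MatC n)} {K : Subgroup (GLC n)} (Y : HCMod h K)
    (C : Submodule ℂ Y.carrier) : Prop :=
  (∀ k, ∀ v ∈ C, Y.grp k v ∈ C) ∧ C ≠ ⊥ ∧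
    ∀ D : Submodule ℂ Y.carrier, (∀ k, ∀ v ∈ D, Y.grp k v ∈ D) → D ≤ C → D = ⊥ ∨ D = C

/-- `r` is Vogan's norm `⟨μ + 2ρ_c, μ + 2ρ_c⟩` of the `K`-type `C`. Here `x` is a regular element
of `i 𝔨_ℝ`; its centralizer in `𝔨_ℂ` is a Cartan subalgebra `𝔱`, the positive roots are those
taking positive values on `x`, `v` is a highest weight vector of `C` of weight `μ`, and the
functional `μ + 2ρ_c` on `𝔱` is represented by `Q` in `𝔱` via the trace form, which is an invariant
form on `𝔤`. -/
def HasVoganNorm {G K : Subgroup (GLC n)} (Y : HCMod (lieAlg G) K)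
    (C : Submodule ℂ Y.carrier) (r : ℝ) : Prop :=
  ∃ x : MatC n, InImagCompact K x ∧
    (∀ S ∈ lieAlg K, ∀ T ∈ lieAlg K, ⁅x, S⁆ = 0 → ⁅x, T⁆ = 0 → ⁅S, T⁆ = 0) ∧
    ∃ v ∈ C, v ≠ 0 ∧ (∀ T : lieAlg G, (T : MatC n) ∈ posPart K x → Y.lie T v = 0) ∧
    ∃ Q ∈ lieAlg K, ⁅x, Q⁆ = 0 ∧
      (∀ T : lieAlg G, (T : MatC n) ∈ lieAlg K → ⁅x, (T : MatC n)⁆ = 0 →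
        ∀ s, IsAdTrace (posPart K x) T s →
          Y.lie T v = (Matrix.trace (Q * (T : MatC n)) - s) • v) ∧
      Matrix.trace (Q * Q) = (r : ℂ)

/-- `C` is the minimal `K`-type of `Y`: an irreducible `K`-submodule whose norm is strictly smaller
than that of every other irreducible `K`-submodule. -/
def IsMinimalKType {G K : Subgroup (GLC n)} (Y : HCMod (lieAlg G) K)
    (C : Submodule ℂ Y.carrier) : Prop :=
  IsKType Y C ∧ ∃ r, HasVoganNorm Y C r ∧
    ∀ C', IsKType Y C' → C' ≠ C → ∀ r', HasVoganNorm Y C' r' → r < r'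

end Parabolic

/- ## Locally algebraic modules, cohomological types, admissible twists -/

section Main

variable {n : ℕ} {G K H : Subgroup (GLC n)}

/-- The complex `(𝔤, H)`-module `Y` underlies `a`, via the isomorphism `e`. -/
def IsComplexModel {A : Type} [AddCommGroup A] [Module ℂ A] [Module ℚ A]
    (a : PairAction (lieAlgQ G) H ℂ A) (Y : HCMod (lieAlg G) H)
    (e : A ≃ₗ[ℂ] Y.carrier) : Prop :=
  (∀ (X : lieAlgQ G) (X' : lieAlg G), (X' : MatC n) = ratToC X →
    ∀ v, e (a.lie X v) = Y.lie X' (e v)) ∧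
  ∀ k v, e (a.act k v) = Y.grp k (e v)

variable {E : Type} [Field E] [CharZero E]
  {A : Type} [AddCommGroup A] [Module E A] [Module ℚ A]
  {A' : Type} [AddCommGroup A'] [Module E A'] [Module ℚ A']
  {V : Type} [AddCommGroup V] [Module E V] [Module ℚ V]
  {B : Type} [AddCommGroup B] [Module E B] [Module ℚ B]

/-- `a` is a `(𝔤, H)`-module over `E`; by faithfully flat descent the axioms may be checked over
`ℂ`. For `H = G` these are the rational representations of `G` over `E` (with `𝔤` acting by the
differential). -/
def IsGKModule [Algebra E ℂ] (a : PairAction (lieAlgQ G) H E A) : Prop :=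
  ∃ (Y : HCMod (lieAlg G) H) (e : (ℂ ⊗[E] A) ≃ₗ[ℂ] Y.carrier), IsComplexModel (a.baseChange ℂ) Y e

variable (G K H E A) in
/-- A locally algebraic module over `E` (up to the axioms of `IsGKModule`): an action of the pair `(𝔤, H)`
together with a commuting `E`-linear action `comp` of `π₀(K(ℝ))`, the latter given as an action of
`K(ℝ)` that is trivial on the identity component. Locally algebraic `(𝔤, K)`-modules are the
case `H = K`, and locally algebraic representations of `G` are the case `H = G`. -/
structure LocAlgModule extends PairAction (lieAlgQ G) H E A where
  comp : realPts K →* Module.End E A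
  comp_trivial : ∀ k ∈ Subgroup.connectedComponentOfOne (realPts K), comp k = 1
  comp_hom : ∀ k, IsPairHom toPairAction toPairAction (comp k)

/-- The action of `K(ℝ)` on the complexification of a locally algebraic `(𝔤, K)`-module:
`k * v = ρ(k) (k v)`. -/
def LocAlgModule.diagAct [Algebra E ℂ] (a : LocAlgModule G K K E A) (k : realPts K) :
    (ℂ ⊗[E] A) →ₗ[ℂ] (ℂ ⊗[E] A) :=
  ((a.comp k).baseChange ℂ).comp ((a.toPairAction.baseChange ℂ).act (realToC k))

/-- The complexifications are isomorphic `(𝔤_ℂ, K(ℝ))`-modules. -/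
def ComplexIso [Algebra E ℂ] (a : LocAlgModule G K K E A) (a' : LocAlgModule G K K E A') : Prop :=
  ∃ Ψ : (ℂ ⊗[E] A) ≃ₗ[ℂ] (ℂ ⊗[E] A'),
    (∀ X v, Ψ ((a.toPairAction.baseChange ℂ).lie X v) =
      (a'.toPairAction.baseChange ℂ).lie X (Ψ v)) ∧
    ∀ k v, Ψ (a.diagAct k v) = a'.diagAct k (Ψ v)

/-- Isomorphism of locally algebraic modules over `E`. -/
def LocAlgIso (a : LocAlgModule G K H E A) (a' : LocAlgModule G K H E A') : Prop :=
  ∃ φ : A ≃ₗ[E] A', IsPairHom a.toPairAction a'.toPairAction φ.toLinearMap ∧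
    ∀ k v, φ (a.comp k v) = a'.comp k (φ v)

/-- `a'` is the twist of `a` by the character `χ`, viewed as a character of `π₀(K(ℝ))`: the
underlying modules are isomorphic and the action of `π₀(K(ℝ))` is multiplied by `χ`. -/
def IsTwistBy (χ : CompChar K) (a' : LocAlgModule G K H E A') (a : LocAlgModule G K H E A) : Prop :=
  ∃ φ : A' ≃ₗ[E] A, IsPairHom a'.toPairAction a.toPairAction φ.toLinearMap ∧
    ∀ k, ∃ c : ℚ, (c : ℂ) = χ.hom (realToC k) ∧ ∀ v, φ (a'.comp k v) = (c : E) • a.comp k (φ v)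

/-- The complexification is essentially (infinitesimally) unitarizable: it carries a positive
definite hermitian form invariant under `K(ℝ)` and under the real Lie algebra of `⁰G`, i.e. under
those `X` that are killed by all rational characters of `G`. -/
def IsEssUnitarizable [algEC : Algebra E ℂ] (a : LocAlgModule G K K E A) : Prop :=
  ∃ c : InnerProductSpace.Core ℂ (ℂ ⊗[E] A),
    (∀ k v w, c.inner (a.diagAct k v) (a.diagAct k w) = c.inner v w) ∧
    ∀ X : lieAlgQ G,
      (∀ (p : MvPolynomial (Coord n) ℚ) (ψ : G →* ℂ),
        (∀ g : G, ψ g = MvPolynomial.aeval (coords (g : GLC n)) p) →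
          derivAtOne (ratToC X) (p.map (algebraMap ℚ ℂ)) = 0) →
      ∀ v w, c.inner ((a.toPairAction.baseChange ℂ).lie X v) w =
        - c.inner v ((a.toPairAction.baseChange ℂ).lie X w)

/-- `(A, V)` represents a cohomological type over the field `E ⊆ ℂ`, with `A` absolutely
irreducible: `V` is an absolutely irreducible locally algebraic representation of `G`, and `A` is an
absolutely irreducible locally algebraic cohomologically induced standard module of weight `V`,
essentially unitarizable for all complex embeddings of `E`. -/
structure IsCohPair [Algebra E ℂ] (a : LocAlgModule G K K E A)
    (ρ : LocAlgModule G K G E V) : Prop where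
  finite : Module.Finite E V
  isRep : IsGKModule ρ.toPairAction
  isModule : IsGKModule a.toPairAction
  irred_weight : IsIrredSub (ρ.toPairAction.baseChange ℂ) ⊤
  irred : IsIrredSub (a.toPairAction.baseChange ℂ) ⊤
  standard : ∃ (VC : HCMod (lieAlg G) G) (eV : (ℂ ⊗[E] V) ≃ₗ[ℂ] VC.carrier)
    (Y : HCMod (lieAlg G) K) (eA : (ℂ ⊗[E] A) ≃ₗ[ℂ] Y.carrier),
    IsComplexModel (ρ.toPairAction.baseChange ℂ) VC eV ∧
    IsComplexModel (a.toPairAction.baseChange ℂ) Y eA ∧ IsStandardFor G K VC Y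
  same_comp : ∀ k, ∃ c : E, a.comp k = c • LinearMap.id ∧ ρ.comp k = c • LinearMap.id
  unitarizable : ∀ σ : E →+* ℂ, IsEssUnitarizable (algEC := σ.toAlgebra) a

/-- The injective `(𝔨, K)`-homomorphism `j : B → A` over `E` identifies `B` with the bottom layer of
`A`, i.e. the image of the complexification of `B` is the minimal `K`-type of `A_ℂ`. -/
def IsBottomLayer [Algebra E ℂ] (a : LocAlgModule G K K E A)
    (b : PairAction (lieAlgQ K) K E B) (j : B →ₗ[E] A) : Prop :=
  Function.Injective j ∧
  (∀ (X : lieAlgQ K) (X' : lieAlgQ G), (X : MatQ n) = X' → ∀ v, j (b.lie X v) = a.lie X' (j v)) ∧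
  (∀ v, a.coact (j v) = TensorProduct.AlgebraTensorModule.map j LinearMap.id (b.coact v)) ∧
  ∃ (Y : HCMod (lieAlg G) K) (e : (ℂ ⊗[E] A) ≃ₗ[ℂ] Y.carrier),
    IsComplexModel (a.toPairAction.baseChange ℂ) Y e ∧
    IsMinimalKType Y ((LinearMap.range (j.baseChange ℂ)).map e.toLinearMap)

end Main

/- ## The conditions over an extension field -/

section Conditions

variable {n : ℕ} {𝔥 : LieSubalgebra ℚ (MatQ n)} {K : Subgroup (GLC n)}
  {F : Type u} [Field F] [CharZero F]
  {A : Type v} [AddCommGroup A] [Module F A] [Module ℚ A]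

/-- As a module over `(𝔥, ker χ)`, `A` is reducible. -/
def CondReducible (a : PairAction 𝔥 K F A) (χ : CompChar K) : Prop :=
  IsReducible (a.restrict χ.ker_le)

/-- As a module over `(𝔥, ker χ)`, `A` is the direct sum of two non-isomorphic absolutely
irreducible submodules. -/
def CondSplits (a : PairAction 𝔥 K F A) (χ : CompChar K) : Prop :=
  ∃ W₁ W₂ : Submodule F A, IsCompl W₁ W₂ ∧ IsAbsIrredSub (a.restrict χ.ker_le) W₁ ∧
    IsAbsIrredSub (a.restrict χ.ker_le) W₂ ∧ ¬ SubIso (a.restrict χ.ker_le) W₁ W₂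

/-- The square of every `χ`-twisted linear automorphism is the square of a scalar. -/
def CondSquare (a : PairAction 𝔥 K F A) (χ : CompChar K) : Prop :=
  ∀ ψ : A ≃ₗ[F] A, IsTwistedHom a χ ψ.toLinearMap → ∃ α : F, ∀ v, ψ (ψ v) = (α ^ 2) • v

/-- Every `χ`-twisted linear automorphism acts by scalars `α` or `-α` on all irreducible submodules
over `(𝔥, ker χ)`. -/
def CondScalars (a : PairAction 𝔥 K F A) (χ : CompChar K) : Prop :=
  ∀ ψ : A ≃ₗ[F] A, IsTwistedHom a χ ψ.toLinearMap → ∃ α : F, ∀ W : Submodule F A,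
    IsIrredSub (a.restrict χ.ker_le) W → (∀ v ∈ W, ψ v = α • v) ∨ (∀ v ∈ W, ψ v = (-α) • v)

end Conditions

end LocAlg

end

open scoped TensorProduct

noncomputable section

namespace LocAlg

universe u v w

attribute [local instance] LieRing.ofAssociativeRing

/-! Everything is governed by one number $c \in E^\times$: each of the conditions says that $c$ is a
square in $E'$.

On real points $\chi$ has absolute value one, because $K(\mathbb R)$ is compact, and rational
values; hence it is $\pm1$ there, and $\chi^2 = 1$ on all of $K$ by Zariski density
(`char_quadratic`). It takes the value $-1$, since otherwise $V' \cong V$. As $\pi_0(K(\mathbb R))$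
acts on $A$ by scalars, an isomorphism $A_{\mathbb C} \cong A'_{\mathbb C}$ amounts to a
$\chi$-twisted automorphism of $A_{\mathbb C}$. Composing with an $E$-linear functional $\mathbb C
\to E$ gives a nonzero twisted $\psi$ over $E$; its square is untwisted, so Schur's lemma gives
$\psi^2 = c$ with $c \ne 0$ (`exists_isTwistModel`).

Next comes Clifford theory for $\ker\chi$, of index two in $K$. Over $\mathbb C$, $\psi$ commutes
with $\mathfrak g$ and $\ker\chi$ and anticommutes with a point $k_0$ outside the kernel. Hence the
commutant of $(\mathfrak g, \ker\chi)$ is spanned by $1$ and $\psi$ (`commutant_of_even`), and the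
proper nonzero submodules are eigenspaces of $\psi$ (`eq_ker_of_even_stable`). Both facts descend to
$E$ and then pass to every extension $E'$, which need not embed in $\mathbb C$, although $A$ may
have infinite dimension: the commutant by taking slices (`commutant_baseChange`), the submodules by
Jacobson density (`dense_of_commutant`, `eq_ker_of_stable`). So $A_{E'}$ is reducible exactly when
$\psi$ has an eigenvalue $\alpha \in E'$, that is, $\alpha^2 = c$. The eigenspaces for $\pm\alpha$
are then complementary, absolutely irreducible and non-isomorphic, and every twisted homomorphism is
a multiple of $\psi$.

For the bottom layer, a twisted automorphism carries $K$-types to $K$-types and preserves the Vogan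
norm, which depends only on the Lie algebra action. It therefore preserves the unique minimal
$K$-type (`IsMinimalKType.map_eq`), so $\psi$ restricts to $B$ with the same $c$, and the same
criterion applies.

Algebraically, a coaction is treated as the family of operators `coeff`, one for each functional on
the coordinate ring. These commute with base change, and Galois descent along $\mathbb C/\mathbb Q$
relates them to the action of complex points. -/

/-! ### Automorphisms of the complex numbers and rational vectors -/

/-- $\Omega$ is an algebraic closure of the polynomial ring generated by a transcendence basis, so a
ring automorphism of that ring extends to $\Omega$. It need not fix $k$. -/
theorem exists_ringEquiv_of_mvPolynomial {k Ω ι : Type*} [Field k] [Field Ω] [Algebra k Ω]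
    [IsAlgClosed Ω] {v : ι → Ω} (hv : IsTranscendenceBasis k v)
    (τ : MvPolynomial ι k ≃+* MvPolynomial ι k) :
    ∃ σ : Ω ≃+* Ω, ∀ p, σ (MvPolynomial.aeval v p) = MvPolynomial.aeval v (τ p) := by
  let _ := IsAlgClosed.isAlgClosure_of_transcendence_basis v hv
  let e : Algebra.adjoin k (Set.range v) ≃+* Algebra.adjoin k (Set.range v) :=
    hv.1.aevalEquiv.symm.toRingEquiv.trans (τ.trans hv.1.aevalEquiv.toRingEquiv)
  refine ⟨IsAlgClosure.equivOfEquiv Ω Ω e, fun p => ?_⟩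
  have h1 := IsAlgClosure.equivOfEquiv_algebraMap Ω Ω e (hv.1.aevalEquiv p)
  simpa [e] using h1

/-- The fixed field of $\mathrm{Aut}(\mathbb C)$ is $\mathbb Q$. An irrational algebraic number is
moved by the Galois group of $\overline{\mathbb Q}$; a transcendental number is part of a
transcendence basis and is moved by a translation. -/
theorem exists_ringEquiv_ne {x : ℂ} (hx : x ∉ Set.range (algebraMap ℚ ℂ)) :
    ∃ σ : ℂ ≃+* ℂ, σ x ≠ x := by
  obtain ⟨ι, v, hv⟩ := exists_isTranscendenceBasis' (algebraicClosure ℚ ℂ) ℂ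
  by_contra! H
  by_cases h : x ∈ algebraicClosure ℚ ℂ
  · have : IsAlgClosure ℚ (algebraicClosure ℚ ℂ) := algebraicClosure.isAlgClosure ℚ ℂ
    have : IsGalois ℚ (algebraicClosure ℚ ℂ) := inferInstance
    have := (InfiniteGalois.mem_range_algebraMap_iff_fixed (k := ℚ)
      (⟨x, h⟩ : algebraicClosure ℚ ℂ)).2 fun τ => by
        -- Here the automorphism of the polynomial ring acts on the coefficients only.
        obtain ⟨σ, hσ⟩ := exists_ringEquiv_of_mvPolynomial hv
          (MvPolynomial.mapEquiv ι τ.toRingEquiv)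
        have := hσ (MvPolynomial.C ⟨x, h⟩)
        rw [MvPolynomial.aeval_C] at this
        have h2 : σ x = _ := this
        rw [H] at h2
        apply Subtype.ext
        simpa using h2.symm
    obtain ⟨q, hq⟩ := this
    exact hx ⟨q, congrArg Subtype.val hq⟩
  · have htr : Transcendental (algebraicClosure ℚ ℂ) x := by
      intro hal
      have hb : x ∈ algebraicClosure (algebraicClosure ℚ ℂ) ℂ := mem_algebraicClosure_iff.2 hal
      rw [algebraicClosure.algebraicClosure_eq_bot] at hb
      obtain ⟨y, rfl⟩ := IntermediateField.mem_bot.1 hb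
      exact h y.2
    have hx1 : AlgebraicIndepOn (algebraicClosure ℚ ℂ) id {x} := by
      rw [AlgebraicIndepOn, algebraicIndependent_singleton_iff ⟨x, rfl⟩]
      exact htr
    obtain ⟨t, hxt, ht⟩ := exists_isTranscendenceBasis_superset hx1
    -- Translation of all variables by one; `x` is itself one of the variables, so it is moved.
    let τ : MvPolynomial t (algebraicClosure ℚ ℂ) ≃ₐ[algebraicClosure ℚ ℂ]
        MvPolynomial t (algebraicClosure ℚ ℂ) :=
      AlgEquiv.ofAlgHom (MvPolynomial.aeval fun i => MvPolynomial.X i + 1)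
        (MvPolynomial.aeval fun i => MvPolynomial.X i - 1) (by ext; simp) (by ext; simp)
    obtain ⟨σ, hσ⟩ := exists_ringEquiv_of_mvPolynomial ht τ.toRingEquiv
    have := hσ (MvPolynomial.X ⟨x, hxt rfl⟩)
    simp [H, τ] at this

/-- Induction on the size of the support: a vector normalised to have a coordinate one is either
rational or differs from one of its conjugates, and the difference lies in `U` with smaller support.
-/
theorem exists_rational_of_ne_zero {ι : Type*} [Finite ι] (U : Submodule ℂ (ι → ℂ))
    (hU : ∀ σ : ℂ ≃+* ℂ, ∀ u ∈ U, (fun i => σ (u i)) ∈ U) (u : ι → ℂ) (hu : u ∈ U) (h0 : u ≠ 0) :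
    ∃ w ∈ U, w ≠ 0 ∧ (∃ q : ι → ℚ, w = fun i => (q i : ℂ)) ∧
      Function.support w ⊆ Function.support u := by
  obtain ⟨m, hm⟩ : ∃ m, (Function.support u).ncard = m := ⟨_, rfl⟩
  induction m using Nat.strong_induction_on generalizing u with
  | _ m ih =>
  obtain ⟨i, hi⟩ := Function.ne_iff.1 h0
  have hi : u i ≠ 0 := hi
  by_cases hq : ∀ j, (u i)⁻¹ * u j ∈ Set.range (algebraMap ℚ ℂ)
  · choose q hq using hq
    refine ⟨(u i)⁻¹ • u, U.smul_mem _ hu, smul_ne_zero (inv_ne_zero hi) h0,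
      ⟨q, funext fun j => (hq j).symm⟩, Function.support_const_smul_subset _ _⟩
  · push Not at hq
    obtain ⟨j, hj⟩ := hq
    obtain ⟨σ, hσ⟩ := exists_ringEquiv_ne hj
    let x : ι → ℂ := fun k => (u i)⁻¹ * u k
    have hx : x ∈ U := U.smul_mem (u i)⁻¹ hu
    -- The coordinate `i` of `x` is one and cancels, while the coordinate `j` is moved by `σ` and
    -- survives.
    let y : ι → ℂ := (fun k => σ (x k)) - x
    have hyU : y ∈ U := U.sub_mem (hU σ x hx) hx
    have hy0 : y ≠ 0 := fun h => hσ (sub_eq_zero.1 (congrFun h j))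
    have hsub : Function.support y ⊆ Function.support u := by
      intro k hk hk0
      exact hk (by simp [y, x, hk0])
    have hyi : i ∉ Function.support y := by simp [y, x, hi]
    have hlt : (Function.support y).ncard < m := hm ▸
      Set.ncard_lt_ncard (Set.ssubset_iff_subset_ne.2 ⟨hsub, fun h => hyi (h ▸ hi)⟩) (Set.toFinite _)
    obtain ⟨w, hw, hw0, hwq, hws⟩ := ih _ hlt y hyU hy0 rfl
    exact ⟨w, hw, hw0, hwq, hws.trans hsub⟩

/-- A complex subspace that is stable under all field automorphisms is spanned by its rational
vectors. -/
theorem mem_span_rational {ι : Type*} [Finite ι] (U : Submodule ℂ (ι → ℂ))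
    (hU : ∀ σ : ℂ ≃+* ℂ, ∀ u ∈ U, (fun i => σ (u i)) ∈ U) (u : ι → ℂ) (hu : u ∈ U) :
    u ∈ Submodule.span ℂ {w | w ∈ U ∧ ∃ q : ι → ℚ, w = fun i => (q i : ℂ)} := by
  obtain ⟨m, hm⟩ : ∃ m, (Function.support u).ncard = m := ⟨_, rfl⟩
  induction m using Nat.strong_induction_on generalizing u with
  | _ m ih =>
  by_cases h0 : u = 0
  · rw [h0]; exact Submodule.zero_mem _
  obtain ⟨w, hw, hw0, hwq, hws⟩ := exists_rational_of_ne_zero U hU u hu h0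
  obtain ⟨i, hi⟩ := Function.ne_iff.1 hw0
  have hi : w i ≠ 0 := hi
  -- The multiple of `w` is chosen to kill the coordinate `i`. No new coordinates appear, because
  -- the support of `w` lies in that of `u`.
  let y : ι → ℂ := u - (u i / w i) • w
  have hyi : i ∉ Function.support y := by simp [y, hi]
  have hsub : Function.support y ⊆ Function.support u := by
    intro k hk hk0
    have : w k = 0 := by
      by_contra h
      exact hws h hk0
    exact hk (by simp [y, hk0, this])
  have hlt : (Function.support y).ncard < m := hm ▸
    Set.ncard_lt_ncard (Set.ssubset_iff_subset_ne.2 ⟨hsub, fun h => hyi (h ▸ hws hi)⟩)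
      (Set.toFinite _)
  have := ih _ hlt y (U.sub_mem hu (U.smul_mem _ hw)) rfl
  have h2 : u = y + (u i / w i) • w := by simp [y]
  rw [h2]
  exact Submodule.add_mem _ this (Submodule.smul_mem _ _ (Submodule.subset_span ⟨hw, hwq⟩))

/-! ### Galois action on the complex points of groups over ℚ -/

/-- The action of a field automorphism on matrices. -/
def conjGL {n : ℕ} (σ : ℂ ≃+* ℂ) : GLC n →* GLC n :=
  Matrix.GeneralLinearGroup.map (σ : ℂ →+* ℂ)

theorem coords_conjGL {n : ℕ} (σ : ℂ ≃+* ℂ) (g : GLC n) (s : Coord n) :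
    coords (conjGL σ g) s = σ (coords g s) := by
  rcases s with p | p
  · rfl
  · have : (conjGL σ g)⁻¹ = conjGL σ g⁻¹ := (map_inv _ _).symm
    simp only [coords, Sum.elim_inr, this]
    rfl

theorem aeval_coords_conjGL {n : ℕ} (σ : ℂ ≃+* ℂ) (g : GLC n) (p : MvPolynomial (Coord n) ℚ) :
    MvPolynomial.aeval (coords (conjGL σ g)) p = σ (MvPolynomial.aeval (coords g) p) := by
  induction p using MvPolynomial.induction_on with
  | C a => simp
  | add p q hp hq => simp [hp, hq]
  | mul_X p s hp => simp [hp, coords_conjGL]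

theorem aeval_coords_conjGL_map {n : ℕ} (σ : ℂ ≃+* ℂ) (g : GLC n) (p : MvPolynomial (Coord n) ℂ) :
    MvPolynomial.aeval (coords (conjGL σ g)) (p.map (σ : ℂ →+* ℂ)) =
      σ (MvPolynomial.aeval (coords g) p) := by
  induction p using MvPolynomial.induction_on with
  | C a => simp
  | add p q hp hq => simp only [map_add, hp, hq]
  | mul_X p s hp =>
    simp only [map_mul, hp, MvPolynomial.map_X, MvPolynomial.aeval_X, coords_conjGL]

theorem IsAlgebraicOver.conjGL_mem {n : ℕ} {H : Subgroup (GLC n)} (hH : IsAlgebraicOver ℚ H)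
    (σ : ℂ ≃+* ℂ) {g : GLC n} (hg : g ∈ H) : conjGL σ g ∈ H := by
  obtain ⟨S, hS⟩ := hH
  refine (hS _).2 fun p hp => ?_
  rw [aeval_coords_conjGL, (hS g).1 hg p hp, map_zero]

theorem coordRing_apply {n : ℕ} {H : Subgroup (GLC n)} (f : coordRing H) :
    ∃ p : MvPolynomial (Coord n) ℚ, ∀ h : H, (f : H → ℂ) h =
      MvPolynomial.aeval (coords (h : GLC n)) p := by
  obtain ⟨p, hp⟩ := f.2
  refine ⟨p, fun h => ?_⟩
  have hp' : (MvPolynomial.aeval (R := ℚ)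
        (fun (s : Coord n) (h : H) => coords (h : GLC n) s)) p = (f : H → ℂ) := hp
  rw [← hp']
  have key : (Pi.evalAlgHom ℚ (fun _ : H => ℂ) h).comp (MvPolynomial.aeval (R := ℚ)
      (fun (s : Coord n) (h : H) => coords (h : GLC n) s)) =
        MvPolynomial.aeval (coords (h : GLC n)) := by
    apply MvPolynomial.algHom_ext
    intro i
    simp
  exact congrArg (fun f => f p) key

/-! ### Regular functions are determined by their complex points -/

section Eval

variable {n : ℕ} {H : Subgroup (GLC n)} {M : Type v} [AddCommGroup M] [Module ℂ M] [Module ℚ M]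

/-- Evaluation of regular functions with values in `M` at a point. -/
def evalAt (h : H) : M ⊗[ℚ] coordRing H →ₗ[ℂ] M :=
  TensorProduct.AlgebraTensorModule.lift
    ({ toFun := fun v =>
        { toFun := fun f => (f : H → ℂ) h • v
          map_add' := fun f g => by simp [add_smul]
          map_smul' := fun c f => by
            simp only [SetLike.val_smul, Pi.smul_apply, RingHom.id_apply, smul_assoc] }
       map_add' := fun v w => by ext f; simp
       map_smul' := fun c v => by
        ext f
        simp only [LinearMap.coe_mk, AddHom.coe_mk, RingHom.id_apply, LinearMap.smul_apply]
        exact smul_comm _ _ _ } : M →ₗ[ℂ] coordRing H →ₗ[ℚ] M)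

@[simp] theorem evalAt_tmul (h : H) (m : M) (f : coordRing H) :
    evalAt h (m ⊗ₜ[ℚ] f) = (f : H → ℂ) h • m := rfl

/-- A function with values in `M` that vanishes at all complex points is zero. -/
theorem eq_zero_of_evalAt (hH : IsAlgebraicOver ℚ H) (t : M ⊗[ℚ] coordRing H)
    (ht : ∀ h, evalAt h t = 0) : t = 0 := by
  classical
  let b := Module.Basis.ofVectorSpace ℚ (coordRing H)
  obtain ⟨c, rfl⟩ := (TensorProduct.equivFinsuppOfBasisRight (M := M) b).symm.surjective t
  have hsym : (TensorProduct.equivFinsuppOfBasisRight (M := M) b).symm c =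
      ∑ i ∈ c.support, c i ⊗ₜ b i := by
    simp [Finsupp.sum]
  rw [hsym] at ht
  -- `U` is the space of complex linear relations between the functions `b i` on `H`. It is stable
  -- under automorphisms of ℂ because `H` is, and it has no nonzero rational vector because the `b
  -- i` are independent over ℚ; hence it vanishes.
  let U : Submodule ℂ (c.support → ℂ) :=
    { carrier := {u | ∀ h : H, ∑ i, u i * (b i : H → ℂ) h = 0}
      add_mem' := fun {x y} hx hy h => by
        simp only [Pi.add_apply, add_mul, Finset.sum_add_distrib, hx h, hy h, add_zero]
      zero_mem' := fun h => by simp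
      smul_mem' := fun a x hx h => by
        simp only [Pi.smul_apply, smul_eq_mul, mul_assoc, ← Finset.mul_sum, hx h, mul_zero] }
  have hU : ∀ σ : ℂ ≃+* ℂ, ∀ u ∈ U, (fun i => σ (u i)) ∈ U := by
    intro σ u hu h
    have h1 := hu ⟨conjGL σ.symm h, hH.conjGL_mem σ.symm h.2⟩
    have h2 := congrArg σ h1
    rw [map_zero, map_sum] at h2
    rw [← h2]
    refine Finset.sum_congr rfl fun i _ => ?_
    obtain ⟨p, hp⟩ := coordRing_apply (b i)
    rw [map_mul, hp, hp, aeval_coords_conjGL]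
    simp
  have hU0 : U = ⊥ := by
    rw [eq_bot_iff]
    intro u hu
    by_contra h0
    obtain ⟨w, hw, hw0, ⟨q, rfl⟩, -⟩ := exists_rational_of_ne_zero U hU u hu h0
    have hli := (Fintype.linearIndependent_iff.1
      (b.linearIndependent.comp (fun i : c.support => (i : _)) Subtype.val_injective)) q (by
        apply Subtype.ext
        funext h
        have := hw h
        simpa [Algebra.smul_def] using this)
    exact hw0 (funext fun i => by simp [hli i])
  have hc : c = 0 := by
    ext i
    by_contra hi
    have hi' : i ∈ c.support := Finsupp.mem_support_iff.2 hi
    -- A complex functional on `M` turns the coefficients into scalars, which then form a relation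
    -- in `U`.
    refine hi ((Module.forall_dual_apply_eq_zero_iff ℂ (c i)).1 fun μ => ?_)
    have hu : (fun j : c.support => μ (c j)) ∈ U := fun h => by
      have h1 := congrArg μ (ht h)
      rw [map_sum, map_sum, map_zero] at h1
      rw [← h1, ← Finset.sum_coe_sort c.support]
      exact Finset.sum_congr rfl fun j _ => by simp [mul_comm]
    rw [hU0] at hu
    exact congrFun ((Submodule.mem_bot ℂ).1 hu) ⟨i, hi'⟩
  rw [hc, map_zero]

end Eval

/-! ### Translations, adjoint action and rational structure of Lie algebras -/

/-- Two derivations that are related by a ring homomorphism on the variables are related. -/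
theorem derivation_comp_eq {σ : Type*} (τ : MvPolynomial σ ℂ →+* MvPolynomial σ ℂ)
    (hτ : ∀ c, ∃ c', τ (MvPolynomial.C c) = MvPolynomial.C c')
    (D₁ D₂ : Derivation ℂ (MvPolynomial σ ℂ) (MvPolynomial σ ℂ))
    (h : ∀ s, D₁ (τ (MvPolynomial.X s)) = τ (D₂ (MvPolynomial.X s))) (p : MvPolynomial σ ℂ) :
    D₁ (τ p) = τ (D₂ p) := by
  induction p using MvPolynomial.induction_on with
  | C c =>
    obtain ⟨c', hc'⟩ := hτ c
    rw [hc', MvPolynomial.derivation_C, MvPolynomial.derivation_C, map_zero]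
  | add p q hp hq => simp only [map_add, hp, hq]
  | mul_X p s hp => simp only [map_mul, Derivation.leibniz, smul_eq_mul, map_add, hp, h]

section Translation

variable {n : ℕ}

/-- The map on polynomials induced by left translation. -/
def lmulPoly (g : GLC n) : MvPolynomial (Coord n) ℂ →ₐ[ℂ] MvPolynomial (Coord n) ℂ :=
  MvPolynomial.aeval (Sum.elim
    (fun p => ∑ k, MvPolynomial.C ((g : MatC n) p.1 k) * MvPolynomial.X (Sum.inl (k, p.2)))
    (fun p => ∑ k, MvPolynomial.C (((g⁻¹ : GLC n) : MatC n) k p.2) *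
      MvPolynomial.X (Sum.inr (p.1, k))))

/-- The map on polynomials induced by right translation. -/
def rmulPoly (g : GLC n) : MvPolynomial (Coord n) ℂ →ₐ[ℂ] MvPolynomial (Coord n) ℂ :=
  MvPolynomial.aeval (Sum.elim
    (fun p => ∑ k, MvPolynomial.C ((g : MatC n) k p.2) * MvPolynomial.X (Sum.inl (p.1, k)))
    (fun p => ∑ k, MvPolynomial.C (((g⁻¹ : GLC n) : MatC n) p.1 k) *
      MvPolynomial.X (Sum.inr (k, p.2))))

theorem aeval_lmulPoly (g h : GLC n) (p : MvPolynomial (Coord n) ℂ) :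
    MvPolynomial.aeval (coords h) (lmulPoly g p) = MvPolynomial.aeval (coords (g * h)) p := by
  have key : (MvPolynomial.aeval (coords h)).comp (lmulPoly g) =
      MvPolynomial.aeval (R := ℂ) (coords (g * h)) := by
    apply MvPolynomial.algHom_ext
    rintro (p | p)
    · simp [lmulPoly, coords, Matrix.mul_apply]
    · simp [lmulPoly, coords, Matrix.mul_apply, mul_comm]
  exact congrArg (fun f => f p) key

theorem aeval_rmulPoly (g h : GLC n) (p : MvPolynomial (Coord n) ℂ) :
    MvPolynomial.aeval (coords h) (rmulPoly g p) = MvPolynomial.aeval (coords (h * g)) p := by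
  have key : (MvPolynomial.aeval (coords h)).comp (rmulPoly g) =
      MvPolynomial.aeval (R := ℂ) (coords (h * g)) := by
    apply MvPolynomial.algHom_ext
    rintro (p | p)
    · simp [rmulPoly, coords, Matrix.mul_apply, mul_comm]
    · simp [rmulPoly, coords, Matrix.mul_apply]
  exact congrArg (fun f => f p) key

/-- Left translation commutes with right multiplication by $\exp(tX)$. -/
theorem leftInvDer_lmulPoly (g : GLC n) (X : MatC n) (p : MvPolynomial (Coord n) ℂ) :
    leftInvDer X (lmulPoly g p) = lmulPoly g (leftInvDer X p) := by
  refine derivation_comp_eq (lmulPoly g).toRingHom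
    (fun c => ⟨c, (lmulPoly g).commutes c⟩) _ _ ?_ p
  rintro (p | p)
  · simp only [lmulPoly, AlgHom.toRingHom_eq_coe, RingHom.coe_coe, MvPolynomial.aeval_X,
      Sum.elim_inl, map_sum, leftInvDer_C, leftInvDer_inl, map_mul, MvPolynomial.algHom_C,
      MvPolynomial.algebraMap_eq, Finset.mul_sum]
    rw [Finset.sum_comm]
    exact Finset.sum_congr rfl fun k _ => Finset.sum_congr rfl fun l _ => by ring
  · simp only [lmulPoly, AlgHom.toRingHom_eq_coe, RingHom.coe_coe, MvPolynomial.aeval_X,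
      Sum.elim_inr, map_sum, leftInvDer_C, leftInvDer_inr, map_mul, MvPolynomial.algHom_C,
      MvPolynomial.algebraMap_eq, Finset.mul_sum, map_neg, mul_neg, Finset.sum_neg_distrib]
    rw [Finset.sum_comm]
    exact congrArg _ (Finset.sum_congr rfl fun k _ => Finset.sum_congr rfl fun l _ => by ring)

/-- Infinitesimal form of $\exp(tX)\,g = g\exp(tY)$. -/
theorem leftInvDer_rmulPoly (g : GLC n) (X Y : MatC n) (hXY : (g : MatC n) * Y = X * (g : MatC n))
    (p : MvPolynomial (Coord n) ℂ) :
    leftInvDer X (rmulPoly g p) = rmulPoly g (leftInvDer Y p) := by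
  have hXY' : Y * ((g⁻¹ : GLC n) : MatC n) = ((g⁻¹ : GLC n) : MatC n) * X := by
    have h1 : ((g⁻¹ : GLC n) : MatC n) * (g : MatC n) = 1 := by
      rw [← Units.val_mul]; simp
    have h2 : (g : MatC n) * ((g⁻¹ : GLC n) : MatC n) = 1 := by
      rw [← Units.val_mul]; simp
    calc Y * ((g⁻¹ : GLC n) : MatC n)
        = ((g⁻¹ : GLC n) : MatC n) * ((g : MatC n) * Y) * ((g⁻¹ : GLC n) : MatC n) := by
          rw [← mul_assoc, h1, one_mul]
      _ = _ := by rw [hXY, mul_assoc, mul_assoc, h2, mul_one]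
  refine derivation_comp_eq (rmulPoly g).toRingHom
    (fun c => ⟨c, (rmulPoly g).commutes c⟩) _ _ ?_ p
  rintro (p | p)
  · have key : ∀ l, ∑ k, MvPolynomial.C (σ := Coord n) ((g : MatC n) l k) *
        MvPolynomial.C (Y k p.2) =
        ∑ k, MvPolynomial.C (X l k) * MvPolynomial.C ((g : MatC n) k p.2) := fun l => by
      simpa [Matrix.mul_apply] using
        congrArg (MvPolynomial.C (σ := Coord n)) (congrFun (congrFun hXY l) p.2)
    simp only [rmulPoly, AlgHom.toRingHom_eq_coe, RingHom.coe_coe, MvPolynomial.aeval_X,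
      Sum.elim_inl, map_sum, leftInvDer_C, leftInvDer_inl, map_mul, MvPolynomial.algHom_C,
      MvPolynomial.algebraMap_eq, Finset.mul_sum]
    rw [Finset.sum_comm]
    conv_rhs => rw [Finset.sum_comm]
    refine Finset.sum_congr rfl fun l _ => ?_
    have := congrArg (· * (MvPolynomial.X (Sum.inl (p.1, l)) : MvPolynomial (Coord n) ℂ)) (key l)
    simp only [Finset.sum_mul] at this
    calc _ = _ := Finset.sum_congr rfl fun k _ => by ring
      _ = _ := this.symm
      _ = _ := Finset.sum_congr rfl fun k _ => by ring
  · have key : ∀ l, ∑ k, MvPolynomial.C (σ := Coord n) (Y p.1 k) *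
        MvPolynomial.C (((g⁻¹ : GLC n) : MatC n) k l) =
        ∑ k, MvPolynomial.C (((g⁻¹ : GLC n) : MatC n) p.1 k) * MvPolynomial.C (X k l) := fun l => by
      simpa [Matrix.mul_apply] using
        congrArg (MvPolynomial.C (σ := Coord n)) (congrFun (congrFun hXY' p.1) l)
    simp only [rmulPoly, AlgHom.toRingHom_eq_coe, RingHom.coe_coe, MvPolynomial.aeval_X,
      Sum.elim_inr, map_sum, leftInvDer_C, leftInvDer_inr, map_mul, MvPolynomial.algHom_C,
      MvPolynomial.algebraMap_eq, Finset.mul_sum, map_neg, mul_neg, Finset.sum_neg_distrib]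
    rw [Finset.sum_comm]
    conv_rhs => rw [Finset.sum_comm]
    refine congrArg _ (Finset.sum_congr rfl fun l _ => ?_)
    have := congrArg (· * (MvPolynomial.X (Sum.inr (l, p.2)) : MvPolynomial (Coord n) ℂ)) (key l)
    simp only [Finset.sum_mul] at this
    calc _ = _ := Finset.sum_congr rfl fun k _ => by ring
      _ = _ := this.symm
      _ = _ := Finset.sum_congr rfl fun k _ => by ring

/-- For $g \in G$ the translate $p(g\,\cdot)$ of a polynomial vanishing on $G$ vanishes on $H$.
Differentiating it at $1$ gives the derivative of $p$ at $g$. -/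
theorem lieAlg_mono {H G : Subgroup (GLC n)} (h : H ≤ G) : lieAlg H ≤ lieAlg G := by
  intro X hX p hp g hg
  have h1 := hX (lmulPoly g p) (fun x hx => by
    rw [aeval_lmulPoly]; exact hp _ (G.mul_mem hg (h hx))) 1 H.one_mem
  rwa [leftInvDer_lmulPoly, aeval_lmulPoly, mul_one] at h1

/-- The vanishing ideal of `H` is stable under right translation by `g`, which conjugates the
derivation of `X` into that of `Y`. -/
theorem lieAlg_conj {H : Subgroup (GLC n)} {g : GLC n} (hg : g ∈ H) {X Y : MatC n}
    (hX : X ∈ lieAlg H) (hXY : (g : MatC n) * Y = X * (g : MatC n)) : Y ∈ lieAlg H := by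
  intro p hp h hh
  have h1 := hX (rmulPoly g p) (fun x hx => by
    rw [aeval_rmulPoly]; exact hp _ (H.mul_mem hx hg)) (h * g⁻¹) (H.mul_mem hh (H.inv_mem hg))
  rwa [leftInvDer_rmulPoly g X Y hXY, aeval_rmulPoly, inv_mul_cancel_right] at h1

theorem leftInvDer_map (σ : ℂ ≃+* ℂ) (X : MatC n) (p : MvPolynomial (Coord n) ℂ) :
    leftInvDer (X.map σ) (p.map (σ : ℂ →+* ℂ)) = (leftInvDer X p).map (σ : ℂ →+* ℂ) := by
  refine derivation_comp_eq (MvPolynomial.map (σ : ℂ →+* ℂ)) (fun c => ⟨σ c, by simp⟩) _ _ ?_ p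
  rintro (p | p)
  · simp [leftInvDer_inl]
  · simp [leftInvDer_inr]

/-- Since `H` is stable under `σ`, so is its vanishing ideal under the action on coefficients. This
makes the complex Lie algebra a Galois-stable space of matrices. -/
theorem lieAlg_map_mem {H : Subgroup (GLC n)} (hH : IsAlgebraicOver ℚ H) (σ : ℂ ≃+* ℂ)
    {X : MatC n} (hX : X ∈ lieAlg H) : X.map σ ∈ lieAlg H := by
  intro p hp h hh
  have hpσ : (p.map (σ.symm : ℂ →+* ℂ)).map (σ : ℂ →+* ℂ) = p := by
    rw [MvPolynomial.map_map]
    simp [MvPolynomial.map_id]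
  have hσ : conjGL σ (conjGL σ.symm h) = h := by
    apply Units.ext
    ext i j
    simp [conjGL]
  have h1 := hX (p.map (σ.symm : ℂ →+* ℂ)) (fun x hx => by
    have h2 := aeval_coords_conjGL_map σ x (p.map (σ.symm : ℂ →+* ℂ))
    rw [hpσ, hp _ (hH.conjGL_mem σ hx)] at h2
    exact (map_eq_zero σ).1 h2.symm) (conjGL σ.symm h) (hH.conjGL_mem σ.symm hh)
  have h3 := aeval_coords_conjGL_map σ (conjGL σ.symm h)
    (leftInvDer X (p.map (σ.symm : ℂ →+* ℂ)))
  rwa [h1, map_zero, ← leftInvDer_map, hpσ, hσ] at h3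

/-- The Lie algebra of an algebraic group over the rationals is spanned by its rational points. -/
theorem mem_span_lieAlgQ {H : Subgroup (GLC n)} (hH : IsAlgebraicOver ℚ H) {X : MatC n}
    (hX : X ∈ lieAlg H) : X ∈ Submodule.span ℂ (Set.range fun Y : lieAlgQ H => ratToC (Y : MatQ n)) := by
  let e : MatC n ≃ₗ[ℂ] (Fin n × Fin n → ℂ) := (LinearEquiv.curry ℂ ℂ (Fin n) (Fin n)).symm
  have h1 := mem_span_rational ((lieAlg H).toSubmodule.map e.toLinearMap) (by
    rintro σ _ ⟨Y, hY, rfl⟩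
    exact ⟨Y.map σ, lieAlg_map_mem hH σ hY, rfl⟩) (e X) ⟨X, hX, rfl⟩
  have h2 := Submodule.mem_map_of_mem (f := e.symm.toLinearMap) h1
  rw [Submodule.map_span] at h2
  simp only [LinearEquiv.coe_coe, LinearEquiv.symm_apply_apply] at h2
  refine Submodule.span_mono ?_ h2
  rintro _ ⟨_, ⟨⟨Y, hY, rfl⟩, q, hq⟩, rfl⟩
  have hYq : Y = ratToC (fun i j => q (i, j)) := by
    ext i j
    exact congrFun hq (i, j)
  have hm : ratToC (fun i j => q (i, j)) ∈ lieAlg H := hYq ▸ hY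
  refine ⟨⟨fun i j => q (i, j), hm⟩, ?_⟩
  simp [← hYq]

end Translation

/-! ### Coactions as families of operators -/

section Coeff

variable {n : ℕ} {𝔥 : LieSubalgebra ℚ (MatQ n)} {H : Subgroup (GLC n)}
  {F : Type u} [Field F] [CharZero F]
  {A : Type v} [AddCommGroup A] [Module F A] [Module ℚ A]
  {B : Type w} [AddCommGroup B] [Module F B] [Module ℚ B]

/-- Contraction of the second factor with a linear functional. -/
def coeffMap {R : Type*} [AddCommGroup R] [Module ℚ R] (ℓ : R →ₗ[ℚ] ℚ) : A ⊗[ℚ] R →ₗ[F] A :=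
  (TensorProduct.AlgebraTensorModule.rid ℚ F A).toLinearMap ∘ₗ
    TensorProduct.AlgebraTensorModule.map LinearMap.id ℓ

section

variable {R R' : Type*} [AddCommGroup R] [Module ℚ R] [AddCommGroup R'] [Module ℚ R']

@[simp] theorem coeffMap_tmul (ℓ : R →ₗ[ℚ] ℚ) (x : A) (f : R) :
    coeffMap (F := F) ℓ (x ⊗ₜ[ℚ] f) = ℓ f • x := by
  simp [coeffMap]

theorem coeffMap_map (ℓ : R' →ₗ[ℚ] ℚ) (g : A →ₗ[F] B) (m : R →ₗ[ℚ] R') (t : A ⊗[ℚ] R) :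
    coeffMap (F := F) ℓ (TensorProduct.AlgebraTensorModule.map g m t) =
      g (coeffMap (F := F) (ℓ ∘ₗ m) t) := by
  induction t with
  | zero => simp
  | add x y hx hy => simp only [map_add, hx, hy]
  | tmul x f => simp [map_rat_smul g]

theorem eq_sum_coeffMap {ι : Type*} (b : Module.Basis ι ℚ R) (t : A ⊗[ℚ] R) :
    ∃ s : Finset ι, t = ∑ i ∈ s, coeffMap (F := F) (b.coord i) t ⊗ₜ[ℚ] b i := by
  classical
  obtain ⟨c, rfl⟩ := (TensorProduct.equivFinsuppOfBasisRight (M := A) b).symm.surjective t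
  have hsym : (TensorProduct.equivFinsuppOfBasisRight (M := A) b).symm c =
      ∑ i ∈ c.support, c i ⊗ₜ b i := by
    simp [Finsupp.sum]
  refine ⟨c.support, ?_⟩
  conv_lhs => rw [hsym]
  refine Finset.sum_congr rfl fun i hi => ?_
  congr 1
  rw [hsym, map_sum, Finset.sum_eq_single i]
  · simp
  · intro j _ hj
    simp [Finsupp.single_eq_of_ne, hj.symm]
  · intro h
    exact absurd hi h

variable (F) in
theorem eq_zero_of_coeffMap (t : A ⊗[ℚ] R) (h : ∀ ℓ, coeffMap (F := F) ℓ t = 0) : t = 0 := by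
  obtain ⟨s, hs⟩ := eq_sum_coeffMap (F := F) (Module.Basis.ofVectorSpace ℚ R) t
  rw [hs]
  exact Finset.sum_eq_zero fun i _ => by rw [h, TensorProduct.zero_tmul]

/-- Expand the tensor along a basis of `R`: it lies in $W \otimes R$ as soon as its coefficients lie
in `W`. -/
theorem mem_range_map_subtype_iff (W : Submodule F A) (t : A ⊗[ℚ] R) :
    t ∈ LinearMap.range (TensorProduct.AlgebraTensorModule.map W.subtype
      (LinearMap.id : R →ₗ[ℚ] R)) ↔ ∀ ℓ, coeffMap (F := F) ℓ t ∈ W := by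
  constructor
  · rintro ⟨t, rfl⟩ ℓ
    rw [coeffMap_map]
    exact (coeffMap (F := F) _ t).2
  · intro h
    obtain ⟨s, hs⟩ := eq_sum_coeffMap (F := F) (Module.Basis.ofVectorSpace ℚ R) t
    rw [hs]
    exact Submodule.sum_mem _ fun i _ => ⟨(⟨_, h _⟩ : W) ⊗ₜ Module.Basis.ofVectorSpace ℚ R i, rfl⟩

theorem coeffMap_assoc_symm (F' : Type w) [Field F'] [CharZero F'] [Algebra F F']
    (ℓ : R →ₗ[ℚ] ℚ) (c : F') (t : A ⊗[ℚ] R) :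
    coeffMap (F := F') ℓ
      ((TensorProduct.AlgebraTensorModule.assoc ℚ F F' F' A R).symm (c ⊗ₜ[F] t)) =
      c ⊗ₜ[F] coeffMap (F := F) ℓ t := by
  induction t with
  | zero => simp
  | add x y hx hy => simp only [map_add, TensorProduct.tmul_add, hx, hy]
  | tmul x f =>
    rw [TensorProduct.AlgebraTensorModule.assoc_symm_tmul, coeffMap_tmul, coeffMap_tmul]
    exact (map_rat_smul (TensorProduct.mk F F' A c) _ _).symm

end

/-- The operator on a module obtained from the coaction and a functional on the coordinate ring. -/
def PairAction.coeff (a : PairAction 𝔥 H F A) (ℓ : coordRing H →ₗ[ℚ] ℚ) : Module.End F A :=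
  coeffMap ℓ ∘ₗ a.coact

theorem PairAction.coeff_apply (a : PairAction 𝔥 H F A) (ℓ : coordRing H →ₗ[ℚ] ℚ) (x : A) :
    a.coeff ℓ x = coeffMap (F := F) ℓ (a.coact x) := rfl

/-- The operators through which the pair acts. -/
def PairAction.opSet (a : PairAction 𝔥 H F A) : Set (Module.End F A) :=
  Set.range a.lie ∪ Set.range a.coeff

/-- Reduces submodules over the pair to subspaces stable under a set of operators, so that only
linear algebra is needed afterwards. -/
theorem isStable_iff (a : PairAction 𝔥 H F A) (W : Submodule F A) :
    IsStable a W ↔ ∀ T ∈ a.opSet, ∀ x ∈ W, T x ∈ W := by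
  simp only [IsStable, mem_range_map_subtype_iff]
  constructor
  · rintro ⟨h1, h2⟩ T (⟨X, rfl⟩ | ⟨ℓ, rfl⟩) x hx
    · exact h1 X x hx
    · exact h2 x hx ℓ
  · exact fun h => ⟨fun X x hx => h _ (Or.inl ⟨X, rfl⟩) x hx,
      fun x hx ℓ => h _ (Or.inr ⟨ℓ, rfl⟩) x hx⟩

theorem coact_eq_iff (t t' : A ⊗[ℚ] coordRing H) :
    t = t' ↔ ∀ ℓ, coeffMap (F := F) ℓ t = coeffMap (F := F) ℓ t' := by
  refine ⟨fun h ℓ => h ▸ rfl, fun h => sub_eq_zero.1 (eq_zero_of_coeffMap F _ fun ℓ => ?_)⟩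
  rw [map_sub, h, sub_self]

/-- Multiplication by a character, on functionals. -/
def CompChar.dualMul (χ : CompChar H) (ℓ : coordRing H →ₗ[ℚ] ℚ) : coordRing H →ₗ[ℚ] ℚ :=
  ℓ ∘ₗ LinearMap.mulLeft ℚ χ.fn

/-- Twisted linearity becomes a family of operator identities, which can be base changed and sliced
one at a time. -/
theorem isTwistedHom_iff (a : PairAction 𝔥 H F A) (χ : CompChar H) (f : A →ₗ[F] A) :
    IsTwistedHom a χ f ↔ (∀ X, f * a.lie X = a.lie X * f) ∧
      ∀ ℓ, f * a.coeff (χ.dualMul ℓ) = a.coeff ℓ * f := by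
  simp only [IsTwistedHom, coact_eq_iff (F := F), coeffMap_map, LinearMap.ext_iff]
  exact and_congr Iff.rfl ⟨fun h ℓ x => (h x ℓ).symm, fun h x ℓ => (h ℓ x).symm⟩

theorem baseChange_lie (a : PairAction 𝔥 H F A) (F' : Type w) [Field F'] [CharZero F']
    [Algebra F F'] (X : 𝔥) : (a.baseChange F').lie X = (a.lie X).baseChange F' := rfl

theorem baseChange_coeff (a : PairAction 𝔥 H F A) (F' : Type w) [Field F'] [CharZero F']
    [Algebra F F'] (ℓ : coordRing H →ₗ[ℚ] ℚ) :
    (a.baseChange F').coeff ℓ = (a.coeff ℓ).baseChange F' := by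
  ext x
  exact coeffMap_assoc_symm F' ℓ 1 (a.coact x)

theorem opSet_baseChange (a : PairAction 𝔥 H F A) (F' : Type w) [Field F'] [CharZero F']
    [Algebra F F'] : (a.baseChange F').opSet = (fun T => T.baseChange F') '' a.opSet := by
  rw [PairAction.opSet, PairAction.opSet, Set.image_union, ← Set.range_comp, ← Set.range_comp]
  congr 2
  funext ℓ
  exact baseChange_coeff a F' ℓ

theorem IsTwistedHom.baseChange {a : PairAction 𝔥 H F A} {χ : CompChar H} {f : A →ₗ[F] A}
    (hf : IsTwistedHom a χ f) (F' : Type w) [Field F'] [CharZero F'] [Algebra F F'] :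
    IsTwistedHom (a.baseChange F') χ (f.baseChange F') := by
  rw [isTwistedHom_iff] at hf ⊢
  simp only [baseChange_lie, baseChange_coeff, ← LinearMap.baseChange_mul, hf.1, hf.2,
    implies_true, and_self]

theorem restrict_coeff (a : PairAction 𝔥 H F A) {H' : Subgroup (GLC n)} (h : H' ≤ H)
    (ℓ : coordRing H' →ₗ[ℚ] ℚ) :
    (a.restrict h).coeff ℓ = a.coeff (ℓ ∘ₗ (coordRes h).toLinearMap) := by
  ext x
  exact coeffMap_map ℓ (LinearMap.id : A →ₗ[F] A) (coordRes h).toLinearMap (a.coact x)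

theorem restrict_baseChange_opSet (a : PairAction 𝔥 H F A) {H' : Subgroup (GLC n)} (h : H' ≤ H)
    (F' : Type w) [Field F'] [CharZero F'] [Algebra F F'] :
    ((a.baseChange F').restrict h).opSet = (fun T => T.baseChange F') '' (a.restrict h).opSet := by
  rw [← opSet_baseChange, PairAction.opSet, PairAction.opSet]
  congr 2
  funext ℓ
  rw [restrict_coeff, baseChange_coeff, baseChange_coeff, restrict_coeff]

/-- Multiplication by χ is invisible after restriction to `χ.ker`, where χ equals one. -/
theorem dualMul_comp_coordRes (χ : CompChar H) (ℓ : coordRing χ.ker →ₗ[ℚ] ℚ) :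
    χ.dualMul (ℓ ∘ₗ (coordRes χ.ker_le).toLinearMap) = ℓ ∘ₗ (coordRes χ.ker_le).toLinearMap := by
  ext f
  refine congrArg ℓ (Subtype.ext (funext fun x => ?_))
  obtain ⟨_, k, hk, rfl⟩ := x
  change χ.hom k * (f : H → ℂ) k = (f : H → ℂ) k
  rw [show χ.hom k = 1 from hk, one_mul]

/-- Twisted homomorphisms are linear over the kernel of the character. -/
theorem IsTwistedHom.commute_opSet_ker {a : PairAction 𝔥 H F A} {χ : CompChar H} {f : A →ₗ[F] A}
    (hf : IsTwistedHom a χ f) : ∀ T ∈ (a.restrict χ.ker_le).opSet, f * T = T * f := by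
  rw [isTwistedHom_iff] at hf
  rintro _ (⟨X, rfl⟩ | ⟨ℓ, rfl⟩)
  · exact hf.1 X
  · rw [restrict_coeff, ← hf.2, dualMul_comp_coordRes]

/-- The coordinate ring is a quotient of a polynomial ring over ℚ in finitely many variables, and
the rational matrices are countable. Countability is what Schur's lemma needs in infinite dimension.
-/
theorem exists_countable_opSet (a : PairAction 𝔥 H F A) :
    ∃ S : Set (Module.End F A), S.Countable ∧ S ⊆ a.opSet ∧
      ∀ W : Submodule F A, (∀ T ∈ S, ∀ x ∈ W, T x ∈ W) → IsStable a W := by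
  have hc : Countable (coordRing H) := by
    have : Countable (MvPolynomial (Coord n) ℚ) :=
      Cardinal.mk_le_aleph0_iff.1 (MvPolynomial.cardinalMk_le_max.trans
        (max_le (max_le (Cardinal.mk_le_aleph0_iff.2 inferInstance)
          (Cardinal.mk_le_aleph0_iff.2 inferInstance)) le_rfl))
    exact Function.Surjective.countable (f := fun p => (⟨_, ⟨p, rfl⟩⟩ : coordRing H))
      fun ⟨_, p, hp⟩ => ⟨p, Subtype.ext hp⟩
  have hh : Countable 𝔥 := by
    have : Countable (MatQ n) := inferInstanceAs (Countable (Fin n → Fin n → ℚ))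
    exact Subtype.countable
  let b := Module.Basis.ofVectorSpace ℚ (coordRing H)
  have hb : Countable (Module.Basis.ofVectorSpaceIndex ℚ (coordRing H)) := b.injective.countable
  refine ⟨Set.range a.lie ∪ Set.range fun i => a.coeff (b.coord i),
    (Set.countable_range _).union (Set.countable_range _), ?_, fun W hW => ?_⟩
  · exact Set.union_subset_union_right _ (by rintro _ ⟨i, rfl⟩; exact ⟨_, rfl⟩)
  · refine ⟨fun X x hx => hW _ (Or.inl ⟨X, rfl⟩) x hx, fun x hx => ?_⟩
    obtain ⟨s, hs⟩ := eq_sum_coeffMap (F := F) b (a.coact x)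
    rw [hs]
    exact Submodule.sum_mem _ fun i _ => ⟨(⟨_, hW _ (Or.inr ⟨i, rfl⟩) x hx⟩ : W) ⊗ₜ b i, rfl⟩

end Coeff

/-! ### Testing on complex points -/

section Points

variable {n : ℕ} {𝔥 : LieSubalgebra ℚ (MatQ n)} {H : Subgroup (GLC n)}
  {A : Type v} [AddCommGroup A] [Module ℂ A] [Module ℚ A]
  {B : Type w} [AddCommGroup B] [Module ℂ B] [Module ℚ B]

theorem PairAction.act_apply (a : PairAction 𝔥 H ℂ A) (h : H) (x : A) :
    a.act h x = evalAt h (a.coact x) := rfl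

theorem evalAt_map {H' : Subgroup (GLC n)} (h : H) (h' : H') (g : A →ₗ[ℂ] B)
    (m : coordRing H' →ₗ[ℚ] coordRing H) (c : ℂ)
    (hm : ∀ f, (m f : H → ℂ) h = c * (f : H' → ℂ) h') (t : A ⊗[ℚ] coordRing H') :
    evalAt h (TensorProduct.AlgebraTensorModule.map g m t) = c • g (evalAt h' t) := by
  induction t with
  | zero => simp
  | add x y hx hy => simp only [map_add, smul_add, hx, hy]
  | tmul x f => simp [hm, mul_smul]

theorem restrict_act (a : PairAction 𝔥 H ℂ A) {H' : Subgroup (GLC n)} (h : H' ≤ H) (k : H') :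
    (a.restrict h).act k = a.act ⟨k, h k.2⟩ := by
  ext x
  have := evalAt_map (A := A) k ⟨k, h k.2⟩ LinearMap.id (coordRes h).toLinearMap 1
    (fun f => (one_mul _).symm) (a.coact x)
  rwa [one_smul] at this

/-- For algebraic groups over the rationals stability can be tested on complex points. -/
theorem isStable_iff_act (hH : IsAlgebraicOver ℚ H) (a : PairAction 𝔥 H ℂ A) (W : Submodule ℂ A) :
    IsStable a W ↔ (∀ X, ∀ x ∈ W, a.lie X x ∈ W) ∧ ∀ k, ∀ x ∈ W, a.act k x ∈ W := by
  refine and_congr Iff.rfl ⟨?_, ?_⟩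
  · intro h k x hx
    obtain ⟨t, ht⟩ := h x hx
    rw [PairAction.act_apply, ← ht,
      evalAt_map k k W.subtype LinearMap.id 1 (fun f => (one_mul _).symm), one_smul]
    exact (evalAt k t).2
  · intro h x hx
    rw [mem_range_map_subtype_iff]
    intro ℓ
    -- Stability says that the coaction vanishes modulo `W`; this is an equality of regular
    -- functions with values in the quotient, so complex points suffice.
    have h0 : TensorProduct.AlgebraTensorModule.map W.mkQ
        (LinearMap.id : coordRing H →ₗ[ℚ] coordRing H) (a.coact x) = 0 := by
      refine eq_zero_of_evalAt hH _ fun k => ?_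
      rw [evalAt_map k k W.mkQ LinearMap.id 1 (fun f => (one_mul _).symm), one_smul]
      exact (Submodule.Quotient.mk_eq_zero W).2 (h k x hx)
    have h1 := coeffMap_map (F := ℂ) ℓ W.mkQ LinearMap.id (a.coact x)
    rw [h0, map_zero] at h1
    exact (Submodule.Quotient.mk_eq_zero W).1 h1.symm

/-- For algebraic groups over the rationals twisted linearity can be tested on complex points. -/
theorem isTwistedHom_iff_act (hH : IsAlgebraicOver ℚ H) (a : PairAction 𝔥 H ℂ A) (χ : CompChar H)
    (f : A →ₗ[ℂ] A) : IsTwistedHom a χ f ↔ (∀ X x, f (a.lie X x) = a.lie X (f x)) ∧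
      ∀ k x, a.act k (f x) = χ.hom k • f (a.act k x) := by
  have key : ∀ k x, evalAt k (TensorProduct.AlgebraTensorModule.map f
      (LinearMap.mulLeft ℚ χ.fn) (a.coact x)) = χ.hom k • f (a.act k x) := fun k x =>
    evalAt_map k k f (LinearMap.mulLeft ℚ χ.fn) (χ.hom k) (fun g => rfl) (a.coact x)
  refine and_congr Iff.rfl ⟨fun h k x => ?_, fun h x => ?_⟩
  · rw [← key, ← h, PairAction.act_apply]
  · refine sub_eq_zero.1 (eq_zero_of_evalAt hH _ fun k => ?_)
    rw [map_sub, key, ← h, PairAction.act_apply, sub_self]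

/-- Operators that commute with the Lie algebra and all complex points commute with all
operators of the pair. -/
theorem commute_opSet_of_act (hH : IsAlgebraicOver ℚ H) (a : PairAction 𝔥 H ℂ A)
    (f : A →ₗ[ℂ] A) : (∀ T ∈ a.opSet, f * T = T * f) ↔ (∀ X, f * a.lie X = a.lie X * f) ∧
      ∀ k, f * a.act k = a.act k * f := by
  have key : ∀ x, a.coact (f x) = TensorProduct.AlgebraTensorModule.map f LinearMap.id (a.coact x)
      ↔ ∀ k, a.act k (f x) = f (a.act k x) := by
    intro x
    have h1 : ∀ k, evalAt k (TensorProduct.AlgebraTensorModule.map f LinearMap.id (a.coact x)) =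
        f (a.act k x) := fun k => by
      have := evalAt_map k k f LinearMap.id 1 (fun f => (one_mul _).symm) (a.coact x)
      rwa [one_smul] at this
    refine ⟨fun h k => ?_, fun h => sub_eq_zero.1 (eq_zero_of_evalAt hH _ fun k => ?_)⟩
    · rw [← h1, ← h, PairAction.act_apply]
    · rw [map_sub, h1, ← h, PairAction.act_apply, sub_self]
  constructor
  · intro h
    refine ⟨fun X => h _ (Or.inl ⟨X, rfl⟩), fun k => LinearMap.ext fun x => ?_⟩
    refine ((key x).1 ?_ k).symm
    rw [coact_eq_iff (F := ℂ)]
    intro ℓ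
    rw [coeffMap_map]
    exact (LinearMap.congr_fun (h _ (Or.inr ⟨ℓ, rfl⟩)) x).symm
  · rintro ⟨h1, h2⟩ _ (⟨X, rfl⟩ | ⟨ℓ, rfl⟩)
    · exact h1 X
    · ext x
      have := (key x).2 fun k => (LinearMap.congr_fun (h2 k) x).symm
      have h3 := coeffMap_map (F := ℂ) ℓ f LinearMap.id (a.coact x)
      rw [← this] at h3
      exact h3.symm

end Points

/-! ### Schur's lemma in countable dimension -/

section Schur

variable {M : Type*} [AddCommGroup M] [Module ℂ M]

open Polynomial in
-- Over ℂ the polynomial splits into linear factors, each of which is invertible at `f`.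
theorem isUnit_aeval_of_isUnit_sub {f : Module.End ℂ M}
    (hf : ∀ c : ℂ, IsUnit (f - algebraMap ℂ (Module.End ℂ M) c)) {q : ℂ[X]} (hq : q ≠ 0) :
    IsUnit (aeval f q) := by
  have h1 : ∀ m : Multiset ℂ, IsUnit (aeval f (m.map fun c => X - C c).prod) := by
    intro m
    induction m using Multiset.induction_on with
    | empty => simp
    | cons c m ih =>
      rw [Multiset.map_cons, Multiset.prod_cons, map_mul]
      refine IsUnit.mul ?_ ih
      simpa using hf c
  rw [(IsAlgClosed.splits q).eq_prod_roots, map_mul]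
  refine IsUnit.mul ?_ (h1 _)
  rw [aeval_C]
  exact (isUnit_iff_ne_zero.2 (leadingCoeff_ne_zero.2 hq)).map _

open Polynomial in
/-- The resolvents of an operator without spectrum are linearly independent. -/
theorem linearIndependent_resolvent {f : Module.End ℂ M}
    (hf : ∀ c : ℂ, IsUnit (f - algebraMap ℂ (Module.End ℂ M) c)) {v : M} (hv : v ≠ 0) :
    LinearIndependent ℂ fun c : ℂ => (((hf c).unit⁻¹ : (Module.End ℂ M)ˣ) : Module.End ℂ M) v := by
  classical
  rw [linearIndependent_iff']
  intro s a h i hi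
  let g : ℂ → Module.End ℂ M := fun c => (((hf c).unit⁻¹ : (Module.End ℂ M)ˣ) : Module.End ℂ M)
  have hg : ∀ c, (f - algebraMap ℂ (Module.End ℂ M) c) * g c = 1 := fun c =>
    (hf c).mul_val_inv
  -- Multiplying a relation between resolvents by $\prod_l (f - l)$ turns it into a polynomial in
  -- `f` that kills `v`. Such a polynomial is zero, and evaluating it at `i` isolates the
  -- coefficient `a i`.
  let Q : ℂ → ℂ[X] := fun j => ∏ l ∈ s.erase j, (X - C l)
  have hQ : ∀ j ∈ s, aeval f (∏ l ∈ s, (X - C l)) (g j v) = aeval f (Q j) v := by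
    intro j hj
    rw [← Finset.prod_erase_mul s _ hj, map_mul]
    have h2 : aeval f (X - C j) * g j = 1 := by
      rw [← hg j]
      simp
    rw [Module.End.mul_apply, ← Module.End.mul_apply (aeval f (X - C j)), h2]
    rfl
  have h3 : aeval f (∑ j ∈ s, C (a j) * Q j) v = 0 := by
    have := congrArg (aeval f (∏ l ∈ s, (X - C l))) h
    rw [map_zero, map_sum] at this
    rw [← this, map_sum, LinearMap.sum_apply]
    refine Finset.sum_congr rfl fun j hj => ?_
    rw [map_smul]
    change _ = a j • aeval f (∏ l ∈ s, (X - C l)) (g j v)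
    rw [hQ j hj]
    simp [Module.algebraMap_end_eq_smul_id]
  have h4 : ∑ j ∈ s, C (a j) * Q j = 0 := by
    by_contra h0
    have hu := (Module.End.isUnit_iff _).1 (isUnit_aeval_of_isUnit_sub hf h0)
    exact hv (hu.1 (h3.trans (map_zero _).symm))
  have h5 := congrArg (eval i) h4
  rw [eval_finsetSum, Finset.sum_eq_single_of_mem i hi, eval_zero, eval_mul, eval_C,
    eval_prod] at h5
  · refine (mul_eq_zero.1 h5).resolve_right (Finset.prod_ne_zero_iff.2 fun l hl => ?_)
    rw [eval_sub, eval_X, eval_C]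
    exact sub_ne_zero.2 (Finset.ne_of_mem_erase hl).symm
  · intro j _ hj
    rw [eval_mul, eval_prod, Finset.prod_eq_zero (Finset.mem_erase.2 ⟨hj.symm, hi⟩), mul_zero]
    simp

/-- Schur's lemma for an irreducible countable set of operators on a complex vector space. -/
theorem exists_eq_smul_of_commute (S : Set (Module.End ℂ M)) (hS : S.Countable)
    (hirr : ∀ W : Submodule ℂ M, (∀ T ∈ S, ∀ x ∈ W, T x ∈ W) → W = ⊥ ∨ W = ⊤)
    (f : Module.End ℂ M) (hf : ∀ T ∈ S, f * T = T * f) : ∃ c : ℂ, f = c • 1 := by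
  by_contra! H
  have hfx : ∀ T ∈ S, ∀ x, f (T x) = T (f x) := fun T hT x => LinearMap.congr_fun (hf T hT) x
  -- If `f` is not scalar, the kernel and the range of each `f - c` are stable, so irreducibility
  -- makes `f - c` bijective.
  have hu : ∀ c : ℂ, IsUnit (f - algebraMap ℂ (Module.End ℂ M) c) := by
    intro c
    have hne : f - algebraMap ℂ (Module.End ℂ M) c ≠ 0 := fun h =>
      H c (by rw [sub_eq_zero.1 h, Algebra.algebraMap_eq_smul_one])
    rw [Module.End.isUnit_iff]
    constructor
    · rw [← LinearMap.ker_eq_bot]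
      refine (hirr _ fun T hT x hx => ?_).resolve_right fun h => hne (LinearMap.ker_eq_top.1 h)
      simp only [LinearMap.mem_ker, LinearMap.sub_apply, Module.algebraMap_end_apply,
        hfx T hT] at hx ⊢
      rw [← map_smul, ← map_sub, hx, map_zero]
    · rw [← LinearMap.range_eq_top]
      refine (hirr _ ?_).resolve_left fun h => hne (LinearMap.range_eq_bot.1 h)
      rintro T hT _ ⟨x, rfl⟩
      exact ⟨T x, by simp [hfx T hT]⟩
  obtain ⟨v, hv⟩ : ∃ v : M, v ≠ 0 := by
    by_contra! h
    exact H 0 (LinearMap.ext fun x => by rw [h x]; simp)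
  have : Countable S := hS.to_subtype
  let U : Submodule ℂ M :=
    Submodule.span ℂ (Set.range fun l : List S => (l.map Subtype.val).prod v)
  have hU : U = ⊤ := by
    refine (hirr U fun T hT x hx => ?_).resolve_left fun h => hv ?_
    · induction hx using Submodule.span_induction with
      | mem x hx =>
        obtain ⟨l, rfl⟩ := hx
        exact Submodule.subset_span ⟨⟨T, hT⟩ :: l, by simp⟩
      | zero => rw [map_zero]; exact U.zero_mem
      | add x y _ _ hx hy => rw [map_add]; exact U.add_mem hx hy
      | smul c x _ hx => rw [map_smul]; exact U.smul_mem _ hx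
    · have : v ∈ U := Submodule.subset_span ⟨[], by simp⟩
      rwa [h, Submodule.mem_bot] at this
  -- Countably many words in `S` applied to `v` span, whereas the resolvents applied to `v` form an
  -- independent family indexed by ℂ.
  have h1 : Module.rank ℂ M ≤ Cardinal.aleph0 := by
    rw [← rank_top ℂ M, ← hU]
    exact (rank_span_le _).trans (Cardinal.mk_le_aleph0_iff.2 (Set.countable_range _).to_subtype)
  have h2 := (linearIndependent_resolvent hu hv).cardinal_lift_le_rank
  rw [Cardinal.mk_complex] at h2
  have h3 := h2.trans (Cardinal.lift_le.2 h1)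
  rw [Cardinal.lift_aleph0, Cardinal.lift_le_aleph0] at h3
  exact absurd h3 (not_le.2 Cardinal.aleph0_lt_continuum)

end Schur

/-! ### Descent along a field extension by linear functionals -/

section Slice

variable {E : Type*} {L : Type*} [Field E] [Field L] [Algebra E L]
  {A : Type*} [AddCommGroup A] [Module E A] {B : Type*} [AddCommGroup B] [Module E B]

/-- Contraction of the first factor with a linear functional. -/
def slice (μ : L →ₗ[E] E) : L ⊗[E] A →ₗ[E] A := TensorProduct.lid E A ∘ₗ μ.rTensor A

@[simp] theorem slice_tmul (μ : L →ₗ[E] E) (c : L) (x : A) : slice μ (c ⊗ₜ[E] x) = μ c • x := by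
  simp [slice]

theorem slice_baseChange (μ : L →ₗ[E] E) (T : A →ₗ[E] B) (t : L ⊗[E] A) :
    slice μ (T.baseChange L t) = T (slice μ t) := by
  induction t with
  | zero => simp
  | add x y hx hy => simp only [map_add, hx, hy]
  | tmul c x => simp

theorem eq_sum_slice {ι : Type*} (b : Module.Basis ι E L) (t : L ⊗[E] A) :
    ∃ s : Finset ι, t = ∑ i ∈ s, b i ⊗ₜ[E] slice (b.coord i) t := by
  classical
  obtain ⟨c, rfl⟩ := (TensorProduct.equivFinsuppOfBasisLeft (N := A) b).symm.surjective t
  have hsym : (TensorProduct.equivFinsuppOfBasisLeft (N := A) b).symm c =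
      ∑ i ∈ c.support, b i ⊗ₜ c i := by
    simp [Finsupp.sum]
  refine ⟨c.support, ?_⟩
  conv_lhs => rw [hsym]
  refine Finset.sum_congr rfl fun i hi => ?_
  congr 1
  rw [hsym, map_sum, Finset.sum_eq_single i]
  · simp
  · intro j _ hj
    simp [Finsupp.single_eq_of_ne, hj.symm]
  · intro h
    exact absurd hi h

theorem eq_zero_of_slice (t : L ⊗[E] A) (h : ∀ μ : L →ₗ[E] E, slice μ t = 0) : t = 0 := by
  obtain ⟨s, hs⟩ := eq_sum_slice (Module.Basis.ofVectorSpace E L) t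
  rw [hs]
  exact Finset.sum_eq_zero fun i _ => by rw [h, TensorProduct.tmul_zero]

theorem mem_baseChange_iff_slice (W : Submodule E A) (t : L ⊗[E] A) :
    t ∈ W.baseChange L ↔ ∀ μ : L →ₗ[E] E, slice μ t ∈ W := by
  constructor
  · intro ht μ
    obtain ⟨t, rfl⟩ := ht
    rw [slice_baseChange]
    exact (slice μ t).2
  · intro h
    obtain ⟨s, hs⟩ := eq_sum_slice (Module.Basis.ofVectorSpace E L) t
    rw [hs]
    exact Submodule.sum_mem _ fun i _ => Submodule.tmul_mem_baseChange_of_mem _ (h _)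

/-- The inclusion of `E` in `L` splits as a map of vector spaces. Slicing with such a functional
specialises identities over `L` to identities over `E`. -/
theorem exists_functional_one : ∃ μ : L →ₗ[E] E, μ 1 = 1 := by
  obtain ⟨μ, hμ⟩ := LinearMap.exists_leftInverse_of_injective (Algebra.linearMap E L)
    (LinearMap.ker_eq_bot.2 (algebraMap E L).injective)
  exact ⟨μ, by simpa using LinearMap.congr_fun hμ 1⟩

theorem one_tmul_mem_baseChange_iff (W : Submodule E A) (x : A) :
    (1 : L) ⊗ₜ[E] x ∈ W.baseChange L ↔ x ∈ W := by
  refine ⟨fun h => ?_, fun h => Submodule.tmul_mem_baseChange_of_mem _ h⟩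
  obtain ⟨μ, hμ⟩ := exists_functional_one (E := E) (L := L)
  simpa [hμ] using (mem_baseChange_iff_slice W _).1 h μ

theorem one_tmul_eq_zero_iff (x : A) : (1 : L) ⊗ₜ[E] x = 0 ↔ x = 0 := by
  refine ⟨fun h => ?_, fun h => by rw [h, TensorProduct.tmul_zero]⟩
  obtain ⟨μ, hμ⟩ := exists_functional_one (E := E) (L := L)
  simpa [hμ] using congrArg (slice μ) h

/-- The linear map over the small field obtained from a functional. -/
def sliceHom (f : L ⊗[E] A →ₗ[L] L ⊗[E] B) (μ : L →ₗ[E] E) : A →ₗ[E] B :=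
  slice μ ∘ₗ f.restrictScalars E ∘ₗ TensorProduct.mk E L A 1

theorem sliceHom_apply (f : L ⊗[E] A →ₗ[L] L ⊗[E] B) (μ : L →ₗ[E] E) (x : A) :
    sliceHom f μ x = slice μ (f (1 ⊗ₜ x)) := rfl

/-- Slices of an intertwiner over `L` are intertwiners over `E`, since the operators on both sides
are defined over `E`. -/
theorem sliceHom_comm (f : L ⊗[E] A →ₗ[L] L ⊗[E] B) (μ : L →ₗ[E] E) (T : Module.End E A)
    (T' : Module.End E B) (h : f ∘ₗ T.baseChange L = T'.baseChange L ∘ₗ f) :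
    sliceHom f μ ∘ₗ T = T' ∘ₗ sliceHom f μ := by
  ext x
  have := LinearMap.congr_fun h (1 ⊗ₜ x)
  simp only [LinearMap.comp_apply, LinearMap.baseChange_tmul] at this
  simp only [LinearMap.comp_apply, sliceHom_apply, this, slice_baseChange]

theorem eq_zero_of_sliceHom (f : L ⊗[E] A →ₗ[L] L ⊗[E] B)
    (h : ∀ μ : L →ₗ[E] E, sliceHom f μ = 0) : f = 0 := by
  ext x
  exact eq_zero_of_slice _ fun μ => LinearMap.congr_fun (h μ) x

/-- If all slices of `f` lie in a space of operators with a separating vector, then `f` lies in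
the base change of that space. -/
theorem mem_span_of_sliceHom_mem (D : Submodule E (Module.End E A)) (v₀ : A)
    (hv₀ : ∀ d ∈ D, d v₀ = 0 → d = 0) (f : Module.End L (L ⊗[E] A))
    (hf : ∀ μ : L →ₗ[E] E, sliceHom f μ ∈ D) :
    f ∈ Submodule.span L ((fun d : Module.End E A => d.baseChange L) '' D) := by
  -- Elements of the span have their slices in `D` too, so the hypothesis on `v₀` will apply to the
  -- difference of `f` and such an element.
  have hsl : ∀ g ∈ Submodule.span L ((fun d : Module.End E A => d.baseChange L) '' D),
      ∀ μ : L →ₗ[E] E, sliceHom g μ ∈ D := by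
    intro g hg
    induction hg using Submodule.span_induction with
    | mem g hg =>
      obtain ⟨d, hd, rfl⟩ := hg
      intro μ
      have : sliceHom (d.baseChange L) μ = μ 1 • d := by
        ext x; simp [sliceHom_apply]
      rw [this]
      exact D.smul_mem _ hd
    | zero =>
      intro μ
      have : sliceHom (0 : Module.End L (L ⊗[E] A)) μ = 0 := by ext x; simp [sliceHom_apply]
      rw [this]
      exact D.zero_mem
    | add g g' _ _ hg hg' =>
      intro μ
      have : sliceHom (g + g') μ = sliceHom g μ + sliceHom g' μ := by
        ext x; simp [sliceHom_apply]
      rw [this]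
      exact D.add_mem (hg μ) (hg' μ)
    | smul c g _ hg =>
      intro μ
      have : sliceHom (c • g) μ = sliceHom g (μ ∘ₗ LinearMap.mulLeft E c) := by
        ext x
        simp only [sliceHom_apply, LinearMap.smul_apply]
        induction g (1 ⊗ₜ x) with
        | zero => simp
        | add y z hy hz => simp only [smul_add, map_add, hy, hz]
        | tmul l y => simp [TensorProduct.smul_tmul']
      rw [this]
      exact hg _
  have h1 : f (1 ⊗ₜ v₀) ∈ (D.map (LinearMap.applyₗ (R := E) v₀)).baseChange L :=
    (mem_baseChange_iff_slice _ _).2 fun μ => ⟨_, hf μ, rfl⟩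
  -- An element `g` of the span agreeing with `f` at `1 ⊗ v₀`. The slices of `f - g` lie in `D` and
  -- kill `v₀`, so `f = g`.
  obtain ⟨g, hg, hgv⟩ : ∃ g ∈ Submodule.span L ((fun d : Module.End E A => d.baseChange L) '' D),
      g (1 ⊗ₜ v₀) = f (1 ⊗ₜ v₀) := by
    rw [Submodule.baseChange_eq_span] at h1
    generalize f (1 ⊗ₜ v₀) = t at h1
    induction h1 using Submodule.span_induction with
    | mem t ht =>
      obtain ⟨_, ⟨d, hd, rfl⟩, rfl⟩ := ht
      exact ⟨d.baseChange L, Submodule.subset_span ⟨d, hd, rfl⟩, by simp⟩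
    | zero => exact ⟨0, Submodule.zero_mem _, by simp⟩
    | add x y _ _ hx hy =>
      obtain ⟨g, hg, rfl⟩ := hx
      obtain ⟨g', hg', rfl⟩ := hy
      exact ⟨g + g', Submodule.add_mem _ hg hg', rfl⟩
    | smul c x _ hx =>
      obtain ⟨g, hg, rfl⟩ := hx
      exact ⟨c • g, Submodule.smul_mem _ c hg, rfl⟩
  have h2 : f - g = 0 := by
    refine eq_zero_of_sliceHom _ fun μ => hv₀ _ ?_ ?_
    · have : sliceHom (f - g) μ = sliceHom f μ - sliceHom g μ := by
        ext x; simp [sliceHom_apply]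
      rw [this]
      exact D.sub_mem (hf μ) (hsl g hg μ)
    · rw [sliceHom_apply, LinearMap.sub_apply, hgv, sub_self, map_zero]
  rwa [sub_eq_zero.1 h2]

end Slice

/-! ### Clifford theory in index two -/

section Clifford

variable {k V : Type*} [Field k] [CharZero k] [AddCommGroup V] [Module k V]

/-- The submodules of an irreducible module that are stable under an even part of index two are
eigenspaces of the twisting operator. -/
theorem eq_ker_of_even_stable (P N : Set (Module.End k V)) (ψ : Module.End k V) (c : k)
    (hc : c ≠ 0) (hψ : ψ * ψ = c • 1) (hP : ∀ T ∈ P, ψ * T = T * ψ)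
    (hN : ∀ T ∈ N, ψ * T = -(T * ψ))
    (hirr : ∀ U : Submodule k V, (∀ T ∈ P, ∀ x ∈ U, T x ∈ U) → (∀ T ∈ N, ∀ x ∈ U, T x ∈ U) →
      U = ⊥ ∨ U = ⊤)
    (hschur : ∀ f : Module.End k V, (∀ T ∈ P, f * T = T * f) → (∀ T ∈ N, f * T = T * f) →
      ∃ β : k, f = β • 1)
    (W : Submodule k V) (hW : ∀ T ∈ P, ∀ x ∈ W, T x ∈ W)
    (hoo : ∀ T ∈ N, ∀ T' ∈ N, ∀ x ∈ W, T (T' x) ∈ W)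
    (heo : ∀ T ∈ P, ∀ T' ∈ N, ∀ x ∈ W, T (T' x) ∈
      Submodule.span k {y | ∃ T ∈ N, ∃ x ∈ W, T x = y}) :
    W = ⊥ ∨ W = ⊤ ∨ ∃ α : k, α ^ 2 = c ∧ W = LinearMap.ker (ψ - α • 1) := by
  by_cases h0 : W = ⊥
  · exact Or.inl h0
  by_cases h1 : W = ⊤
  · exact Or.inr (Or.inl h1)
  refine Or.inr (Or.inr ?_)
  -- `W₁` is the image of `W` under the odd operators. Odd operators exchange `W` and `W₁`, so their
  -- sum and intersection are stable under everything and irreducibility makes them complementary.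
  let W₁ : Submodule k V := Submodule.span k {y | ∃ T ∈ N, ∃ x ∈ W, T x = y}
  have hNW : ∀ T ∈ N, ∀ x ∈ W, T x ∈ W₁ := fun T hT x hx =>
    Submodule.subset_span ⟨T, hT, x, hx, rfl⟩
  have hNW₁ : ∀ T ∈ N, ∀ x ∈ W₁, T x ∈ W := by
    intro T hT
    change W₁ ≤ W.comap T
    refine Submodule.span_le.2 ?_
    rintro _ ⟨T', hT', x, hx, rfl⟩
    exact hoo T hT T' hT' x hx
  have hPW₁ : ∀ T ∈ P, ∀ x ∈ W₁, T x ∈ W₁ := by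
    intro T hT
    change W₁ ≤ W₁.comap T
    refine Submodule.span_le.2 ?_
    rintro _ ⟨T', hT', x, hx, rfl⟩
    exact heo T hT T' hT' x hx
  have hsup : W ⊔ W₁ = ⊤ := by
    refine (hirr (W ⊔ W₁) (fun T hT x hx => ?_) fun T hT x hx => ?_).resolve_left
      fun h => h0 (eq_bot_iff.2 (le_sup_left.trans h.le))
    · obtain ⟨y, hy, z, hz, rfl⟩ := Submodule.mem_sup.1 hx
      rw [map_add]
      exact Submodule.add_mem_sup (hW T hT y hy) (hPW₁ T hT z hz)
    · obtain ⟨y, hy, z, hz, rfl⟩ := Submodule.mem_sup.1 hx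
      rw [map_add, add_comm]
      exact Submodule.add_mem_sup (hNW₁ T hT z hz) (hNW T hT y hy)
  have hinf : W ⊓ W₁ = ⊥ := by
    refine (hirr (W ⊓ W₁) (fun T hT x hx => ⟨hW T hT x hx.1, hPW₁ T hT x hx.2⟩)
      fun T hT x hx => ⟨hNW₁ T hT x hx.2, hNW T hT x hx.1⟩).resolve_right
      fun h => h1 (eq_top_iff.2 (h.ge.trans inf_le_left))
  have hcompl : IsCompl W W₁ := ⟨disjoint_iff.2 hinf, codisjoint_iff.2 hsup⟩
  -- The sign operator of the decomposition. Like `ψ` it commutes with the even operators and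
  -- anticommutes with the odd ones, so `ψ * s` commutes with both and is a scalar β; then `ψ = β •
  -- s`.
  let s : Module.End k V := LinearMap.ofIsCompl hcompl W.subtype (-W₁.subtype)
  have hs : ∀ x ∈ W, s x = x := fun x hx => LinearMap.ofIsCompl_apply_left hcompl ⟨x, hx⟩
  have hs₁ : ∀ x ∈ W₁, s x = -x := fun x hx => LinearMap.ofIsCompl_apply_right hcompl ⟨x, hx⟩
  have hdec : ∀ x, ∃ y ∈ W, ∃ z ∈ W₁, y + z = x := fun x =>
    Submodule.mem_sup.1 (hsup ▸ Submodule.mem_top)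
  have hsP : ∀ T ∈ P, s * T = T * s := by
    intro T hT
    ext x
    obtain ⟨y, hy, z, hz, rfl⟩ := hdec x
    simp [hs y hy, hs₁ z hz, hs _ (hW T hT y hy), hs₁ _ (hPW₁ T hT z hz)]
  have hsN : ∀ T ∈ N, s * T = -(T * s) := by
    intro T hT
    ext x
    obtain ⟨y, hy, z, hz, rfl⟩ := hdec x
    simp [hs y hy, hs₁ z hz, hs₁ _ (hNW T hT y hy), hs _ (hNW₁ T hT z hz), add_comm]
  have hss : s * s = 1 := by
    ext x
    obtain ⟨y, hy, z, hz, rfl⟩ := hdec x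
    simp [hs y hy, hs₁ z hz]
  obtain ⟨β, hβ⟩ := hschur (ψ * s)
    (fun T hT => by rw [mul_assoc, hsP T hT, ← mul_assoc, hP T hT, mul_assoc])
    (fun T hT => by
      rw [mul_assoc, hsN T hT, mul_neg, ← mul_assoc, hN T hT, neg_mul, neg_neg, mul_assoc])
  have hψs : ψ = β • s := by
    rw [← mul_one ψ, ← hss, ← mul_assoc, hβ, smul_mul_assoc, one_mul]
  have hβ2 : (β ^ 2 - c) • (1 : Module.End k V) = 0 := by
    rw [sub_smul, ← hψ, hψs, smul_mul_smul_comm, hss, sq, sub_self]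
  obtain ⟨w, hw, hw0⟩ := Submodule.exists_mem_ne_zero_of_ne_bot h0
  have hβc : β ^ 2 = c := by
    have := LinearMap.congr_fun hβ2 w
    exact sub_eq_zero.1 ((smul_eq_zero.1 this).resolve_right hw0)
  have hβ0 : β ≠ 0 := fun h => hc (by rw [← hβc, h]; simp)
  refine ⟨β, hβc, le_antisymm (fun x hx => ?_) fun x hx => ?_⟩
  · rw [LinearMap.mem_ker, hψs]
    simp [hs x hx]
  · obtain ⟨y, hy, z, hz, rfl⟩ := hdec x
    rw [LinearMap.mem_ker, hψs] at hx
    simp only [LinearMap.sub_apply, LinearMap.smul_apply, map_add, hs y hy, hs₁ z hz,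
      Module.End.one_apply] at hx
    have h2 : (2 * β) • z = 0 := by
      rw [← neg_eq_zero, ← hx]
      module
    rw [(smul_eq_zero.1 h2).resolve_left (mul_ne_zero two_ne_zero hβ0), add_zero]
    exact hy

/-- The commutant of an even part of index two. -/
theorem commutant_of_even (P : Set (Module.End k V)) (ψ κ κ' : Module.End k V) (c : k)
    (hc : c ≠ 0) (hψ : ψ * ψ = c • 1) (hP : ∀ T ∈ P, ψ * T = T * ψ) (hκψ : ψ * κ = -(κ * ψ))
    (hκ : κ * κ' = 1) (hκ' : κ' * κ = 1)
    (hconj : ∀ f : Module.End k V, (∀ T ∈ P, f * T = T * f) →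
      ∀ T ∈ P, κ * f * κ' * T = T * (κ * f * κ'))
    (hsq : ∀ f : Module.End k V, (∀ T ∈ P, f * T = T * f) → f * (κ * κ) = κ * κ * f)
    (hschur : ∀ f : Module.End k V, (∀ T ∈ P, f * T = T * f) → f * κ = κ * f →
      ∃ β : k, f = β • 1)
    (f : Module.End k V) (hf : ∀ T ∈ P, f * T = T * f) : ∃ x y : k, f = x • 1 + y • ψ := by
  -- The conjugate of `f` by the odd element; conjugating twice is harmless since `κ * κ` commutes
  -- with `f`. Hence `f + g` commutes with `κ`, while `f - g` anticommutes with it and becomes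
  -- central after multiplication by `ψ`.
  let g := κ * f * κ'
  have hg := hconj f hf
  have hgκ : g * κ = κ * f := by rw [mul_assoc, hκ', mul_one]
  have hκg : κ * g = f * κ := by
    rw [← mul_assoc, ← mul_assoc, ← hsq f hf, mul_assoc, mul_assoc, hκ, mul_one]
  obtain ⟨x, hx⟩ := hschur (f + g) (fun T hT => by rw [add_mul, mul_add, hf T hT, hg T hT])
    (by rw [add_mul, mul_add, hgκ, hκg, add_comm])
  obtain ⟨y, hy⟩ := hschur ((f - g) * ψ)
    (fun T hT => by
      rw [mul_assoc, hP T hT, ← mul_assoc, sub_mul, hf T hT, hg T hT, ← mul_sub, mul_assoc])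
    (by rw [mul_assoc, hκψ, mul_neg, ← mul_assoc, sub_mul, hgκ, ← neg_mul, neg_sub, ← hκg,
      ← mul_sub, mul_assoc])
  -- From $f + g = x$ and $(f - g)\psi = y$, using $\psi^{-1} = c^{-1}\psi$.
  refine ⟨x / 2, y / (2 * c), ?_⟩
  have h1 : f - g = (y / c) • ψ := by
    have : (f - g) * ψ * ψ = y • ψ := by rw [hy, smul_mul_assoc, one_mul]
    rw [mul_assoc, hψ, mul_smul_comm, mul_one] at this
    rw [div_eq_inv_mul, mul_smul, ← this, smul_smul, inv_mul_cancel₀ hc, one_smul]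
  have h2 : (2 : k) • f = x • 1 + (y / c) • ψ := by
    rw [← hx, ← h1, two_smul]
    abel
  have h3 : f = (2 : k)⁻¹ • ((2 : k) • f) := by
    rw [smul_smul, inv_mul_cancel₀ two_ne_zero, one_smul]
  rw [h3, h2, smul_add, smul_smul, smul_smul]
  congr 2 <;> field_simp

end Clifford

/-! ### Extension of scalars for a two-dimensional commutant -/

section TwistData

variable {E : Type*} [Field E] {A : Type*} [AddCommGroup A] [Module E A]

theorem exists_dual_eq_one {v : A} (hv : v ≠ 0) : ∃ μ : A →ₗ[E] E, μ v = 1 := by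
  obtain ⟨μ, hμ⟩ := Module.Projective.exists_dual_ne_zero E hv
  exact ⟨(μ v)⁻¹ • μ, by simp [hμ]⟩

/-- Commuting with the rank one operators already forces `h` to be a scalar. -/
theorem exists_eq_smul_of_commute_all (h : Module.End E A) (hh : ∀ g : Module.End E A, h * g = g * h) :
    ∃ β : E, h = β • 1 := by
  by_cases h0 : ∀ v : A, v = 0
  · exact ⟨0, LinearMap.ext fun v => by rw [h0 v]; simp⟩
  push Not at h0
  obtain ⟨v, hv⟩ := h0
  obtain ⟨μ, hμ⟩ := exists_dual_eq_one (E := E) hv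
  refine ⟨μ (h v), LinearMap.ext fun x => ?_⟩
  have := LinearMap.congr_fun (hh (μ.smulRight x)) v
  simpa [hμ] using this

/-- A nonzero tensor has a nonzero coordinate in `L` along some functional on `A`, and rank one
operators extract it. -/
theorem exists_dual_slice_ne_zero {L : Type*} [Field L] [Algebra E L] (t : L ⊗[E] A) (ht : t ≠ 0) :
    ∃ μ : A →ₗ[E] E, ∃ φ : L, φ ≠ 0 ∧ ∀ x : A, (μ.smulRight x).baseChange L t = φ ⊗ₜ[E] x := by
  classical
  let b := Module.Basis.ofVectorSpace E A
  by_contra! H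
  have key : ∀ μ : A →ₗ[E] E, ∀ t : L ⊗[E] A, ∀ x : A, (μ.smulRight x).baseChange L t =
      (TensorProduct.rid E L (μ.lTensor L t)) ⊗ₜ[E] x := by
    intro μ t x
    induction t with
    | zero => simp
    | add y z hy hz => simp only [map_add, hy, hz, TensorProduct.add_tmul]
    | tmul c y => simp [TensorProduct.smul_tmul]
  have h0 : ∀ μ : A →ₗ[E] E, TensorProduct.rid E L (μ.lTensor L t) = 0 := by
    intro μ
    by_contra h
    obtain ⟨x, hx⟩ := H μ _ h
    exact hx (key μ t x)
  apply ht
  apply (TensorProduct.equivFinsuppOfBasisRight (M := L) b).injective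
  rw [map_zero]
  ext i
  rw [Finsupp.zero_apply, ← h0 (b.coord i)]
  clear * -
  induction t with
  | zero => simp
  | add y z hy hz => simp only [map_add, Finsupp.add_apply, hy, hz]
  | tmul c y => simp

/-- Rank one operators carry one nonzero vector to a nonzero multiple of each `1 ⊗ x`, so no
finiteness of `A` is needed. -/
theorem eq_top_of_stable_all {L : Type*} [Field L] [Algebra E L] (U : Submodule L (L ⊗[E] A))
    (hU : ∀ g : Module.End E A, ∀ t ∈ U, g.baseChange L t ∈ U) : U = ⊥ ∨ U = ⊤ := by
  by_cases h0 : U = ⊥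
  · exact Or.inl h0
  refine Or.inr ?_
  obtain ⟨t, ht, ht0⟩ := Submodule.exists_mem_ne_zero_of_ne_bot h0
  obtain ⟨μ, φ, hφ, h⟩ := exists_dual_slice_ne_zero t ht0
  rw [eq_top_iff]
  rintro z -
  induction z with
  | zero => exact U.zero_mem
  | add y z hy hz => exact U.add_mem hy hz
  | tmul c x =>
    have := U.smul_mem (c / φ) (h x ▸ hU _ t ht)
    rwa [TensorProduct.smul_tmul', smul_eq_mul, div_mul_cancel₀ _ hφ] at this

/-- A set of operators whose commutant is the quadratic algebra generated by `ψ`, and which is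
dense in the commutant of `ψ`. -/
structure IsTwistPair (S : Set (Module.End E A)) (ψ : Module.End E A) (c : E) : Prop where
  ne_zero : c ≠ 0
  sq : ψ * ψ = c • 1
  comm : ∀ T ∈ S, ψ * T = T * ψ
  not_scalar : ∀ x : E, ψ ≠ x • 1
  commutant : ∀ f : Module.End E A, (∀ T ∈ S, f * T = T * f) → ∃ x y : E, f = x • 1 + y • ψ
  dense : ∀ g : Module.End E A, ψ * g = g * ψ → ∀ s : Finset A,
    ∃ r ∈ Algebra.adjoin E S, ∀ m ∈ s, r m = g m

theorem ker_baseChange_sub {L : Type*} [Field L] [Algebra E L] (ψ : Module.End E A) (α : L) (x : A) :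
    (1 : L) ⊗ₜ[E] x ∈ LinearMap.ker (ψ.baseChange L - α • 1) ↔ (1 : L) ⊗ₜ[E] ψ x = α ⊗ₜ x := by
  rw [LinearMap.mem_ker]
  simp [sub_eq_zero, TensorProduct.smul_tmul']

/-- Submodules over the small field, from the knowledge of the submodules over a large field. -/
theorem eq_ker_of_baseChange (L : Type*) [Field L] [Algebra E L] {S : Set (Module.End E A)}
    {ψ : Module.End E A} {c : E} (hψ : ψ * ψ = c • 1)
    (hL : ∀ W : Submodule L (L ⊗[E] A), (∀ T ∈ S, ∀ x ∈ W, T.baseChange L x ∈ W) →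
      W = ⊥ ∨ W = ⊤ ∨ ∃ α : L, W = LinearMap.ker (ψ.baseChange L - α • 1))
    (W : Submodule E A) (hW : ∀ T ∈ S, ∀ x ∈ W, T x ∈ W) :
    W = ⊥ ∨ W = ⊤ ∨ ∃ α : E, α ^ 2 = c ∧ W = LinearMap.ker (ψ - α • 1) := by
  have hWL : ∀ T ∈ S, ∀ x ∈ W.baseChange L, T.baseChange L x ∈ W.baseChange L := by
    intro T hT x hx
    rw [mem_baseChange_iff_slice] at hx ⊢
    intro μ
    rw [slice_baseChange]
    exact hW T hT _ (hx μ)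
  by_cases hbot : W = ⊥
  · exact Or.inl hbot
  obtain ⟨w, hw, hw0⟩ := Submodule.exists_mem_ne_zero_of_ne_bot hbot
  rcases hL _ hWL with h | h | ⟨α, h⟩
  · have := (one_tmul_mem_baseChange_iff (L := L) W w).2 hw
    rw [h, Submodule.mem_bot, one_tmul_eq_zero_iff] at this
    exact absurd this hw0
  · refine Or.inr (Or.inl (eq_top_iff.2 fun x _ => ?_))
    rw [← one_tmul_mem_baseChange_iff (L := L), h]
    trivial
  · refine Or.inr (Or.inr ?_)
    have key : ∀ x ∈ W, (1 : L) ⊗ₜ[E] ψ x = α ⊗ₜ x := fun x hx => by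
      rw [← ker_baseChange_sub, ← h]
      exact (one_tmul_mem_baseChange_iff W x).2 hx
    obtain ⟨μ, hμ⟩ := exists_functional_one (E := E) (L := L)
    have hψw : ∀ x ∈ W, ψ x = μ α • x := fun x hx => by
      simpa [hμ] using congrArg (slice μ) (key x hx)
    -- The eigenvalue lies in `E`: it is attained at a nonzero vector of `A`, on which `ψ` is
    -- defined over `E`.
    have hα : ∀ x, (α ⊗ₜ[E] x : L ⊗[E] A) = 1 ⊗ₜ (μ α • x) := by
      have h1 : ((α - algebraMap E L (μ α)) ⊗ₜ[E] w : L ⊗[E] A) = 0 := by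
        rw [TensorProduct.sub_tmul, ← key w hw, hψw w hw, Algebra.algebraMap_eq_smul_one,
          TensorProduct.smul_tmul, sub_self]
      obtain ⟨ν, hν⟩ := exists_dual_eq_one (E := E) hw0
      have h2 : α = algebraMap E L (μ α) := by
        have := congrArg (fun t => TensorProduct.rid E L (ν.lTensor L t)) h1
        simp [hν] at this
        exact sub_eq_zero.1 this
      intro x
      rw [TensorProduct.tmul_smul, TensorProduct.smul_tmul', ← Algebra.algebraMap_eq_smul_one, ← h2]
    refine ⟨μ α, ?_, le_antisymm (fun x hx => ?_) fun x hx => ?_⟩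
    · have h1 := LinearMap.congr_fun hψ w
      rw [Module.End.mul_apply, hψw w hw, map_smul, hψw w hw, smul_smul, ← sq] at h1
      exact smul_left_injective E hw0 h1
    · rw [LinearMap.mem_ker]
      simp [hψw x hx]
    · rw [← one_tmul_mem_baseChange_iff (L := L), h, ker_baseChange_sub, hα]
      rw [LinearMap.mem_ker] at hx
      have hx' : ψ x = μ α • x := by simpa [sub_eq_zero] using hx
      rw [hx']

/-- The known submodules show that `A` is semisimple over the algebra generated by `S`, the
eigenspaces for `α` and `-α` being complementary. Its commutant is spanned by `1` and `ψ`, so `g`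
lies in the bicommutant and Jacobson density applies. -/
theorem dense_of_commutant [CharZero E] {S : Set (Module.End E A)}
    {ψ : Module.End E A} {c : E} (hc : c ≠ 0) (hψ : ψ * ψ = c • 1)
    (hcomm : ∀ T ∈ S, ψ * T = T * ψ)
    (hsub : ∀ W : Submodule E A, (∀ T ∈ S, ∀ x ∈ W, T x ∈ W) →
      W = ⊥ ∨ W = ⊤ ∨ ∃ α : E, α ^ 2 = c ∧ W = LinearMap.ker (ψ - α • 1))
    (hcen : ∀ f : Module.End E A, (∀ T ∈ S, f * T = T * f) → ∃ x y : E, f = x • 1 + y • ψ)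
    (g : Module.End E A) (hg : ψ * g = g * ψ) (s : Finset A) :
    ∃ r ∈ Algebra.adjoin E S, ∀ m ∈ s, r m = g m := by
  let R := Algebra.adjoin E S
  have hRcomm : ∀ r ∈ R, ψ * r = r * ψ := by
    intro r hr
    induction hr using Algebra.adjoin_induction with
    | mem T hT => exact hcomm T hT
    | algebraMap e => exact (Algebra.commutes e ψ).symm
    | add x y _ _ hx hy => rw [mul_add, add_mul, hx, hy]
    | mul x y _ _ hx hy => rw [← mul_assoc, hx, mul_assoc, hy, mul_assoc]
  let Ker (α : E) : Submodule R A :=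
    { carrier := {x | ψ x = α • x}
      add_mem' := fun {x y} hx hy => by
        change ψ (x + y) = α • (x + y)
        rw [map_add, smul_add, show ψ x = α • x from hx, show ψ y = α • y from hy]
      zero_mem' := by simp
      smul_mem' := fun r x hx => by
        have h1 := LinearMap.congr_fun (hRcomm r.1 r.2) x
        change ψ (r.1 x) = α • r.1 x
        rw [Module.End.mul_apply, Module.End.mul_apply, show ψ x = α • x from hx, map_smul] at h1
        exact h1 }
  have hss : ComplementedLattice (Submodule R A) := by
    refine ⟨fun W => ?_⟩
    rcases hsub (W.restrictScalars E) (fun T hT x hx =>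
      W.smul_mem (⟨T, Algebra.subset_adjoin hT⟩ : R) hx) with h | h | ⟨α, hα, h⟩
    · have : W = ⊥ := (Submodule.restrictScalars_eq_bot_iff E R A).1 h
      exact this ▸ ⟨⊤, isCompl_bot_top⟩
    · have : W = ⊤ := (Submodule.restrictScalars_eq_top_iff E R A).1 h
      exact this ▸ ⟨⊥, isCompl_top_bot⟩
    · have hα0 : α ≠ 0 := fun h => hc (by rw [← hα, h]; simp)
      have hW : W = Ker α := by
        ext x
        rw [← Submodule.restrictScalars_mem E, h, LinearMap.mem_ker]
        change _ ↔ ψ x = α • x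
        simp [sub_eq_zero]
      refine ⟨Ker (-α), ?_⟩
      rw [hW]
      constructor
      · rw [Submodule.disjoint_def]
        intro x hx hx'
        have h1 : α • x = -α • x := (show ψ x = α • x from hx).symm.trans hx'
        have h2 : (2 * α) • x = 0 := by
          rw [two_mul, add_smul]
          nth_rewrite 1 [h1]
          simp
        exact (smul_eq_zero.1 h2).resolve_left (mul_ne_zero two_ne_zero hα0)
      · rw [codisjoint_iff, eq_top_iff]
        rintro x -
        have hψ2 : ψ (ψ x) = (α * α) • x := by
          have := LinearMap.congr_fun hψ x
          rw [← sq, hα]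
          exact this
        -- The two eigenprojections of `ψ`, using `ψ² = α²`.
        refine Submodule.mem_sup.2 ⟨(2 * α)⁻¹ • (α • x + ψ x), ?_, (2 * α)⁻¹ • (α • x - ψ x), ?_, ?_⟩
        · change ψ _ = α • _
          rw [map_smul, map_add, map_smul, hψ2, smul_comm α]
          congr 1
          module
        · change ψ _ = -α • _
          rw [map_smul, map_sub, map_smul, hψ2, smul_comm (-α)]
          congr 1
          module
        · rw [← smul_add, add_add_sub_cancel, ← two_smul E (α • x), smul_smul, smul_smul,
            mul_assoc, inv_mul_cancel₀ (mul_ne_zero two_ne_zero hα0), one_smul]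
  have : IsSemisimpleModule R A := (isSemisimpleModule_iff R A).2 hss
  let f : Module.End (Module.End R A) A :=
    { toFun := g
      map_add' := map_add g
      map_smul' := fun h x => by
        obtain ⟨p, q, hpq⟩ := hcen (h.restrictScalars E) (fun T hT => LinearMap.ext fun x =>
          h.map_smul (⟨T, Algebra.subset_adjoin hT⟩ : R) x)
        have hx : ∀ x, h x = p • x + q • ψ x := fun x => LinearMap.congr_fun hpq x
        have h1 := LinearMap.congr_fun hg x
        simp only [Module.End.mul_apply] at h1
        change g (h x) = h (g x)
        rw [hx, hx, map_add, map_smul, map_smul, h1] }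
  obtain ⟨r, hr⟩ := jacobson_density f s
  exact ⟨r.1, r.2, fun m hm => (hr m hm).symm⟩

variable {S : Set (Module.End E A)} {ψ : Module.End E A} {c : E}

/-- Construction of a twist pair from information over a larger field. -/
theorem IsTwistPair.of_baseChange [CharZero E] (L : Type*) [Field L] [Algebra E L]
    (hc : c ≠ 0) (hψ : ψ * ψ = c • 1)
    (hcomm : ∀ T ∈ S, ψ * T = T * ψ) (hns : ∀ x : L, ψ.baseChange L ≠ x • 1)
    (hL : ∀ W : Submodule L (L ⊗[E] A), (∀ T ∈ S, ∀ x ∈ W, T.baseChange L x ∈ W) →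
      W = ⊥ ∨ W = ⊤ ∨ ∃ α : L, W = LinearMap.ker (ψ.baseChange L - α • 1))
    (hcen : ∀ f : Module.End L (L ⊗[E] A), (∀ T ∈ S, f * T.baseChange L = T.baseChange L * f) →
      ∃ x y : L, f = x • 1 + y • ψ.baseChange L) : IsTwistPair S ψ c := by
  have hcenE : ∀ f : Module.End E A, (∀ T ∈ S, f * T = T * f) → ∃ x y : E, f = x • 1 + y • ψ := by
    intro f hf
    obtain ⟨x, y, hxy⟩ := hcen (f.baseChange L) fun T hT => by
      rw [← LinearMap.baseChange_mul, hf T hT, LinearMap.baseChange_mul]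
    obtain ⟨μ, hμ⟩ := exists_functional_one (E := E) (L := L)
    refine ⟨μ x, μ y, LinearMap.ext fun v => ?_⟩
    have := congrArg (slice μ) (LinearMap.congr_fun hxy (1 ⊗ₜ v))
    simpa [hμ, TensorProduct.smul_tmul'] using this
  refine ⟨hc, hψ, hcomm, fun x hx => ?_, hcenE,
    dense_of_commutant hc hψ hcomm (eq_ker_of_baseChange L hψ hL) hcenE⟩
  refine hns (algebraMap E L x) ?_
  rw [hx]
  ext v
  simp [TensorProduct.smul_tmul', Algebra.algebraMap_eq_smul_one]

namespace IsTwistPair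

/-- If `v` and `ψ v` were dependent for every `v`, then `ψ` would be a scalar. The vector found
separates the commutant, which makes slicing effective in infinite dimension. -/
theorem exists_separating (h : IsTwistPair S ψ c) :
    ∃ v : A, ∀ x y : E, x • v + y • ψ v = 0 → x = 0 ∧ y = 0 := by
  by_contra! H
  obtain ⟨a, ha⟩ := LinearMap.exists_eq_smul_id_of_forall_notLinearIndependent (f := ψ) fun v hv => by
    obtain ⟨x, y, h1, h2⟩ := H v
    have := LinearIndependent.pair_iff.1 hv x y h1
    exact h2 this.1 this.2
  exact h.not_scalar a ha

variable (h : IsTwistPair S ψ c) (F : Type*) [Field F] [Algebra E F]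

include h

/-- All slices of `f` lie in the span of `1` and `ψ`, which has a separating vector, so `f` lies in
the base change of this span. -/
theorem commutant_baseChange (f : Module.End F (F ⊗[E] A))
    (hf : ∀ T ∈ S, f * T.baseChange F = T.baseChange F * f) :
    ∃ x y : F, f = x • 1 + y • ψ.baseChange F := by
  obtain ⟨v, hv⟩ := h.exists_separating
  have h1 := mem_span_of_sliceHom_mem (Submodule.span E {1, ψ}) v (fun d hd hdv => by
    obtain ⟨x, y, rfl⟩ := Submodule.mem_span_pair.1 hd
    obtain ⟨rfl, rfl⟩ := hv x y hdv
    simp) f fun μ => by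
      obtain ⟨x, y, hxy⟩ := h.commutant (sliceHom f μ) fun T hT => sliceHom_comm f μ T T (hf T hT)
      exact Submodule.mem_span_pair.2 ⟨x, y, hxy.symm⟩
  clear hf
  induction h1 using Submodule.span_induction with
  | mem g hg =>
    obtain ⟨d, hd, rfl⟩ := hg
    obtain ⟨x, y, rfl⟩ := Submodule.mem_span_pair.1 hd
    refine ⟨algebraMap E F x, algebraMap E F y, ?_⟩
    ext v
    simp [TensorProduct.smul_tmul', Algebra.algebraMap_eq_smul_one]
  | zero => exact ⟨0, 0, by simp⟩
  | add f g _ _ hf hg =>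
    obtain ⟨x, y, rfl⟩ := hf
    obtain ⟨x', y', rfl⟩ := hg
    exact ⟨x + x', y + y', by module⟩
  | smul e f _ hf =>
    obtain ⟨x, y, rfl⟩ := hf
    exact ⟨e * x, e * y, by module⟩

theorem sq_baseChange : ψ.baseChange F * ψ.baseChange F = algebraMap E F c • 1 := by
  rw [← LinearMap.baseChange_mul, h.sq]
  ext v
  simp [TensorProduct.smul_tmul', Algebra.algebraMap_eq_smul_one]

theorem baseChange_ne_smul (x : F) : ψ.baseChange F ≠ x • 1 := by
  intro hx
  obtain ⟨μ, hμ⟩ := exists_functional_one (E := E) (L := F)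
  refine h.not_scalar (μ x) (LinearMap.ext fun v => ?_)
  have := congrArg (slice μ) (LinearMap.congr_fun hx (1 ⊗ₜ v))
  simpa [hμ, TensorProduct.smul_tmul'] using this

/-- The submodules over an extension field. -/
theorem eq_ker_of_stable [CharZero E] [CharZero F] (W : Submodule F (F ⊗[E] A))
    (hW : ∀ T ∈ S, ∀ x ∈ W, T.baseChange F x ∈ W) :
    W = ⊥ ∨ W = ⊤ ∨ ∃ α : F, α ^ 2 = algebraMap E F c ∧
      W = LinearMap.ker (ψ.baseChange F - α • 1) := by
  have hR : ∀ r ∈ Algebra.adjoin E S, ∀ x ∈ W, r.baseChange F x ∈ W := by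
    intro r hr
    induction hr using Algebra.adjoin_induction with
    | mem T hT => exact hW T hT
    | algebraMap e =>
      intro x hx
      have : (algebraMap E (Module.End E A) e).baseChange F x = algebraMap E F e • x := by
        rw [Algebra.algebraMap_eq_smul_one, LinearMap.baseChange_smul, LinearMap.baseChange_one,
          algebraMap_smul]
        rfl
      rw [this]
      exact W.smul_mem _ hx
    | add r r' _ _ h1 h2 =>
      intro x hx
      rw [LinearMap.baseChange_add]
      exact W.add_mem (h1 x hx) (h2 x hx)
    | mul r r' _ _ h1 h2 =>
      intro x hx
      rw [LinearMap.baseChange_mul]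
      exact h1 _ (h2 x hx)
  -- A vector of `F ⊗ A` involves finitely many vectors of `A`, on which `g` agrees with an element
  -- of the algebra generated by `S`. So `W` is stable under the whole centralizer of `ψ`.
  have hZ : ∀ g : Module.End E A, ψ * g = g * ψ → ∀ x ∈ W, g.baseChange F x ∈ W := by
    intro g hg x hx
    classical
    obtain ⟨s, hs⟩ := eq_sum_slice (Module.Basis.ofVectorSpace E F) x
    obtain ⟨r, hr, hrs⟩ := h.dense g hg
      (s.image fun i => slice ((Module.Basis.ofVectorSpace E F).coord i) x)
    have : g.baseChange F x = r.baseChange F x := by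
      rw [hs, map_sum, map_sum]
      refine Finset.sum_congr rfl fun i hi => ?_
      rw [LinearMap.baseChange_tmul, LinearMap.baseChange_tmul,
        hrs _ (Finset.mem_image_of_mem _ hi)]
    rw [this]
    exact hR r hr x hx
  have hc' : algebraMap E F c ≠ 0 := (map_ne_zero _).2 h.ne_zero
  -- The even and odd parts of `g` under conjugation by `ψ`, where $\psi^{-1} = c^{-1}\psi$.
  have hdecomp : ∀ g : Module.End E A, ∃ g₁ g₂ : Module.End E A, g = g₁ + g₂ ∧
      ψ * g₁ = g₁ * ψ ∧ ψ * g₂ = -(g₂ * ψ) := by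
    intro g
    have h1 : ψ * (ψ * g * ψ) = c • (g * ψ) := by
      rw [← mul_assoc, ← mul_assoc, h.sq, smul_mul_assoc, smul_mul_assoc, one_mul]
    have h2 : ψ * g * ψ * ψ = c • (ψ * g) := by
      rw [mul_assoc, h.sq, mul_smul_comm, mul_one]
    have hc2 : (2 * c)⁻¹ * c = (2 : E)⁻¹ := by
      rw [mul_inv, mul_assoc, inv_mul_cancel₀ h.ne_zero, mul_one]
    refine ⟨(2 : E)⁻¹ • g + (2 * c)⁻¹ • (ψ * g * ψ), (2 : E)⁻¹ • g - (2 * c)⁻¹ • (ψ * g * ψ),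
      ?_, ?_, ?_⟩
    · rw [add_add_sub_cancel, ← add_smul, ← two_mul, mul_inv_cancel₀ two_ne_zero, one_smul]
    · rw [mul_add, add_mul, mul_smul_comm, mul_smul_comm, h1, smul_mul_assoc, smul_mul_assoc, h2,
        smul_smul, smul_smul, hc2, add_comm]
    · rw [mul_sub, sub_mul, mul_smul_comm, mul_smul_comm, h1, smul_mul_assoc, smul_mul_assoc, h2,
        smul_smul, smul_smul, hc2, neg_sub]
  -- Clifford theory again, with the centralizer of `ψ` as even part and all anticommuting operators
  -- as odd part. Together they give all of `End A`, which is irreducible over every `F`; no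
  -- embedding of `F` in ℂ is involved.
  refine eq_ker_of_even_stable
    {T | ∃ g : Module.End E A, ψ * g = g * ψ ∧ g.baseChange F = T}
    {T | ∃ g : Module.End E A, ψ * g = -(g * ψ) ∧ g.baseChange F = T}
    (ψ.baseChange F) _ hc' (h.sq_baseChange F) ?_ ?_ ?_ ?_ W ?_ ?_ ?_
  · rintro _ ⟨g, hg, rfl⟩
    rw [← LinearMap.baseChange_mul, hg, LinearMap.baseChange_mul]
  · rintro _ ⟨g, hg, rfl⟩
    rw [← LinearMap.baseChange_mul, hg, LinearMap.baseChange_neg, LinearMap.baseChange_mul]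
  · intro U hU hU'
    refine eq_top_of_stable_all U fun g t ht => ?_
    obtain ⟨g₁, g₂, rfl, h1, h2⟩ := hdecomp g
    rw [LinearMap.baseChange_add]
    exact U.add_mem (hU _ ⟨g₁, h1, rfl⟩ t ht) (hU' _ ⟨g₂, h2, rfl⟩ t ht)
  · intro f hf hf'
    have hfg : ∀ g : Module.End E A, f * g.baseChange F = g.baseChange F * f := by
      intro g
      obtain ⟨g₁, g₂, rfl, h1, h2⟩ := hdecomp g
      rw [LinearMap.baseChange_add, mul_add, add_mul, hf _ ⟨g₁, h1, rfl⟩, hf' _ ⟨g₂, h2, rfl⟩]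
    obtain ⟨v, hv⟩ := h.exists_separating
    have h1 := mem_span_of_sliceHom_mem (Submodule.span E {1}) v (fun d hd hdv => by
      obtain ⟨x, rfl⟩ := Submodule.mem_span_singleton.1 hd
      obtain ⟨rfl, -⟩ := hv x 0 (by simpa using hdv)
      simp) f fun μ => by
        obtain ⟨x, hx⟩ := exists_eq_smul_of_commute_all (sliceHom f μ)
          fun g => sliceHom_comm f μ g g (hfg g)
        exact Submodule.mem_span_singleton.2 ⟨x, hx.symm⟩
    clear hf hf' hfg
    induction h1 using Submodule.span_induction with
    | mem g hg =>
      obtain ⟨d, hd, rfl⟩ := hg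
      obtain ⟨x, rfl⟩ := Submodule.mem_span_singleton.1 hd
      refine ⟨algebraMap E F x, ?_⟩
      ext v
      simp [TensorProduct.smul_tmul', Algebra.algebraMap_eq_smul_one]
    | zero => exact ⟨0, by simp⟩
    | add f g _ _ hf hg =>
      obtain ⟨x, rfl⟩ := hf
      obtain ⟨x', rfl⟩ := hg
      exact ⟨x + x', by module⟩
    | smul e f _ hf =>
      obtain ⟨x, rfl⟩ := hf
      exact ⟨e * x, by module⟩
  · rintro _ ⟨g, hg, rfl⟩
    exact hZ g hg
  · rintro _ ⟨g, hg, rfl⟩ _ ⟨g', hg', rfl⟩ x hx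
    rw [← Module.End.mul_apply, ← LinearMap.baseChange_mul]
    refine hZ _ ?_ x hx
    rw [← mul_assoc, hg, neg_mul, mul_assoc, hg', mul_neg, neg_neg, mul_assoc]
  · rintro _ ⟨g, hg, rfl⟩ _ ⟨g', hg', rfl⟩ x hx
    rw [← Module.End.mul_apply, ← LinearMap.baseChange_mul]
    refine Submodule.subset_span ⟨_, ⟨g * g', ?_, rfl⟩, x, hx, rfl⟩
    rw [← mul_assoc, hg, mul_assoc, hg', mul_neg, mul_assoc]

end IsTwistPair

end TwistData

/-! ### Restriction to the kernel of a quadratic character -/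

section TwistModel

variable {n : ℕ} {𝔥 : LieSubalgebra ℚ (MatQ n)} {K : Subgroup (GLC n)}

theorem CompChar.mem_ker_iff (χ : CompChar K) (k : K) : (k : GLC n) ∈ χ.ker ↔ χ.hom k = 1 := by
  constructor
  · rintro ⟨k', hk', h⟩
    rwa [← Subtype.ext h]
  · exact fun h => ⟨k, h, rfl⟩

/-- χ is given by a rational polynomial, so one further equation cuts out the kernel. -/
theorem CompChar.isAlgebraicOver_ker (hK : IsAlgebraicOver ℚ K) (χ : CompChar K) :
    IsAlgebraicOver ℚ χ.ker := by
  obtain ⟨S, hS⟩ := hK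
  obtain ⟨p, hp⟩ := coordRing_apply χ.fn
  have hp' : ∀ k : K, χ.hom k = MvPolynomial.aeval (coords (k : GLC n)) p := hp
  refine ⟨insert (p - 1) S, fun g => ?_⟩
  rw [Set.forall_mem_insert, ← hS]
  constructor
  · intro hg
    have hgK := χ.ker_le hg
    refine ⟨?_, hgK⟩
    rw [map_sub, map_one, ← hp' ⟨g, hgK⟩, (χ.mem_ker_iff ⟨g, hgK⟩).1 hg, sub_self]
  · rintro ⟨h1, h2⟩
    refine (χ.mem_ker_iff ⟨g, h2⟩).2 ?_
    rw [hp' ⟨g, h2⟩]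
    rwa [map_sub, map_one, sub_eq_zero] at h1

variable {E : Type u} [Field E] [CharZero E] {A : Type v} [AddCommGroup A] [Module E A] [Module ℚ A]

/-- An irreducible module over a pair together with an isomorphism to its twist by a quadratic
character. -/
structure IsTwistModel [Algebra E ℂ] (a : PairAction 𝔥 K E A) (χ : CompChar K)
    (ψ : Module.End E A) (c : E) : Prop where
  algebraic : IsAlgebraicOver ℚ K
  act_one : (a.baseChange ℂ).act 1 = 1
  act_mul : ∀ k k', (a.baseChange ℂ).act (k * k') = (a.baseChange ℂ).act k * (a.baseChange ℂ).act k'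
  compat : ∀ k X, ∃ Z ∈ Submodule.span ℂ (Set.range (a.baseChange ℂ).lie),
    (a.baseChange ℂ).act k * (a.baseChange ℂ).lie X = Z * (a.baseChange ℂ).act k
  irred : IsIrredSub (a.baseChange ℂ) ⊤
  quadratic : ∀ k, χ.hom k = 1 ∨ χ.hom k = -1
  nontrivial : ∃ k, χ.hom k = -1
  twisted : IsTwistedHom a χ ψ
  ne_zero : c ≠ 0
  sq : ψ * ψ = c • 1

variable [Algebra E ℂ] {a : PairAction 𝔥 K E A} {χ : CompChar K} {ψ : Module.End E A} {c : E}

/-- Schur's lemma for complex irreducible modules over a pair. -/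
theorem exists_eq_smul_of_commute_opSet {M : Type v} [AddCommGroup M] [Module ℂ M] [Module ℚ M]
    (b : PairAction 𝔥 K ℂ M) (hb : IsIrredSub b ⊤) (f : Module.End ℂ M)
    (hf : ∀ T ∈ b.opSet, f * T = T * f) : ∃ β : ℂ, f = β • 1 := by
  obtain ⟨S, hS, hSb, hSW⟩ := exists_countable_opSet b
  exact exists_eq_smul_of_commute S hS (fun W hW => hb.2.2 W (hSW W hW) le_top) f
    fun T hT => hf T (hSb hT)

theorem IsTwistModel.nontrivial_module (h : IsTwistModel a χ ψ c) : Nontrivial (ℂ ⊗[E] A) := by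
  by_contra hn
  rw [not_nontrivial_iff_subsingleton] at hn
  exact h.irred.2.1 (Subsingleton.elim _ _)

/-- A twisted identity would make a point with `χ = -1` act as its own negative, although points act
invertibly. This will exclude a scalar component in twisted homomorphisms. -/
theorem IsTwistModel.not_isTwistedHom_one (h : IsTwistModel a χ ψ c) :
    ¬ IsTwistedHom a χ (1 : Module.End E A) := by
  intro h1
  have h2 := ((isTwistedHom_iff_act h.algebraic _ χ _).1 (h1.baseChange ℂ)).2
  obtain ⟨k, hk⟩ := h.nontrivial
  have := h.nontrivial_module
  obtain ⟨x, hx⟩ := exists_ne (0 : ℂ ⊗[E] A)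
  have h3 : ∀ y, (a.baseChange ℂ).act k y = 0 := fun y => by
    have := h2 k y
    rw [hk, LinearMap.baseChange_one, Module.End.one_apply, Module.End.one_apply, neg_one_smul,
      eq_neg_iff_add_eq_zero, ← two_smul ℂ] at this
    exact (smul_eq_zero.1 this).resolve_left two_ne_zero
  have h4 := LinearMap.congr_fun (h.act_mul k k⁻¹) x
  rw [mul_inv_cancel, h.act_one, Module.End.mul_apply, h3] at h4
  exact hx h4

/-- Clifford theory over ℂ followed by descent: the even operators `P` come from the Lie algebra and
from the points of the kernel, the odd one is a point `k₀` with `χ k₀ = -1`, and together they act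
irreducibly. -/
theorem IsTwistModel.isTwistPair (h : IsTwistModel a χ ψ c) :
    IsTwistPair (a.restrict χ.ker_le).opSet ψ c := by
  have hker := χ.isAlgebraicOver_ker h.algebraic
  obtain ⟨k₀, hk₀⟩ := h.nontrivial
  let b := a.baseChange ℂ
  let ψC : Module.End ℂ (ℂ ⊗[E] A) := ψ.baseChange ℂ
  let P : Set (Module.End ℂ (ℂ ⊗[E] A)) :=
    Set.range b.lie ∪ {T | ∃ k, χ.hom k = 1 ∧ b.act k = T}
  have hstab : ∀ W : Submodule ℂ (ℂ ⊗[E] A),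
      (∀ T ∈ (a.restrict χ.ker_le).opSet, ∀ x ∈ W, T.baseChange ℂ x ∈ W) →
      ∀ T ∈ P, ∀ x ∈ W, T x ∈ W := by
    intro W hW
    have h1 : IsStable (b.restrict χ.ker_le) W := by
      rw [isStable_iff, restrict_baseChange_opSet]
      rintro _ ⟨T, hT, rfl⟩
      exact hW T hT
    rw [isStable_iff_act hker] at h1
    rintro _ (⟨X, rfl⟩ | ⟨k, hk, rfl⟩) x hx
    · exact h1.1 X x hx
    · have := h1.2 ⟨k, (χ.mem_ker_iff k).2 hk⟩ x hx
      rwa [restrict_act] at this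
  have hcommP : ∀ f : Module.End ℂ (ℂ ⊗[E] A),
      (∀ T ∈ (a.restrict χ.ker_le).opSet, f * T.baseChange ℂ = T.baseChange ℂ * f) →
      ∀ T ∈ P, f * T = T * f := by
    intro f hf
    have h1 := (commute_opSet_of_act hker (b.restrict χ.ker_le) f).1 (by
      rw [restrict_baseChange_opSet]
      rintro _ ⟨T, hT, rfl⟩
      exact hf T hT)
    rintro _ (⟨X, rfl⟩ | ⟨k, hk, rfl⟩)
    · exact h1.1 X
    · have := h1.2 ⟨k, (χ.mem_ker_iff k).2 hk⟩
      rwa [restrict_act] at this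
  have hspan : ∀ f : Module.End ℂ (ℂ ⊗[E] A), (∀ T ∈ P, f * T = T * f) →
      ∀ Z ∈ Submodule.span ℂ (Set.range b.lie), f * Z = Z * f := by
    intro f hf Z hZ
    induction hZ using Submodule.span_induction with
    | mem Z hZ => exact hf Z (Or.inl hZ)
    | zero => rw [mul_zero, zero_mul]
    | add Z Z' _ _ h1 h2 => rw [mul_add, add_mul, h1, h2]
    | smul e Z _ h1 => rw [mul_smul_comm, smul_mul_assoc, h1]
  -- The kernel and its coset through `k₀` exhaust `K`.
  have hodd : ∀ k, χ.hom k ≠ 1 → ∃ k', χ.hom k' = 1 ∧ b.act k = b.act k₀ * b.act k' := by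
    intro k hk
    refine ⟨k₀⁻¹ * k, ?_, ?_⟩
    · have h1 : χ.hom k₀ * χ.hom (k₀⁻¹ * k) = χ.hom k := by rw [← map_mul, mul_inv_cancel_left]
      rw [hk₀, (h.quadratic k).resolve_left hk] at h1
      linear_combination -h1
    · rw [← h.act_mul, mul_inv_cancel_left]
  have hinv : b.act k₀ * b.act k₀⁻¹ = 1 := by rw [← h.act_mul, mul_inv_cancel, h.act_one]
  have hinv' : b.act k₀⁻¹ * b.act k₀ = 1 := by rw [← h.act_mul, inv_mul_cancel, h.act_one]
  have hk₀i : χ.hom k₀⁻¹ = -1 := by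
    have h1 : χ.hom k₀ * χ.hom k₀⁻¹ = 1 := by rw [← map_mul, mul_inv_cancel, map_one]
    rw [hk₀] at h1
    linear_combination -h1
  have hsq : b.act k₀ * b.act k₀ ∈ P :=
    Or.inr ⟨k₀ * k₀, by rw [map_mul, hk₀]; norm_num, h.act_mul _ _⟩
  have htw := (isTwistedHom_iff_act h.algebraic _ χ _).1 (h.twisted.baseChange ℂ)
  have hψP : ∀ T ∈ P, ψC * T = T * ψC := by
    rintro _ (⟨X, rfl⟩ | ⟨k, hk, rfl⟩)
    · exact LinearMap.ext fun x => htw.1 X x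
    · ext x
      have := htw.2 k (1 ⊗ₜ x)
      rw [hk, one_smul] at this
      exact this.symm
  have hψκ : ψC * b.act k₀ = -(b.act k₀ * ψC) := by
    refine LinearMap.ext fun x => ?_
    have := htw.2 k₀ x
    rw [hk₀, neg_one_smul] at this
    exact (neg_eq_iff_eq_neg.2 this).symm
  have hsqC : ψC * ψC = algebraMap E ℂ c • 1 := by
    change ψ.baseChange ℂ * ψ.baseChange ℂ = _
    rw [← LinearMap.baseChange_mul, h.sq]
    ext v
    simp [TensorProduct.smul_tmul', Algebra.algebraMap_eq_smul_one]
  have hcC : algebraMap E ℂ c ≠ 0 := (map_ne_zero _).2 h.ne_zero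
  have hschur : ∀ f : Module.End ℂ (ℂ ⊗[E] A), (∀ T ∈ P, f * T = T * f) →
      f * b.act k₀ = b.act k₀ * f → ∃ β : ℂ, f = β • 1 := by
    intro f hf hf'
    refine exists_eq_smul_of_commute_opSet b h.irred f ?_
    rw [commute_opSet_of_act h.algebraic]
    refine ⟨fun X => hf _ (Or.inl ⟨X, rfl⟩), fun k => ?_⟩
    by_cases hk : χ.hom k = 1
    · exact hf _ (Or.inr ⟨k, hk, rfl⟩)
    · obtain ⟨k', hk', hkk⟩ := hodd k hk
      rw [hkk, ← mul_assoc, hf', mul_assoc, hf _ (Or.inr ⟨k', hk', rfl⟩), mul_assoc]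
  -- Conjugation by `k₀` preserves the even part. A rational Lie algebra operator may become a
  -- complex combination of rational ones, so `Z` need not lie in `P`; only its commutation and
  -- stability properties are recorded.
  have hmove : ∀ T ∈ P, ∃ Z : Module.End ℂ (ℂ ⊗[E] A), T * b.act k₀ = b.act k₀ * Z ∧
      (∀ f : Module.End ℂ (ℂ ⊗[E] A), (∀ T ∈ P, f * T = T * f) → f * Z = Z * f) ∧
      ∀ W : Submodule ℂ (ℂ ⊗[E] A), (∀ T ∈ P, ∀ x ∈ W, T x ∈ W) → ∀ x ∈ W, Z x ∈ W := by
    rintro _ (⟨X, rfl⟩ | ⟨k, hk, rfl⟩)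
    · obtain ⟨Z, hZ, hZX⟩ := h.compat k₀⁻¹ X
      refine ⟨Z, ?_, fun f hf => hspan f hf Z hZ, fun W hW => ?_⟩
      · calc b.lie X * b.act k₀ = b.act k₀ * (b.act k₀⁻¹ * b.lie X) * b.act k₀ := by
              rw [← mul_assoc, hinv, one_mul]
          _ = b.act k₀ * Z := by rw [hZX, mul_assoc, mul_assoc, hinv', mul_one]
      · clear hZX
        induction hZ using Submodule.span_induction with
        | mem Z hZ => exact hW Z (Or.inl hZ)
        | zero => exact fun x _ => W.zero_mem
        | add Z Z' _ _ h1 h2 => exact fun x hx => W.add_mem (h1 x hx) (h2 x hx)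
        | smul e Z _ h1 => exact fun x hx => W.smul_mem e (h1 x hx)
    · have hk' : χ.hom (k₀⁻¹ * k * k₀) = 1 := by
        rw [map_mul, map_mul, hk, hk₀, hk₀i]; norm_num
      have hP : b.act (k₀⁻¹ * k * k₀) ∈ P := Or.inr ⟨_, hk', rfl⟩
      refine ⟨b.act (k₀⁻¹ * k * k₀), ?_, fun f hf => hf _ hP, fun W hW => hW _ hP⟩
      rw [← h.act_mul, ← h.act_mul]
      congr 1
      group
  refine IsTwistPair.of_baseChange ℂ h.ne_zero h.sq h.twisted.commute_opSet_ker ?_ ?_ ?_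
  · intro x hx
    have h1 : ψC * b.act k₀ = b.act k₀ * ψC := by
      change ψ.baseChange ℂ * _ = _ * ψ.baseChange ℂ
      rw [hx, smul_mul_assoc, mul_smul_comm, one_mul, mul_one]
    rw [h1, eq_neg_iff_add_eq_zero, ← two_smul ℂ] at hψκ
    have h2 : b.act k₀ * ψC = 0 := (smul_eq_zero.1 hψκ).resolve_left two_ne_zero
    have h3 : ψC = 0 := by rw [← one_mul ψC, ← hinv', mul_assoc, h2, mul_zero]
    rw [h3, mul_zero] at hsqC
    have := h.nontrivial_module
    exact smul_ne_zero hcC one_ne_zero hsqC.symm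
  · intro W hW
    have hWP := hstab W hW
    rcases eq_ker_of_even_stable P {b.act k₀} ψC _ hcC hsqC hψP (by rintro _ rfl; exact hψκ)
      (fun U hU hU' => h.irred.2.2 U ((isStable_iff_act h.algebraic _ _).2
        ⟨fun X => hU _ (Or.inl ⟨X, rfl⟩), fun k x hx => by
          by_cases hk : χ.hom k = 1
          · exact hU _ (Or.inr ⟨k, hk, rfl⟩) x hx
          · obtain ⟨k', hk', hkk⟩ := hodd k hk
            change b.act k x ∈ U
            rw [hkk]
            exact hU' _ rfl _ (hU _ (Or.inr ⟨k', hk', rfl⟩) x hx)⟩) le_top)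
      (fun f hf hf' => hschur f hf (hf' _ rfl)) W hWP
      (by
        rintro _ rfl _ rfl x hx
        exact hWP _ hsq x hx)
      (by
        rintro T hT _ rfl x hx
        obtain ⟨Z, hZ, -, hZW⟩ := hmove T hT
        exact Submodule.subset_span ⟨_, rfl, Z x, hZW W hWP x hx, (LinearMap.congr_fun hZ x).symm⟩)
      with h1 | h1 | ⟨α, -, h1⟩
    · exact Or.inl h1
    · exact Or.inr (Or.inl h1)
    · exact Or.inr (Or.inr ⟨α, h1⟩)
  · intro f hf
    refine commutant_of_even P ψC (b.act k₀) (b.act k₀⁻¹) _ hcC hsqC hψP hψκ hinv hinv' ?_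
      (fun f hf => hf _ hsq) hschur f (hcommP f hf)
    intro f hf T hT
    obtain ⟨Z, hZ, hZf, -⟩ := hmove T hT
    have h1 : b.act k₀⁻¹ * T = Z * b.act k₀⁻¹ := by
      calc b.act k₀⁻¹ * T = b.act k₀⁻¹ * (T * b.act k₀) * b.act k₀⁻¹ := by
            rw [mul_assoc, mul_assoc, hinv, mul_one]
        _ = Z * b.act k₀⁻¹ := by rw [hZ, ← mul_assoc, hinv', one_mul]
    calc b.act k₀ * f * b.act k₀⁻¹ * T = b.act k₀ * (f * Z) * b.act k₀⁻¹ := by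
          rw [mul_assoc, h1]; simp only [mul_assoc]
      _ = b.act k₀ * Z * f * b.act k₀⁻¹ := by rw [hZf f hf]; simp only [mul_assoc]
      _ = T * (b.act k₀ * f * b.act k₀⁻¹) := by rw [← hZ]; simp only [mul_assoc]

end TwistModel

/-! ### Each condition says that `c` is a square in the extension field -/

section Conditions

variable {n : ℕ} {𝔥 : LieSubalgebra ℚ (MatQ n)} {K : Subgroup (GLC n)}
variable {E : Type u} [Field E] [CharZero E] {A : Type v} [AddCommGroup A] [Module E A] [Module ℚ A]
  {a : PairAction 𝔥 K E A} {χ : CompChar K} {ψ : Module.End E A} {c : E}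

theorem isStable_baseChange_iff {M : Type v} [AddCommGroup M] [Module E M] [Module ℚ M]
    (b : PairAction 𝔥 K E M) (L : Type w) [Field L] [CharZero L] [Algebra E L]
    (U : Submodule L (L ⊗[E] M)) :
    IsStable (b.baseChange L) U ↔ ∀ T ∈ b.opSet, ∀ x ∈ U, T.baseChange L x ∈ U := by
  rw [isStable_iff, opSet_baseChange, Set.forall_mem_image]

variable (F : Type w) [Field F] [CharZero F] [Algebra E F]

theorem isStable_restrict_baseChange_iff (W : Submodule F (F ⊗[E] A)) :
    IsStable ((a.baseChange F).restrict χ.ker_le) W ↔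
      ∀ T ∈ (a.restrict χ.ker_le).opSet, ∀ x ∈ W, T.baseChange F x ∈ W := by
  rw [isStable_iff, restrict_baseChange_opSet, Set.forall_mem_image]

theorem isStable_of_baseChange {M : Type v} [AddCommGroup M] [Module E M] [Module ℚ M]
    (b : PairAction 𝔥 K E M) (W : Submodule E M) (h : IsStable (b.baseChange F) (W.baseChange F)) :
    IsStable b W := by
  rw [isStable_baseChange_iff] at h
  rw [isStable_iff]
  intro T hT x hx
  rw [← one_tmul_mem_baseChange_iff (L := F)]
  exact h T hT _ ((one_tmul_mem_baseChange_iff W x).2 hx)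

theorem isStable_baseChange {M : Type v} [AddCommGroup M] [Module E M] [Module ℚ M]
    (b : PairAction 𝔥 K E M) (W : Submodule E M) (h : IsStable b W) :
    IsStable (b.baseChange F) (W.baseChange F) := by
  rw [isStable_baseChange_iff]
  rw [isStable_iff] at h
  intro T hT x hx
  rw [mem_baseChange_iff_slice] at hx ⊢
  intro μ
  rw [slice_baseChange]
  exact h T hT _ (hx μ)

namespace IsTwistModel

section

variable [Algebra E ℂ] (h : IsTwistModel a χ ψ c)
include h

theorem eq_ker_of_isStable {W : Submodule F (F ⊗[E] A)}
    (hW : IsStable ((a.baseChange F).restrict χ.ker_le) W) : W = ⊥ ∨ W = ⊤ ∨ ∃ α : F,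
      α ^ 2 = algebraMap E F c ∧ W = LinearMap.ker (ψ.baseChange F - α • 1) :=
  h.isTwistPair.eq_ker_of_stable F W ((isStable_restrict_baseChange_iff F W).1 hW)

/-- A twisted homomorphism lies in the commutant spanned by `1` and `ψ`. A nonzero component along
`1` would make the identity twisted, over `F` and hence over `E`. -/
theorem exists_eq_smul_of_isTwistedHom (f : Module.End F (F ⊗[E] A))
    (hf : IsTwistedHom (a.baseChange F) χ f) : ∃ β : F, f = β • ψ.baseChange F := by
  obtain ⟨x, y, rfl⟩ := h.isTwistPair.commutant_baseChange F f fun T hT =>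
    hf.commute_opSet_ker _ (by rw [restrict_baseChange_opSet]; exact ⟨T, hT, rfl⟩)
  have hψ := h.twisted.baseChange F
  rw [isTwistedHom_iff] at hf hψ
  have hx : x = 0 := by
    by_contra hx
    refine h.not_isTwistedHom_one ((isTwistedHom_iff _ _ _).2 ⟨fun X => by rw [one_mul, mul_one],
      fun ℓ => ?_⟩)
    have h1 := hf.2 ℓ
    rw [add_mul, mul_add, smul_mul_assoc, smul_mul_assoc, mul_smul_comm, mul_smul_comm, hψ.2,
      add_left_inj, one_mul, mul_one] at h1
    have h2 := smul_right_injective _ hx h1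
    rw [baseChange_coeff, baseChange_coeff] at h2
    rw [one_mul, mul_one]
    ext v
    have h3 := LinearMap.congr_fun h2 (1 ⊗ₜ v)
    rw [LinearMap.baseChange_tmul, LinearMap.baseChange_tmul, ← sub_eq_zero,
      ← TensorProduct.tmul_sub, one_tmul_eq_zero_iff, sub_eq_zero] at h3
    exact h3
  exact ⟨y, by rw [hx, zero_smul, zero_add]⟩

theorem isStable_ker (α : F) : IsStable ((a.baseChange F).restrict χ.ker_le)
    (LinearMap.ker (ψ.baseChange F - α • 1)) := by
  rw [isStable_iff]
  intro T hT x hx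
  have h1 := LinearMap.congr_fun ((h.twisted.baseChange F).commute_opSet_ker T hT) x
  simp only [LinearMap.mem_ker, LinearMap.sub_apply, LinearMap.smul_apply, Module.End.one_apply,
    Module.End.mul_apply, sub_eq_zero] at hx h1 ⊢
  rw [h1, hx, map_smul]

omit [CharZero F] in
theorem sub_smul_apply_sub_smul {α : F} (hα : α ^ 2 = algebraMap E F c) (x : F ⊗[E] A) :
    (ψ.baseChange F - α • 1) ((ψ.baseChange F - (-α) • 1) x) = 0 := by
  have h1 := LinearMap.congr_fun (h.isTwistPair.sq_baseChange F) x
  rw [← hα, Module.End.mul_apply] at h1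
  simp only [LinearMap.sub_apply, LinearMap.smul_apply, Module.End.one_apply, map_sub, map_smul, h1]
  module

theorem isCompl_ker {α : F} (hα : α ^ 2 = algebraMap E F c) :
    IsCompl (LinearMap.ker (ψ.baseChange F - α • 1))
      (LinearMap.ker (ψ.baseChange F - (-α) • 1)) := by
  have hα0 : α ≠ 0 := by
    rintro rfl
    rw [zero_pow two_ne_zero] at hα
    exact h.ne_zero ((map_eq_zero _).1 hα.symm)
  have h2 : (2 * α) ≠ 0 := mul_ne_zero two_ne_zero hα0
  constructor
  · rw [Submodule.disjoint_def]
    intro x hx hx'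
    simp only [LinearMap.mem_ker, LinearMap.sub_apply, LinearMap.smul_apply, Module.End.one_apply,
      sub_eq_zero] at hx hx'
    rw [hx] at hx'
    have : (2 * α) • x = 0 := by
      rw [two_mul, add_smul]
      nth_rewrite 1 [hx']
      simp
    exact (smul_eq_zero.1 this).resolve_left h2
  · rw [codisjoint_iff, eq_top_iff]
    rintro x -
    have h3 : ∀ β : F, β ^ 2 = algebraMap E F c → ∀ y,
        (ψ.baseChange F - (-β) • 1) y ∈ LinearMap.ker (ψ.baseChange F - β • 1) := fun β hβ y =>
      h.sub_smul_apply_sub_smul F hβ y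
    refine Submodule.mem_sup.2 ⟨(2 * α)⁻¹ • (ψ.baseChange F - (-α) • 1) x,
      Submodule.smul_mem _ _ (h3 α hα x), (-(2 * α)⁻¹) • (ψ.baseChange F - (- -α) • 1) x,
      Submodule.smul_mem _ _ (h3 (-α) (by rw [neg_sq, hα]) x), ?_⟩
    have h4 : (ψ.baseChange F - (-α) • 1) x = ψ.baseChange F x + α • x := by simp
    have h5 : (ψ.baseChange F - (- -α) • 1) x = ψ.baseChange F x - α • x := by simp
    rw [h4, h5]
    calc _ = ((2 * α)⁻¹ * (2 * α)) • x := by module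
      _ = x := by rw [inv_mul_cancel₀ h2, one_smul]

omit [CharZero F] in
theorem ker_ne_top (α : F) : LinearMap.ker (ψ.baseChange F - α • 1) ≠ ⊤ := fun h1 =>
  h.isTwistPair.baseChange_ne_smul F α (sub_eq_zero.1 (LinearMap.ker_eq_top.1 h1))

theorem ker_ne_bot {α : F} (hα : α ^ 2 = algebraMap E F c) :
    LinearMap.ker (ψ.baseChange F - α • 1) ≠ ⊥ := by
  intro h1
  have h2 := (h.isCompl_ker F hα).sup_eq_top
  rw [h1, bot_sup_eq] at h2
  exact h.ker_ne_top F _ h2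

/-- Proper nonzero submodules are eigenspaces of `ψ`, and their eigenvalues are square roots of `c`.
-/
theorem condReducible_iff : CondReducible (a.baseChange F) χ ↔
    ∃ α : F, α ^ 2 = algebraMap E F c := by
  constructor
  · rintro ⟨W, hW, h0, h1⟩
    obtain ⟨α, hα, -⟩ := ((h.eq_ker_of_isStable F hW).resolve_left h0).resolve_left h1
    exact ⟨α, hα⟩
  · rintro ⟨α, hα⟩
    exact ⟨_, h.isStable_ker F α, h.ker_ne_bot F hα, h.ker_ne_top F α⟩

/-- Over a further extension `L` every submodule is again zero, everything or an eigenspace of `ψ`.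
One contained in the extended `α`-eigenspace and nonzero must have eigenvalue `α`. -/
theorem isIrredSub_ker {α : F} (hα : α ^ 2 = algebraMap E F c) :
    IsAbsIrredSub ((a.baseChange F).restrict χ.ker_le) (LinearMap.ker (ψ.baseChange F - α • 1)) := by
  intro L _ _ _
  let _ : Algebra E L := ((algebraMap F L).comp (algebraMap E F)).toAlgebra
  have : IsScalarTower E F L := IsScalarTower.of_algebraMap_eq fun _ => rfl
  let W := LinearMap.ker (ψ.baseChange F - α • 1)
  let e := TensorProduct.AlgebraTensorModule.cancelBaseChange E F L L A
  have he : ∀ (T : Module.End E A) x,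
      e ((T.baseChange F).baseChange L x) = T.baseChange L (e x) := by
    intro T x
    rw [LinearMap.baseChange_baseChange]
    simp [e]
  have hWL : ∀ x ∈ W.baseChange L, (ψ.baseChange F).baseChange L x = algebraMap F L α • x := by
    rintro _ ⟨x, rfl⟩
    induction x with
    | zero => simp
    | add x y hx hy => simp only [map_add, hx, hy, smul_add]
    | tmul l x =>
      obtain ⟨x, hx⟩ := x
      have hx' : ψ.baseChange F x = α • x := by
        simpa [W, LinearMap.mem_ker, sub_eq_zero] using hx
      simp [hx', TensorProduct.smul_tmul', Algebra.smul_def]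
  refine ⟨isStable_baseChange L _ W (h.isStable_ker F α), ?_, ?_⟩
  · intro h0
    refine h.ker_ne_bot F hα (eq_bot_iff.2 fun x hx => ?_)
    have h1 := (one_tmul_mem_baseChange_iff (L := L) W x).2 hx
    change W.baseChange L = ⊥ at h0
    rw [h0, Submodule.mem_bot, one_tmul_eq_zero_iff] at h1
    exact h1
  · intro U hU hUW
    have hU' : IsStable ((a.baseChange L).restrict χ.ker_le) (U.map e.toLinearMap) := by
      rw [isStable_restrict_baseChange_iff]
      rw [isStable_baseChange_iff, restrict_baseChange_opSet, Set.forall_mem_image] at hU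
      rintro T hT _ ⟨x, hx, rfl⟩
      exact ⟨_, hU hT x hx, he T x⟩
    have hmem : ∀ x, e x ∈ U.map e.toLinearMap ↔ x ∈ U := fun x =>
      ⟨fun ⟨y, hy, hyx⟩ => e.injective hyx ▸ hy, fun hx => ⟨x, hx, rfl⟩⟩
    rcases h.eq_ker_of_isStable L hU' with h1 | h1 | ⟨β, -, h1⟩
    · refine Or.inl (eq_bot_iff.2 fun x hx => ?_)
      have := (hmem x).2 hx
      rw [h1, Submodule.mem_bot] at this
      exact (map_eq_zero_iff e e.injective).1 this
    · exfalso
      refine h.ker_ne_top F α (eq_top_iff.2 fun x _ => ?_)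
      rw [← one_tmul_mem_baseChange_iff (L := L)]
      refine hUW ((hmem _).1 ?_)
      rw [h1]
      trivial
    · by_cases h0 : U = ⊥
      · exact Or.inl h0
      obtain ⟨x, hx, hx0⟩ := Submodule.exists_mem_ne_zero_of_ne_bot h0
      have hker : ∀ y, y ∈ U ↔ (ψ.baseChange F).baseChange L y = β • y := by
        intro y
        rw [← hmem, h1, LinearMap.mem_ker, LinearMap.sub_apply, ← he, sub_eq_zero]
        change _ = β • e y ↔ _
        rw [← map_smul, e.injective.eq_iff]
      have hβ : β = algebraMap F L α := by
        have h2 := (hker x).1 hx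
        rw [hWL x (hUW hx)] at h2
        exact (smul_left_injective L hx0 h2).symm
      refine Or.inr (le_antisymm hUW fun y hy => (hker y).2 ?_)
      rw [hβ]
      exact hWL y hy

/-- Extended by zero, an isomorphism would lie in the commutant spanned by `1` and `ψ`. Such
operators preserve each eigenspace, so the isomorphism would vanish. -/
theorem not_subIso_ker {α : F} (hα : α ^ 2 = algebraMap E F c) :
    ¬ SubIso ((a.baseChange F).restrict χ.ker_le) (LinearMap.ker (ψ.baseChange F - α • 1))
      (LinearMap.ker (ψ.baseChange F - (-α) • 1)) := by
  rintro ⟨φ, hφ1, hφ2⟩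
  have hcompl := h.isCompl_ker F hα
  let b := (a.baseChange F).restrict χ.ker_le
  let W₁ := LinearMap.ker (ψ.baseChange F - α • 1)
  let W₂ := LinearMap.ker (ψ.baseChange F - (-α) • 1)
  have hst₁ : IsStable b W₁ := h.isStable_ker F α
  have hst₂ := (isStable_iff b W₂).1 (h.isStable_ker F (-α))
  have hφT : ∀ T ∈ b.opSet, ∀ x y : W₁, (y : F ⊗[E] A) = T x → (φ y : F ⊗[E] A) = T (φ x) := by
    rintro _ (⟨X, rfl⟩ | ⟨ℓ, rfl⟩) x y hxy
    · exact hφ1 X x y hxy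
    · obtain ⟨t, ht⟩ := hst₁.2 x x.2
      have h1 := hφ2 x t ht
      rw [PairAction.coeff_apply, ← h1, coeffMap_map]
      rw [PairAction.coeff_apply, ← ht, coeffMap_map] at hxy
      rw [Subtype.ext hxy]
      rfl
  let f : Module.End F (F ⊗[E] A) := LinearMap.ofIsCompl hcompl (W₂.subtype ∘ₗ φ.toLinearMap) 0
  have hf₁ : ∀ x : W₁, f x = φ x := fun x => LinearMap.ofIsCompl_apply_left hcompl x
  have hf₂ : ∀ x : W₂, f x = 0 := fun x => LinearMap.ofIsCompl_apply_right hcompl x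
  have hdec : ∀ x, ∃ y ∈ W₁, ∃ z ∈ W₂, y + z = x := fun x =>
    Submodule.mem_sup.1 (hcompl.sup_eq_top ▸ Submodule.mem_top)
  have hfT : ∀ T ∈ b.opSet, f * T = T * f := by
    intro T hT
    ext x
    have hT₁ := (isStable_iff b W₁).1 hst₁ T hT
    obtain ⟨y, hy, z, hz, hyz⟩ := hdec (1 ⊗ₜ x)
    change f (T (1 ⊗ₜ x)) = T (f (1 ⊗ₜ x))
    rw [← hyz, map_add, map_add, map_add, map_add, hf₁ ⟨_, hT₁ y hy⟩, hf₂ ⟨_, hst₂ T hT z hz⟩,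
      hf₁ ⟨y, hy⟩, hf₂ ⟨z, hz⟩, map_zero, hφT T hT ⟨y, hy⟩ ⟨_, hT₁ y hy⟩ rfl]
  obtain ⟨x, y, hxy⟩ := h.isTwistPair.commutant_baseChange F f fun T hT =>
    hfT _ (by
      change T.baseChange F ∈ ((a.baseChange F).restrict χ.ker_le).opSet
      rw [restrict_baseChange_opSet]; exact ⟨T, hT, rfl⟩)
  obtain ⟨w, hw, hw0⟩ := Submodule.exists_mem_ne_zero_of_ne_bot (h.ker_ne_bot F hα)
  have hψw : ψ.baseChange F w = α • w := by
    simpa [LinearMap.mem_ker, sub_eq_zero] using hw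
  have h1 : f w = (x + y * α) • w := by
    rw [hxy, LinearMap.add_apply, LinearMap.smul_apply, LinearMap.smul_apply, hψw, add_smul,
      mul_smul]
    rfl
  have h2 : f w = 0 := by
    refine Submodule.disjoint_def.1 hcompl.disjoint _ ?_ ?_
    · rw [h1]; exact Submodule.smul_mem _ _ hw
    · rw [hf₁ ⟨w, hw⟩]; exact (φ ⟨w, hw⟩).2
  have h3 : φ ⟨w, hw⟩ = 0 := Subtype.ext ((hf₁ ⟨w, hw⟩).symm.trans h2)
  exact hw0 (congrArg Subtype.val ((map_eq_zero_iff φ φ.injective).1 h3))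

/-- A splitting gives reducibility through its first summand; conversely the eigenspaces for `α` and
`-α` are the two summands. -/
theorem condSplits_iff : CondSplits (a.baseChange F) χ ↔
    ∃ α : F, α ^ 2 = algebraMap E F c := by
  constructor
  · rintro ⟨W₁, W₂, hW, h1, h2, -⟩
    rw [← h.condReducible_iff F]
    -- Absolute irreducibility is used for the trivial extension of `F` by itself, and then
    -- descended.
    refine ⟨W₁, isStable_of_baseChange F _ W₁ (h1 F).1, ?_, ?_⟩
    · rintro rfl
      exact (h1 F).2.1 (by simp)
    · rintro rfl
      have : W₂ = ⊥ := by simpa using hW.inf_eq_bot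
      subst this
      exact (h2 F).2.1 (by simp)
  · rintro ⟨α, hα⟩
    exact ⟨_, _, h.isCompl_ker F hα, h.isIrredSub_ker F hα,
      h.isIrredSub_ker F (by rw [neg_sq, hα]), h.not_subIso_ker F hα⟩

omit [CharZero F] in
theorem exists_equiv : ∃ Ψ : (F ⊗[E] A) ≃ₗ[F] (F ⊗[E] A), Ψ.toLinearMap = ψ.baseChange F := by
  have hc : algebraMap E F c ≠ 0 := (map_ne_zero _).2 h.ne_zero
  have h1 := h.isTwistPair.sq_baseChange F
  refine ⟨LinearEquiv.ofLinearMap (ψ.baseChange F) ((algebraMap E F c)⁻¹ • ψ.baseChange F) ?_ ?_, rfl⟩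
  · change ψ.baseChange F * ((algebraMap E F c)⁻¹ • ψ.baseChange F) = 1
    rw [mul_smul_comm, h1, smul_smul, inv_mul_cancel₀ hc, one_smul]
  · change ((algebraMap E F c)⁻¹ • ψ.baseChange F) * ψ.baseChange F = 1
    rw [smul_mul_assoc, h1, smul_smul, inv_mul_cancel₀ hc, one_smul]

omit [CharZero F] in
theorem exists_module_ne_zero : ∃ v : F ⊗[E] A, v ≠ 0 := by
  by_contra! h0
  refine h.ker_ne_top F 0 (eq_top_iff.2 fun x _ => ?_)
  rw [h0 x]
  exact Submodule.zero_mem _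

/-- Every twisted automorphism is $\beta\psi$, with square $\beta^2 c$. -/
theorem condSquare_iff : CondSquare (a.baseChange F) χ ↔
    ∃ α : F, α ^ 2 = algebraMap E F c := by
  have h1 := h.isTwistPair.sq_baseChange F
  constructor
  · intro H
    obtain ⟨Ψ, hΨ⟩ := h.exists_equiv F
    obtain ⟨α, hα⟩ := H Ψ (hΨ ▸ h.twisted.baseChange F)
    obtain ⟨v, hv⟩ := h.exists_module_ne_zero F
    have h2 := LinearMap.congr_fun h1 v
    rw [← hΨ] at h2
    exact ⟨α, smul_left_injective F hv ((hα v).symm.trans h2)⟩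
  · rintro ⟨α, hα⟩ Ψ hΨ
    obtain ⟨β, hβ⟩ := h.exists_eq_smul_of_isTwistedHom F _ hΨ
    refine ⟨β * α, fun v => ?_⟩
    have h3 : ∀ x, Ψ x = β • ψ.baseChange F x := fun x => LinearMap.congr_fun hβ x
    have h2 := LinearMap.congr_fun h1 v
    rw [Module.End.mul_apply] at h2
    rw [h3, h3, map_smul, h2, ← hα]
    simp only [LinearMap.smul_apply, Module.End.one_apply, smul_smul]
    ring_nf

/-- If `c` is not a square, the whole module is irreducible and `ψ` would have to be a scalar. If $c
= \alpha^2$, the irreducible submodules are eigenspaces of `ψ` for $\pm\alpha$. -/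
theorem condScalars_iff : CondScalars (a.baseChange F) χ ↔
    ∃ α : F, α ^ 2 = algebraMap E F c := by
  constructor
  · intro H
    by_contra hn
    obtain ⟨Ψ, hΨ⟩ := h.exists_equiv F
    obtain ⟨α, hα⟩ := H Ψ (hΨ ▸ h.twisted.baseChange F)
    have hΨv : ∀ v, Ψ v = ψ.baseChange F v := fun v => LinearMap.congr_fun hΨ v
    have htop : IsIrredSub ((a.baseChange F).restrict χ.ker_le) ⊤ := by
      refine ⟨(isStable_iff _ _).2 fun _ _ _ _ => Submodule.mem_top, fun h0 => ?_,
        fun U hU _ => ?_⟩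
      · obtain ⟨v, hv⟩ := h.exists_module_ne_zero F
        exact hv ((Submodule.mem_bot F).1 (h0 ▸ Submodule.mem_top))
      · rcases h.eq_ker_of_isStable F hU with h1 | h1 | ⟨β, hβ, -⟩
        · exact Or.inl h1
        · exact Or.inr h1
        · exact absurd ⟨β, hβ⟩ hn
    rcases hα ⊤ htop with h1 | h1
    · exact h.isTwistPair.baseChange_ne_smul F α (LinearMap.ext fun v => by
        rw [← hΨv]; exact h1 v trivial)
    · exact h.isTwistPair.baseChange_ne_smul F (-α) (LinearMap.ext fun v => by
        rw [← hΨv]; exact h1 v trivial)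
  · rintro ⟨α, hα⟩ Ψ hΨ
    obtain ⟨β, hβ⟩ := h.exists_eq_smul_of_isTwistedHom F _ hΨ
    have h3 : ∀ x, Ψ x = β • ψ.baseChange F x := fun x => LinearMap.congr_fun hβ x
    refine ⟨β * α, fun W hW => ?_⟩
    have hker : ∀ γ : F, W = LinearMap.ker (ψ.baseChange F - γ • 1) →
        ∀ v ∈ W, Ψ v = (β * γ) • v := by
      rintro γ rfl v hv
      have : ψ.baseChange F v = γ • v := by
        simpa [LinearMap.mem_ker, sub_eq_zero] using hv
      rw [h3, this, smul_smul]
    rcases h.eq_ker_of_isStable F hW.1 with h1 | h1 | ⟨γ, hγ, h1⟩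
    · exact absurd h1 hW.2.1
    · subst h1
      rcases hW.2.2 _ (h.isStable_ker F α) le_top with h2 | h2
      · exact absurd h2 (h.ker_ne_bot F hα)
      · exact absurd h2 (h.ker_ne_top F α)
    · rcases sq_eq_sq_iff_eq_or_eq_neg.1 (hγ.trans hα.symm) with rfl | rfl
      · exact Or.inl (hker _ h1)
      · refine Or.inr fun v hv => ?_
        rw [hker _ h1 v hv]
        congr 1
        ring

end

end IsTwistModel

end Conditions

/-! ### Quadratic characters and twisted automorphisms over the field of definition -/

section Models

variable {n : ℕ} {G H K : Subgroup (GLC n)}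

/-- Functions with values in a vector space that vanish on the real points vanish. -/
theorem eq_zero_of_evalAt_real (hK : IsMaximalCompactModel G K) {M : Type v} [AddCommGroup M]
    [Module ℂ M] [Module ℚ M] (t : M ⊗[ℚ] coordRing K)
    (ht : ∀ k : realPts K, evalAt (realToC k) t = 0) : t = 0 := by
  refine eq_zero_of_evalAt hK.algebraic t fun k => ?_
  refine (Module.forall_dual_apply_eq_zero_iff ℂ _).1 fun μ => ?_
  have key : ∀ t : M ⊗[ℚ] coordRing K, ∃ p : MvPolynomial (Coord n) ℂ, ∀ k : K,
      MvPolynomial.aeval (coords (k : GLC n)) p = μ (evalAt k t) := by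
    intro t
    induction t with
    | zero => exact ⟨0, by simp⟩
    | add x y hx hy =>
      obtain ⟨p, hp⟩ := hx
      obtain ⟨q, hq⟩ := hy
      exact ⟨p + q, fun k => by rw [map_add, map_add, map_add, hp, hq]⟩
    | tmul m f =>
      obtain ⟨p, hp⟩ := coordRing_apply f
      refine ⟨p.map (algebraMap ℚ ℂ) * MvPolynomial.C (μ m), fun k => ?_⟩
      rw [map_mul, MvPolynomial.aeval_map_algebraMap, ← hp]
      simp
  obtain ⟨p, hp⟩ := key t
  rw [← hp]
  exact hK.dense p (fun k' => by rw [hp, ht, map_zero]) k k.2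

theorem continuous_aeval_coords_real (p : MvPolynomial (Coord n) ℚ) :
    Continuous fun g : GLR n => MvPolynomial.aeval
      (coords (Matrix.GeneralLinearGroup.map Complex.ofRealHom g)) p := by
  induction p using MvPolynomial.induction_on with
  | C c => simpa using continuous_const
  | add p q hp hq =>
    simp only [map_add]
    exact Continuous.add hp hq
  | mul_X p s hp =>
    simp only [map_mul, MvPolynomial.aeval_X]
    refine hp.mul ?_
    rcases s with s | s
    · exact Complex.continuous_ofReal.comp (Units.continuous_val.matrix_elem s.1 s.2)
    · have : (fun g : GLR n => coords (Matrix.GeneralLinearGroup.map Complex.ofRealHom g)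
          (Sum.inr s)) = fun g => (((g⁻¹ : GLR n) : Matrix (Fin n) (Fin n) ℝ) s.1 s.2 : ℂ) := by
        funext g
        have h1 : (Matrix.GeneralLinearGroup.map Complex.ofRealHom g)⁻¹ =
          Matrix.GeneralLinearGroup.map Complex.ofRealHom g⁻¹ := (map_inv _ _).symm
        simp only [coords, Sum.elim_inr, h1]
        rfl
      rw [this]
      exact Complex.continuous_ofReal.comp
        ((Units.continuous_val.comp continuous_inv).matrix_elem s.1 s.2)

theorem realToC_pow (k : realPts K) (m : ℕ) : realToC (k ^ m) = realToC k ^ m :=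
  Subtype.ext (map_pow (Matrix.GeneralLinearGroup.map Complex.ofRealHom) (k : GLR n) m)

theorem realToC_inv (k : realPts K) : realToC k⁻¹ = (realToC k)⁻¹ :=
  Subtype.ext (map_inv (Matrix.GeneralLinearGroup.map Complex.ofRealHom) (k : GLR n))

/-- The powers of `k` stay in a compact group on which χ is bounded, so $|\chi(k)| \le 1$; the same
holds for the inverse. -/
theorem norm_char_eq_one (hK : IsMaximalCompactModel G K) (χ : CompChar K) (k : realPts K) :
    ‖χ.hom (realToC k)‖ = 1 := by
  obtain ⟨p, hp⟩ := coordRing_apply χ.fn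
  have hp' : ∀ k : K, χ.hom k = MvPolynomial.aeval (coords (k : GLC n)) p := hp
  obtain ⟨C, hC⟩ := hK.compact.exists_bound_of_continuousOn
    (continuous_aeval_coords_real p).continuousOn
  have hle : ∀ k : realPts K, ‖χ.hom (realToC k)‖ ≤ 1 := by
    intro k
    by_contra! h1
    obtain ⟨m, hm⟩ := pow_unbounded_of_one_lt C h1
    have h2 := hC (k ^ m : realPts K) (k ^ m).2
    have h3 : χ.hom (realToC (k ^ m)) = MvPolynomial.aeval
        (coords (Matrix.GeneralLinearGroup.map Complex.ofRealHom ((k ^ m : realPts K) : GLR n))) p :=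
      hp' _
    rw [← h3, realToC_pow, map_pow, norm_pow] at h2
    exact absurd hm (not_lt.2 h2)
  have h1 : χ.hom (realToC k) * χ.hom (realToC k⁻¹) = 1 := by
    rw [← map_mul, realToC_inv, mul_inv_cancel, map_one]
  have h2 := congrArg norm h1
  rw [norm_mul, norm_one] at h2
  have h3 := hle k
  have h4 := hle k⁻¹
  nlinarith [norm_nonneg (χ.hom (realToC k)), norm_nonneg (χ.hom (realToC k⁻¹))]

/-- A rational number of absolute value one is $\pm1$, so $\chi^2 - 1$ vanishes on the real points,
which are Zariski dense. -/
theorem char_quadratic (hK : IsMaximalCompactModel G K) (χ : CompChar K)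
    (hχ : ∀ k : realPts K, ∃ c : ℚ, (c : ℂ) = χ.hom (realToC k)) (k : K) :
    χ.hom k = 1 ∨ χ.hom k = -1 := by
  obtain ⟨p, hp⟩ := coordRing_apply χ.fn
  have hp' : ∀ k : K, χ.hom k = MvPolynomial.aeval (coords (k : GLC n)) p := hp
  have h1 := hK.dense ((p ^ 2 - 1).map (algebraMap ℚ ℂ)) (fun k => by
    obtain ⟨c, hc⟩ := hχ k
    have h2 := norm_char_eq_one hK χ k
    rw [MvPolynomial.aeval_map_algebraMap, map_sub, map_pow, map_one, ← hp', ← hc]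
    rw [← hc] at h2
    have h3 : |c| = 1 := by
      have : ‖(c : ℂ)‖ = ((|c| : ℚ) : ℝ) := by
        rw [← Complex.ofReal_ratCast, Complex.norm_real, Real.norm_eq_abs, Rat.cast_abs]
      rw [this] at h2
      exact_mod_cast h2
    have h4 : c ^ 2 = 1 := by rw [← sq_abs, h3, one_pow]
    rw [sub_eq_zero]
    exact_mod_cast h4) k k.2
  rw [MvPolynomial.aeval_map_algebraMap, map_sub, map_pow, map_one, ← hp', sub_eq_zero] at h1
  have h2 : (χ.hom k - 1) * (χ.hom k + 1) = 0 := by linear_combination h1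
  exact (mul_eq_zero.1 h2).imp sub_eq_zero.1 eq_neg_of_add_eq_zero_left

variable {E : Type u} [Field E] [CharZero E] [Algebra E ℂ]
  {B : Type v} [AddCommGroup B] [Module E B] [Module ℚ B]

/-- An injection of the complexification of `b` into a module over the complex pair, compatible
with all actions. -/
structure IsComplexEmbedding (b : PairAction (lieAlgQ H) K E B) (Y : HCMod (lieAlg G) K)
    (ι : ℂ ⊗[E] B →ₗ[ℂ] Y.carrier) : Prop where
  injective : Function.Injective ι
  map_lie : ∀ (X : lieAlgQ H) (X' : lieAlg G), (X' : MatC n) = ratToC X →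
    ∀ v, ι ((b.baseChange ℂ).lie X v) = Y.lie X' (ι v)
  map_act : ∀ k v, ι ((b.baseChange ℂ).act k v) = Y.grp k (ι v)

namespace IsComplexEmbedding

variable {b : PairAction (lieAlgQ H) K E B} {Y : HCMod (lieAlg G) K}
  {ι : ℂ ⊗[E] B →ₗ[ℂ] Y.carrier} (h : IsComplexEmbedding b Y ι)

include h

theorem act_one : (b.baseChange ℂ).act 1 = 1 := by
  refine LinearMap.ext fun v => h.injective ?_
  rw [h.map_act, map_one]
  rfl

theorem act_mul (k k' : K) : (b.baseChange ℂ).act (k * k') =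
    (b.baseChange ℂ).act k * (b.baseChange ℂ).act k' := by
  refine LinearMap.ext fun v => h.injective ?_
  rw [h.map_act, map_mul, Module.End.mul_apply, Module.End.mul_apply, h.map_act, h.map_act]

/-- The complex Lie algebra is spanned by its rational points, whose action on `Y` comes from `b`.
-/
theorem exists_lie (hH : IsAlgebraicOver ℚ H) (hHG : H ≤ G) {T : MatC n} (hT : T ∈ lieAlg H) :
    ∃ Z ∈ Submodule.span ℂ (Set.range (b.baseChange ℂ).lie),
      ∀ v, ι (Z v) = Y.lie ⟨T, lieAlg_mono hHG hT⟩ (ι v) := by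
  have h1 := mem_span_lieAlgQ hH hT
  have hle : Submodule.span ℂ (Set.range fun Y : lieAlgQ H => ratToC (Y : MatQ n)) ≤
      (lieAlg G).toSubmodule := Submodule.span_le.2 (by
    rintro _ ⟨X, rfl⟩
    exact lieAlg_mono hHG X.2)
  suffices ∀ T ∈ Submodule.span ℂ (Set.range fun Y : lieAlgQ H => ratToC (Y : MatQ n)),
      ∀ hT : T ∈ lieAlg G, ∃ Z ∈ Submodule.span ℂ (Set.range (b.baseChange ℂ).lie),
        ∀ v, ι (Z v) = Y.lie ⟨T, hT⟩ (ι v) from this T h1 _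
  intro T hT
  induction hT using Submodule.span_induction with
  | mem T hT =>
    obtain ⟨X, rfl⟩ := hT
    exact fun hT => ⟨_, Submodule.subset_span ⟨X, rfl⟩, h.map_lie X _ rfl⟩
  | zero =>
    refine fun hT => ⟨0, Submodule.zero_mem _, fun v => ?_⟩
    have : (⟨0, hT⟩ : lieAlg G) = 0 := rfl
    rw [this, map_zero]
    simp
  | add T T' hT hT' h1 h2 =>
    intro hTT
    obtain ⟨Z, hZ, hZv⟩ := h1 (hle hT)
    obtain ⟨Z', hZ', hZv'⟩ := h2 (hle hT')
    refine ⟨Z + Z', Submodule.add_mem _ hZ hZ', fun v => ?_⟩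
    have : (⟨T + T', hTT⟩ : lieAlg G) = ⟨T, hle hT⟩ + ⟨T', hle hT'⟩ := rfl
    rw [this, map_add, LinearMap.add_apply, map_add, hZv, hZv', LinearMap.add_apply]
  | smul e T hT h1 =>
    intro hTT
    obtain ⟨Z, hZ, hZv⟩ := h1 (hle hT)
    refine ⟨e • Z, Submodule.smul_mem _ e hZ, fun v => ?_⟩
    have : (⟨e • T, hTT⟩ : lieAlg G) = e • ⟨T, hle hT⟩ := rfl
    rw [this, map_smul, LinearMap.smul_apply, map_smul, hZv, LinearMap.smul_apply]

/-- The conjugate of a rational element by a complex point is in general not rational, hence the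
complex span. -/
theorem compat (hH : IsAlgebraicOver ℚ H) (hHG : H ≤ G) (hKH : K ≤ H) (k : K) (X : lieAlgQ H) :
    ∃ Z ∈ Submodule.span ℂ (Set.range (b.baseChange ℂ).lie),
      (b.baseChange ℂ).act k * (b.baseChange ℂ).lie X = Z * (b.baseChange ℂ).act k := by
  have h1 : (((k : GLC n)⁻¹ : GLC n) : MatC n) * ((k : GLC n) : MatC n) = 1 := by
    rw [← Units.val_mul]; simp
  have hT : ((k : GLC n) : MatC n) * ratToC (X : MatQ n) * (((k : GLC n)⁻¹ : GLC n) : MatC n) ∈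
      lieAlg H := by
    refine lieAlg_conj (H.inv_mem (hKH k.2)) X.2 ?_
    rw [← mul_assoc, ← mul_assoc, h1, one_mul]
  obtain ⟨Z, hZ, hZv⟩ := h.exists_lie hH hHG hT
  refine ⟨Z, hZ, LinearMap.ext fun v => h.injective ?_⟩
  rw [Module.End.mul_apply, Module.End.mul_apply, h.map_act, hZv, h.map_act,
    h.map_lie X ⟨ratToC X, lieAlg_mono hHG X.2⟩ rfl]
  exact Y.compat k _ _ rfl _

end IsComplexEmbedding

variable {𝔥 : LieSubalgebra ℚ (MatQ n)} {a : PairAction 𝔥 K E B} {χ : CompChar K}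

theorem dualMul_dualMul (hχ : ∀ k, χ.hom k = 1 ∨ χ.hom k = -1) (ℓ : coordRing K →ₗ[ℚ] ℚ) :
    χ.dualMul (χ.dualMul ℓ) = ℓ := by
  ext f
  refine congrArg ℓ (Subtype.ext (funext fun k => ?_))
  change χ.hom k * (χ.hom k * (f : K → ℂ) k) = (f : K → ℂ) k
  rcases hχ k with h | h <;> simp [h]

/-- A twisted homomorphism over the complex numbers yields one over the field of definition. -/
theorem exists_isTwistModel (hK : IsAlgebraicOver ℚ K)
    (h1 : (a.baseChange ℂ).act 1 = 1)
    (h2 : ∀ k k', (a.baseChange ℂ).act (k * k') = (a.baseChange ℂ).act k * (a.baseChange ℂ).act k')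
    (h3 : ∀ k X, ∃ Z ∈ Submodule.span ℂ (Set.range (a.baseChange ℂ).lie),
      (a.baseChange ℂ).act k * (a.baseChange ℂ).lie X = Z * (a.baseChange ℂ).act k)
    (hirr : IsIrredSub (a.baseChange ℂ) ⊤) (hχ : ∀ k, χ.hom k = 1 ∨ χ.hom k = -1)
    (hχ1 : ∃ k, χ.hom k = -1) (ψ₀ : Module.End ℂ (ℂ ⊗[E] B))
    (hψ₀ : IsTwistedHom (a.baseChange ℂ) χ ψ₀) (h0 : ψ₀ ≠ 0) :
    ∃ ψ c, IsTwistModel a χ ψ c := by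
  -- A nonzero slice of `ψ₀` is the twisted endomorphism over `E`; twistedness survives slicing
  -- since all operators involved are defined over `E`.
  obtain ⟨μ, hμ⟩ : ∃ μ : ℂ →ₗ[E] E, sliceHom ψ₀ μ ≠ 0 := by
    by_contra! h
    exact h0 (eq_zero_of_sliceHom ψ₀ h)
  let ψ : Module.End E B := sliceHom ψ₀ μ
  have hψ : IsTwistedHom a χ ψ := by
    rw [isTwistedHom_iff] at hψ₀ ⊢
    refine ⟨fun X => sliceHom_comm ψ₀ μ _ _ (hψ₀.1 X), fun ℓ => sliceHom_comm ψ₀ μ _ _ ?_⟩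
    rw [← baseChange_coeff, ← baseChange_coeff]
    exact hψ₀.2 ℓ
  have hψ' := (isTwistedHom_iff _ _ _).1 hψ
  -- The two twists cancel because `χ² = 1`.
  have hcomm : ∀ T ∈ a.opSet, ψ * ψ * T = T * (ψ * ψ) := by
    rintro _ (⟨X, rfl⟩ | ⟨ℓ, rfl⟩)
    · rw [mul_assoc, hψ'.1, ← mul_assoc, hψ'.1, mul_assoc]
    · nth_rewrite 1 [← dualMul_dualMul hχ ℓ]
      rw [mul_assoc, hψ'.2, ← mul_assoc, hψ'.2, mul_assoc]
  obtain ⟨β, hβ⟩ := exists_eq_smul_of_commute_opSet (a.baseChange ℂ) hirr ((ψ * ψ).baseChange ℂ) (by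
    rw [opSet_baseChange]
    rintro _ ⟨T, hT, rfl⟩
    change (ψ * ψ).baseChange ℂ * T.baseChange ℂ = T.baseChange ℂ * (ψ * ψ).baseChange ℂ
    rw [← LinearMap.baseChange_mul, hcomm T hT, LinearMap.baseChange_mul])
  obtain ⟨ν, hν⟩ := exists_functional_one (E := E) (L := ℂ)
  have hc : ψ * ψ = ν β • 1 := by
    refine LinearMap.ext fun v => ?_
    have := congrArg (slice ν) (LinearMap.congr_fun hβ (1 ⊗ₜ v))
    simpa [hν, TensorProduct.smul_tmul'] using this
  -- If the scalar were zero, `ψ` would be nilpotent; its kernel over ℂ is a submodule, so by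
  -- irreducibility `ψ` is injective or zero, and either way `ψ = 0`.
  refine ⟨ψ, ν β, hK, h1, h2, h3, hirr, hχ, hχ1, hψ, fun hν0 => ?_, hc⟩
  rw [hν0, zero_smul] at hc
  have hψC := (isTwistedHom_iff _ _ _).1 (hψ.baseChange ℂ)
  have hker := hirr.2.2 (LinearMap.ker (ψ.baseChange ℂ)) ((isStable_iff _ _).2 (by
    rintro _ (⟨X, rfl⟩ | ⟨ℓ, rfl⟩) x hx
    · rw [LinearMap.mem_ker] at hx ⊢
      rw [← Module.End.mul_apply, hψC.1, Module.End.mul_apply, hx, map_zero]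
    · rw [LinearMap.mem_ker] at hx ⊢
      rw [← Module.End.mul_apply, ← dualMul_dualMul hχ ℓ, hψC.2, Module.End.mul_apply, hx,
        map_zero])) le_top
  rcases hker with hker | hker
  · refine hμ (LinearMap.ext fun v => ?_)
    have h4 : ∀ x, ψ x = 0 → x = 0 := fun x hx => by
      have : (1 : ℂ) ⊗ₜ[E] x ∈ LinearMap.ker (ψ.baseChange ℂ) := by
        rw [LinearMap.mem_ker, LinearMap.baseChange_tmul, hx, TensorProduct.tmul_zero]
      rwa [hker, Submodule.mem_bot, one_tmul_eq_zero_iff] at this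
    exact h4 _ (LinearMap.congr_fun hc v)
  · refine hμ (LinearMap.ext fun v => ?_)
    have h4 := LinearMap.congr_fun (LinearMap.ker_eq_top.1 hker) (1 ⊗ₜ v)
    rw [LinearMap.baseChange_tmul] at h4
    exact (one_tmul_eq_zero_iff _).1 h4

end Models

/-! ### Homomorphisms of coactions between modules for different Lie algebras -/

section CoactionHoms

variable {n : ℕ} {𝔥 𝔥' : LieSubalgebra ℚ (MatQ n)} {H : Subgroup (GLC n)}

section

variable {F : Type u} [Field F] [CharZero F]
  {A : Type v} [AddCommGroup A] [Module F A] [Module ℚ A]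
  {B : Type w} [AddCommGroup B] [Module F B] [Module ℚ B]
  {a : PairAction 𝔥 H F A} {b : PairAction 𝔥' H F B} {f : A →ₗ[F] B}

theorem coact_comm_iff : (∀ x, b.coact (f x) =
      TensorProduct.AlgebraTensorModule.map f LinearMap.id (a.coact x)) ↔
    ∀ ℓ, f ∘ₗ a.coeff ℓ = b.coeff ℓ ∘ₗ f := by
  simp only [coact_eq_iff (F := F), coeffMap_map, LinearMap.ext_iff]
  exact ⟨fun h ℓ x => (h x ℓ).symm, fun h x ℓ => (h ℓ x).symm⟩

theorem coact_comm_baseChange (hf : ∀ x, b.coact (f x) =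
      TensorProduct.AlgebraTensorModule.map f LinearMap.id (a.coact x))
    (F' : Type*) [Field F'] [CharZero F'] [Algebra F F'] (x : F' ⊗[F] A) :
    (b.baseChange F').coact (f.baseChange F' x) =
      TensorProduct.AlgebraTensorModule.map (f.baseChange F') LinearMap.id
        ((a.baseChange F').coact x) := by
  revert x
  rw [coact_comm_iff] at hf ⊢
  intro ℓ
  rw [baseChange_coeff, baseChange_coeff, ← LinearMap.baseChange_comp, hf,
    LinearMap.baseChange_comp]

end

theorem act_comm {A : Type v} [AddCommGroup A] [Module ℂ A] [Module ℚ A]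
    {B : Type w} [AddCommGroup B] [Module ℂ B] [Module ℚ B]
    {a : PairAction 𝔥 H ℂ A} {b : PairAction 𝔥' H ℂ B} {f : A →ₗ[ℂ] B}
    (hf : ∀ x, b.coact (f x) =
      TensorProduct.AlgebraTensorModule.map f LinearMap.id (a.coact x)) (k : H) (x : A) :
    f (a.act k x) = b.act k (f x) := by
  rw [PairAction.act_apply, PairAction.act_apply, hf,
    evalAt_map k k f LinearMap.id 1 (fun f => (one_mul _).symm), one_smul]

end CoactionHoms

/-! ### From cohomological pairs to twisted automorphisms -/

section Cohomological

variable {n : ℕ} {G K : Subgroup (GLC n)} {E : Type} [Field E] [CharZero E] [Algebra E ℂ]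
  {A : Type} [AddCommGroup A] [Module E A] [Module ℚ A]
  {A' : Type} [AddCommGroup A'] [Module E A'] [Module ℚ A']
  {B : Type} [AddCommGroup B] [Module E B] [Module ℚ B]
  {V : Type} [AddCommGroup V] [Module E V] [Module ℚ V]
  {V' : Type} [AddCommGroup V'] [Module E V'] [Module ℚ V']
  {χ : CompChar K}

theorem baseChange_smul_id {E M : Type*} [Field E] [Algebra E ℂ] [AddCommGroup M] [Module E M]
    (c : E) (x : ℂ ⊗[E] M) :
    (c • (LinearMap.id : M →ₗ[E] M)).baseChange ℂ x = algebraMap E ℂ c • x := by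
  rw [LinearMap.baseChange_smul, LinearMap.baseChange_id, LinearMap.smul_apply,
    LinearMap.id_apply, algebraMap_smul]

/-- An isomorphism of the complexifications of a module and of its twist is a twisted
automorphism. -/
theorem exists_isTwistedHom_complex (hK : IsMaximalCompactModel G K) {a : LocAlgModule G K K E A}
    {a' : LocAlgModule G K K E A'} (hirr : IsIrredSub (a.toPairAction.baseChange ℂ) ⊤)
    (hcomp : ∀ k, ∃ c : E, a.comp k = c • LinearMap.id)
    (hχ : ∀ k, χ.hom k = 1 ∨ χ.hom k = -1)
    (hA' : IsTwistBy χ a' a) (hC : ComplexIso a a') :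
    ∃ ψ : Module.End ℂ (ℂ ⊗[E] A), IsTwistedHom (a.toPairAction.baseChange ℂ) χ ψ ∧ ψ ≠ 0 := by
  obtain ⟨φ, ⟨hφ1, hφ2⟩, hφ3⟩ := hA'
  obtain ⟨Ψ, hΨ1, hΨ2⟩ := hC
  let ψ : Module.End ℂ (ℂ ⊗[E] A) := φ.toLinearMap.baseChange ℂ ∘ₗ Ψ.toLinearMap
  have hφC : Function.Injective (φ.toLinearMap.baseChange ℂ) :=
    Module.Flat.lTensor_preserves_injective_linearMap _ φ.injective
  have hψ : Function.Injective ψ := hφC.comp Ψ.injective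
  obtain ⟨x, -, hx⟩ := Submodule.exists_mem_ne_zero_of_ne_bot hirr.2.1
  have hlie : ∀ X y, ψ ((a.toPairAction.baseChange ℂ).lie X y) =
      (a.toPairAction.baseChange ℂ).lie X (ψ y) := by
    intro X y
    have h1 : φ.toLinearMap ∘ₗ a'.lie X = a.lie X ∘ₗ φ.toLinearMap := LinearMap.ext (hφ1 X)
    have h2 := congrArg (LinearMap.baseChange ℂ) h1
    rw [LinearMap.baseChange_comp, LinearMap.baseChange_comp] at h2
    change φ.toLinearMap.baseChange ℂ (Ψ _) = _
    rw [hΨ1]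
    exact LinearMap.congr_fun h2 (Ψ y)
  -- A component acts by a scalar `c` on `A`, and by `χ(k) c` on `A'`. Cancelling `c` in the
  -- equivariance of `Ψ` leaves the twist by χ, for now on real points only.
  have hreal : ∀ (k : realPts K) y, (a.toPairAction.baseChange ℂ).act (realToC k) (ψ y) =
      χ.hom (realToC k) • ψ ((a.toPairAction.baseChange ℂ).act (realToC k) y) := by
    intro k y
    obtain ⟨c, hc⟩ := hcomp k
    obtain ⟨d, hd⟩ := hcomp k⁻¹
    obtain ⟨q, hq, hqv⟩ := hφ3 k
    have hc0 : algebraMap E ℂ c ≠ 0 := by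
      rw [map_ne_zero]
      rintro rfl
      have h1 : a.comp k * a.comp k⁻¹ = 1 := by rw [← map_mul, mul_inv_cancel, map_one]
      rw [hc, zero_smul, zero_mul] at h1
      refine hx ?_
      have h2 := LinearMap.congr_fun (LinearMap.baseChange_one (R := E) (A := ℂ) (M := A)) x
      rw [← h1, LinearMap.baseChange_zero] at h2
      exact h2.symm
    have hc' : a'.comp k = ((q : E) * c) • LinearMap.id := by
      refine LinearMap.ext fun v => φ.injective ?_
      rw [hqv, hc, LinearMap.smul_apply, LinearMap.smul_apply, LinearMap.id_apply,
        LinearMap.id_apply, map_smul, mul_smul]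
    have h1 := hΨ2 k y
    rw [LocAlgModule.diagAct, LocAlgModule.diagAct, LinearMap.comp_apply, LinearMap.comp_apply,
      hc, hc', baseChange_smul_id, baseChange_smul_id, map_smul, map_mul, map_ratCast, hq,
      mul_comm, mul_smul] at h1
    have h2 := smul_right_injective _ hc0 h1
    have h3 := congrArg (φ.toLinearMap.baseChange ℂ) h2
    rw [map_smul, act_comm (coact_comm_baseChange hφ2 ℂ)] at h3
    change _ = _ • φ.toLinearMap.baseChange ℂ (Ψ _)
    rw [h3, smul_smul]
    have h4 : χ.hom (realToC k) * χ.hom (realToC k) = 1 := by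
      rcases hχ (realToC k) with h | h <;> simp [h]
    rw [h4, one_smul]
    rfl
  refine ⟨ψ, ⟨hlie, fun y => sub_eq_zero.1 (eq_zero_of_evalAt_real hK _ fun k => ?_)⟩, ?_⟩
  · rw [map_sub, evalAt_map _ (realToC k) ψ (LinearMap.mulLeft ℚ χ.fn) (χ.hom (realToC k))
      fun g => rfl]
    exact sub_eq_zero.2 (hreal k y)
  · intro h
    exact hx (hψ (by rw [h, LinearMap.zero_apply, LinearMap.zero_apply]))

omit [Algebra E ℂ] in
-- If χ were identically one, twisting by it would change nothing.
theorem exists_char_eq_neg_one {ρ : LocAlgModule G K G E V} {ρ' : LocAlgModule G K G E V'}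
    (hχ : ∀ k, χ.hom k = 1 ∨ χ.hom k = -1) (h : IsTwistBy χ ρ' ρ) (hne : ¬ LocAlgIso ρ' ρ) :
    ∃ k, χ.hom k = -1 := by
  by_contra! h1
  obtain ⟨φ, hφ, hφ'⟩ := h
  refine hne ⟨φ, hφ, fun k v => ?_⟩
  obtain ⟨c, hc, hcv⟩ := hφ' k
  rw [(hχ _).resolve_right (h1 _)] at hc
  rw [hcv, show c = 1 by exact_mod_cast hc, Rat.cast_one, one_smul]

/-- A pair of modules that differ by an admissible twist of the same cohomological type gives rise
to a twisted automorphism over the field of definition. -/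
theorem IsCohPair.exists_isTwistModel {a : LocAlgModule G K K E A} {ρ : LocAlgModule G K G E V}
    (hav : IsCohPair a ρ) (hG : IsAlgebraicOver ℚ G) (hK : IsMaximalCompactModel G K)
    {a' : LocAlgModule G K K E A'} {ρ' : LocAlgModule G K G E V'}
    (hV' : IsTwistBy χ ρ' ρ) (hne : ¬ LocAlgIso ρ' ρ)
    (hA' : IsTwistBy χ a' a) (hC : ComplexIso a a') :
    ∃ ψ c, IsTwistModel a.toPairAction χ ψ c := by
  have hχ := char_quadratic hK χ fun k => by
    obtain ⟨φ, -, hφ⟩ := hA'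
    obtain ⟨c, hc, -⟩ := hφ k
    exact ⟨c, hc⟩
  obtain ⟨Y, e, he⟩ := hav.isModule
  have hY : IsComplexEmbedding a.toPairAction Y e.toLinearMap := ⟨e.injective, he.1, he.2⟩
  obtain ⟨ψ, hψ, h0⟩ := exists_isTwistedHom_complex hK hav.irred
    (fun k => (hav.same_comp k).imp fun c hc => hc.1) hχ hA' hC
  exact LocAlg.exists_isTwistModel hK.algebraic hY.act_one hY.act_mul
    (hY.compat hG le_rfl hK.le) hav.irred hχ (exists_char_eq_neg_one hχ hV' hne) ψ hψ h0

/-! ### Minimal `K`-types under twisted automorphisms -/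

section MinimalKType

variable {Y : HCMod (lieAlg G) K} {Ψ : Y.carrier →ₗ[ℂ] Y.carrier} {C : Submodule ℂ Y.carrier}

/-- `Ψ` commutes with the group up to a sign, which no subspace notices. -/
theorem IsKType.map (hC : IsKType Y C) (hΨ : Function.Injective Ψ)
    (hgrp : ∀ k y, Y.grp k (Ψ y) = χ.hom k • Ψ (Y.grp k y))
    (hχ : ∀ k, χ.hom k = 1 ∨ χ.hom k = -1) : IsKType Y (C.map Ψ) := by
  obtain ⟨h1, h2, h3⟩ := hC
  refine ⟨?_, fun h => h2 (Submodule.map_injective_of_injective hΨ (h.trans (Submodule.map_bot Ψ).symm)), fun D hD hDC => ?_⟩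
  · rintro k _ ⟨v, hv, rfl⟩
    rw [hgrp]
    exact Submodule.smul_mem _ _ ⟨_, h1 k v hv, rfl⟩
  · have hmap : (D.comap Ψ).map Ψ = D :=
      Submodule.map_comap_eq_of_le (hDC.trans (LinearMap.map_le_range))
    have hle : D.comap Ψ ≤ C := by
      rw [← Submodule.comap_map_eq_of_injective hΨ C]
      exact Submodule.comap_mono hDC
    have hst : ∀ k, ∀ v ∈ D.comap Ψ, Y.grp k v ∈ D.comap Ψ := by
      intro k v hv
      have h4 : Ψ (Y.grp k v) = χ.hom k • Y.grp k (Ψ v) := by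
        rw [hgrp, smul_smul]
        rcases hχ k with h | h <;> simp [h]
      rw [Submodule.mem_comap, h4]
      exact D.smul_mem _ (hD k _ hv)
    rcases h3 _ hst hle with h | h
    · exact Or.inl (by rw [← hmap, h, Submodule.map_bot])
    · exact Or.inr (by rw [← hmap, h])

/-- The norm is read off from the Lie algebra action on a highest weight vector, and `Ψ` commutes
with the Lie algebra. -/
theorem HasVoganNorm.map {r : ℝ} (hC : HasVoganNorm Y C r) (hΨ : Function.Injective Ψ)
    (hlie : ∀ T y, Ψ (Y.lie T y) = Y.lie T (Ψ y)) : HasVoganNorm Y (C.map Ψ) r := by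
  obtain ⟨x, hx, hreg, v, hv, hv0, hhw, Q, hQ, hxQ, hwt, hr⟩ := hC
  refine ⟨x, hx, hreg, Ψ v, ⟨v, hv, rfl⟩, fun h => hv0 (hΨ (by rw [h, map_zero])),
    fun T hT => ?_, Q, hQ, hxQ, fun T hT hxT s hs => ?_, hr⟩
  · rw [← hlie, hhw T hT, map_zero]
  · rw [← hlie, hwt T hT hxT s hs, map_smul]

/-- The minimal `K`-type is preserved by twisted automorphisms. -/
theorem IsMinimalKType.map_eq (hC : IsMinimalKType Y C) (hΨ : Function.Injective Ψ)
    (hlie : ∀ T y, Ψ (Y.lie T y) = Y.lie T (Ψ y))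
    (hgrp : ∀ k y, Y.grp k (Ψ y) = χ.hom k • Ψ (Y.grp k y))
    (hχ : ∀ k, χ.hom k = 1 ∨ χ.hom k = -1) : C.map Ψ = C := by
  obtain ⟨h1, r, hr, hmin⟩ := hC
  by_contra h
  -- Otherwise the image would be another `K`-type with the same norm.
  exact lt_irrefl r (hmin _ (h1.map hΨ hgrp hχ) h r (hr.map hΨ hlie))

end MinimalKType

/-- The twisted automorphism preserves the bottom layer. -/
theorem IsTwistModel.apply_mem_range {a : LocAlgModule G K K E A}
    {b : PairAction (lieAlgQ K) K E B} {j : B →ₗ[E] A} {ψ : Module.End E A} {c : E}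
    (h : IsTwistModel a.toPairAction χ ψ c) (hG : IsAlgebraicOver ℚ G)
    (hb : IsBottomLayer a b j) (x : B) : ψ (j x) ∈ LinearMap.range j := by
  obtain ⟨-, -, -, Y, e, ⟨he1, he2⟩, hC⟩ := hb
  have hY : IsComplexEmbedding a.toPairAction Y e.toLinearMap := ⟨e.injective, he1, he2⟩
  have htw := (isTwistedHom_iff_act h.algebraic _ χ _).1 (h.twisted.baseChange ℂ)
  have hψ : Function.Injective ψ := by
    refine (injective_iff_map_eq_zero ψ).2 fun x hx => ?_
    have h1 := LinearMap.congr_fun h.sq x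
    rw [Module.End.mul_apply, hx, map_zero] at h1
    exact (smul_eq_zero.1 h1.symm).resolve_left h.ne_zero
  have hψC : Function.Injective (ψ.baseChange ℂ) :=
    Module.Flat.lTensor_preserves_injective_linearMap _ hψ
  let Ψ : Y.carrier →ₗ[ℂ] Y.carrier := e.toLinearMap ∘ₗ ψ.baseChange ℂ ∘ₗ e.symm.toLinearMap
  have hΨe : ∀ t, Ψ (e t) = e (ψ.baseChange ℂ t) := fun t => by
    change e (ψ.baseChange ℂ (e.symm (e t))) = _
    rw [e.symm_apply_apply]
  have hmap := hC.map_eq (Ψ := Ψ) (χ := χ) (e.injective.comp (hψC.comp e.symm.injective))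
    (by
      intro T y
      obtain ⟨t, rfl⟩ := e.surjective y
      obtain ⟨Z, hZ, hZT⟩ := hY.exists_lie hG le_rfl T.2
      have hcomm : ψ.baseChange ℂ * Z = Z * ψ.baseChange ℂ := by
        clear hZT
        induction hZ using Submodule.span_induction with
        | mem Z hZ =>
          obtain ⟨X, rfl⟩ := hZ
          exact LinearMap.ext (htw.1 X)
        | zero => rw [mul_zero, zero_mul]
        | add Z Z' _ _ h1 h2 => rw [mul_add, add_mul, h1, h2]
        | smul d Z _ h1 => rw [mul_smul_comm, smul_mul_assoc, h1]
      have h1 : ∀ v, e (Z v) = Y.lie T (e v) := hZT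
      rw [hΨe, ← h1, ← h1, hΨe]
      exact congrArg e (LinearMap.congr_fun hcomm t))
    (by
      intro k y
      obtain ⟨t, rfl⟩ := e.surjective y
      rw [hΨe, ← he2, htw.2, map_smul, ← he2, hΨe])
    h.quadratic
  have h1 : Ψ (e (j.baseChange ℂ (1 ⊗ₜ x))) ∈
      (LinearMap.range (j.baseChange ℂ)).map e.toLinearMap := by
    rw [← hmap]
    exact ⟨_, ⟨_, ⟨_, rfl⟩, rfl⟩, rfl⟩
  obtain ⟨_, ⟨s, rfl⟩, hs⟩ := h1
  rw [hΨe] at hs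
  have h2 : j.baseChange ℂ s = (1 : ℂ) ⊗ₜ ψ (j x) := e.injective hs
  -- Membership in the range of `j` is known over ℂ; slicing brings it down to `E`.
  rw [← one_tmul_mem_baseChange_iff (L := ℂ), ← h2, mem_baseChange_iff_slice]
  intro μ
  rw [slice_baseChange]
  exact ⟨_, rfl⟩

/-- The twisted automorphism restricts to the bottom layer, with the same square. -/
theorem IsTwistModel.bottomLayer {a : LocAlgModule G K K E A}
    {b : PairAction (lieAlgQ K) K E B} {j : B →ₗ[E] A} {ψ : Module.End E A} {c : E}
    (h : IsTwistModel a.toPairAction χ ψ c) (hG : IsAlgebraicOver ℚ G) (hKG : K ≤ G)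
    (hb : IsBottomLayer a b j) : ∃ ψ' : Module.End E B, IsTwistModel b χ ψ' c := by
  have hmem := h.apply_mem_range hG hb
  obtain ⟨hj, hjlie, hjco, Y, e, ⟨he1, he2⟩, hC, -⟩ := hb
  let ψ' : Module.End E B := (LinearEquiv.ofInjective j hj).symm.toLinearMap ∘ₗ
    (ψ ∘ₗ j).codRestrict (LinearMap.range j) hmem
  have hψ' : ∀ x, j (ψ' x) = ψ (j x) := fun x =>
    congrArg Subtype.val ((LinearEquiv.ofInjective j hj).apply_symm_apply ⟨ψ (j x), hmem x⟩)
  have hjcoeff : ∀ ℓ x, j (b.coeff ℓ x) = a.coeff ℓ (j x) := fun ℓ =>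
    LinearMap.congr_fun (coact_comm_iff.1 hjco ℓ)
  have hlie : ∀ (X : lieAlgQ K) x,
      j (b.lie X x) = a.lie ⟨X, lieAlg_mono hKG X.2⟩ (j x) := fun X => hjlie X _ rfl
  have hjC : Function.Injective (j.baseChange ℂ) :=
    Module.Flat.lTensor_preserves_injective_linearMap _ hj
  have hι : IsComplexEmbedding b Y (e.toLinearMap ∘ₗ j.baseChange ℂ) := by
    refine ⟨e.injective.comp hjC, fun X X' hX v => ?_, fun k v => ?_⟩
    · have h1 : j ∘ₗ b.lie X = a.lie ⟨X, lieAlg_mono hKG X.2⟩ ∘ₗ j := LinearMap.ext (hlie X)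
      have h2 := congrArg (LinearMap.baseChange ℂ) h1
      rw [LinearMap.baseChange_comp, LinearMap.baseChange_comp] at h2
      exact (congrArg e (LinearMap.congr_fun h2 v)).trans
        (he1 ⟨X, lieAlg_mono hKG X.2⟩ X' hX _)
    · exact (congrArg e (act_comm (coact_comm_baseChange hjco ℂ) k v)).trans (he2 k _)
  have htw := (isTwistedHom_iff _ _ _).1 h.twisted
  have hrange : (LinearMap.range (j.baseChange ℂ)).map e.toLinearMap =
      LinearMap.range (e.toLinearMap ∘ₗ j.baseChange ℂ) := (LinearMap.range_comp _ _).symm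
  rw [hrange] at hC
  refine ⟨ψ', h.algebraic, hι.act_one, hι.act_mul,
    hι.compat (H := K) h.algebraic hKG le_rfl, ⟨?_, ?_, fun U hU _ => ?_⟩, h.quadratic,
    h.nontrivial, (isTwistedHom_iff _ _ _).2 ⟨fun X => LinearMap.ext fun x => hj ?_,
      fun ℓ => LinearMap.ext fun x => hj ?_⟩, h.ne_zero, LinearMap.ext fun x => hj ?_⟩
  · exact (isStable_iff _ _).2 fun _ _ _ _ => Submodule.mem_top
  · intro h1
    refine hC.2.1 ?_
    rw [LinearMap.range_eq_map, h1, Submodule.map_bot]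
  -- A minimal `K`-type is irreducible already under the group, so stability under the Lie algebra
  -- is not needed here.
  · have h1 := (isStable_iff_act h.algebraic _ _).1 hU
    rcases hC.2.2 (U.map (e.toLinearMap ∘ₗ j.baseChange ℂ)) (by
      rintro k _ ⟨v, hv, rfl⟩
      rw [← hι.map_act]
      exact ⟨_, h1.2 k v hv, rfl⟩) LinearMap.map_le_range with h2 | h2
    · exact Or.inl (Submodule.map_injective_of_injective hι.injective
        (h2.trans (Submodule.map_bot _).symm))
    · rw [LinearMap.range_eq_map] at h2
      exact Or.inr (Submodule.map_injective_of_injective hι.injective h2)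
  · rw [Module.End.mul_apply, Module.End.mul_apply, hψ', hlie, hlie, hψ']
    exact LinearMap.congr_fun (htw.1 _) (j x)
  · rw [Module.End.mul_apply, Module.End.mul_apply, hψ', hjcoeff, hjcoeff, hψ']
    exact LinearMap.congr_fun (htw.2 _) (j x)
  · rw [Module.End.mul_apply, hψ', hψ', LinearMap.smul_apply, Module.End.one_apply, map_smul]
    exact LinearMap.congr_fun h.sq (j x)

end Cohomological

end LocAlg

end

/-! ### The equivalences -/

theorem mainTheorem11 {n : ℕ} {G K : Subgroup (LocAlg.GLC n)}
    (hG : LocAlg.IsConnectedReductive G) (hK : LocAlg.IsMaximalCompactModel G K)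
    {E : Type} [Field E] [NumberField E] [Algebra E ℂ]
    {A : Type} [AddCommGroup A] [Module E A] [Module ℚ A]
    {V : Type} [AddCommGroup V] [Module E V] [Module ℚ V]
    {A' : Type} [AddCommGroup A'] [Module E A'] [Module ℚ A']
    {V' : Type} [AddCommGroup V'] [Module E V'] [Module ℚ V']
    (a : LocAlg.LocAlgModule G K K E A) (ρ : LocAlg.LocAlgModule G K G E V)
    (hav : LocAlg.IsCohPair a ρ)
    (hmf : LocAlg.IsMultiplicityFree
      ((a.toPairAction.baseChange ℂ).restrict (LocAlg.realIdComp_le K)))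
    (a' : LocAlg.LocAlgModule G K K E A') (ρ' : LocAlg.LocAlgModule G K G E V')
    (χ : LocAlg.CompChar K)
    (hV' : LocAlg.IsTwistBy χ ρ' ρ) (hne : ¬ LocAlg.LocAlgIso ρ' ρ)
    (hA' : LocAlg.IsTwistBy χ a' a) (hC : LocAlg.ComplexIso a a')
    (E' : Type*) [Field E'] [CharZero E'] [Algebra E E'] :
    [LocAlg.CondReducible (a.toPairAction.baseChange E') χ,
      LocAlg.CondSplits (a.toPairAction.baseChange E') χ,
      LocAlg.CondSquare (a.toPairAction.baseChange E') χ,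
      LocAlg.CondScalars (a.toPairAction.baseChange E') χ].TFAE ∧
    ∀ {B : Type} [AddCommGroup B] [Module E B] [Module ℚ B]
      (b : LocAlg.PairAction (LocAlg.lieAlgQ K) K E B) (j : B →ₗ[E] A),
      LocAlg.IsBottomLayer a b j →
      [LocAlg.CondReducible (a.toPairAction.baseChange E') χ,
        LocAlg.CondReducible (b.baseChange E') χ,
        LocAlg.CondSplits (b.baseChange E') χ,
        LocAlg.CondSquare (b.baseChange E') χ,
        LocAlg.CondScalars (b.baseChange E') χ].TFAE := by
  obtain ⟨ψ, c, h⟩ := hav.exists_isTwistModel hG.algebraic hK hV' hne hA' hC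
  have tfae_of_iff : ∀ {l : List Prop} {p : Prop}, (∀ q ∈ l, q ↔ p) → l.TFAE :=
    fun hl q₁ h₁ q₂ h₂ => (hl q₁ h₁).trans (hl q₂ h₂).symm
  refine ⟨tfae_of_iff (p := ∃ α : E', α ^ 2 = algebraMap E E' c) ?_, fun b j hb => ?_⟩
  · simp only [List.forall_mem_cons, List.not_mem_nil, false_imp_iff, implies_true, and_true]
    exact ⟨h.condReducible_iff E', h.condSplits_iff E', h.condSquare_iff E', h.condScalars_iff E'⟩
  -- The restricted automorphism has the same square `c`, so the conditions on `B` and on `A` share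
  -- one criterion.
  · obtain ⟨ψ', h'⟩ := h.bottomLayer hG.algebraic hK.le hb
    refine tfae_of_iff (p := ∃ α : E', α ^ 2 = algebraMap E E' c) ?_
    simp only [List.forall_mem_cons, List.not_mem_nil, false_imp_iff, implies_true, and_true]
    exact ⟨h.condReducible_iff E', h'.condReducible_iff E', h'.condSplits_iff E',
      h'.condSquare_iff E', h'.condScalars_iff E'⟩
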